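/- Let $G$ be a compact connected Lie group with Lie algebra $\mathfrak g$. Let $V$ be the Banach space of $C^1$ maps $X=(X_0,X_1,\dots,X_7):[0,1]\to\mathfrak g\otimes\mathbb R^8$ with the $C^1$ norm, and let $\mathcal N\subset V$ be the set of solutions of the octonionic Nahm equations $$\frac{dX_i}{dt}+[X_0,X_i]+\tfrac12\sum_{j,k=1}^7 f_{ijk}[X_j,X_k]=0,\qquad i=1,\dots,7,$$ where $f_{ijk}$ is totally antisymmetric and is given by $\tfrac16\sum f_{ijk}e^{ijk}=e^{123}+e^{145}+e^{167}+e^{246}-e^{257}-e^{347}-e^{356}$. The gauge group $\mathcal G$ of $C^2$ maps $g:[0,1]\to G$ acts by $X_0\mapsto gX_0g^{-1}-\frac{dg}{dt}g^{-1}$, $X_i\mapsto gX_ig^{-1}$. Let $\mathcal G_0=\{g\in\mathcal G: g(0)=g(1)=1\}$, and let $\mathcal M=\mathcal N/\mathcal G_0$ with the quotient topology. For each $X\in\mathcal N$ there is exactly one $g\in\mathcal G$ with $g(0)=1$ whose action transforms $X_0$ to $0$, and $$\chi([X])=(g(1),X_1(0),\dots,X_7(0))$$ is a well-defined map $\chi:\mathcal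 M\to G\times(\mathfrak g\otimes\mathbb R^7)$. The space $\mathcal M$ is a smooth quotient manifold of $\mathcal N$, that is, it has a (necessarily unique) smooth structure for which the projection $\mathcal N\to\mathcal M$ is a smooth submersion (smooth, with a smooth local section through each point of $\mathcal N$). Moreover: (i) $\chi$ is a diffeomorphism of $\mathcal M$ onto an open subset $W$ of $G\times(\mathfrak g\otimes\mathbb R^7)$ that contains $G\times\{0\}$. (ii) $\chi$ is surjective if and only if $G$ is abelian. Moreover, if $\sigma_1,\sigma_2,\sigma_3\in\mathfrak g$ are non-zero and satisfy $[\sigma_1,\sigma_2]=\sigma_3$, $[\sigma_2,\sigma_3]=\sigma_1$, $[\sigma_3,\sigma_1]=\sigma_2$ (a copy of $\mathfrak{su}(2)$), then $\bigl(0,\tfrac{1}{t-1}\sigma_1,\tfrac{1}{t-1}\sigma_2,\tfrac{1}{t-1}\sigma_3,0,0,0,0\bigr)$ solves the octonionic Nahm equations for $t<1$ and blows up at $t=1$, and no point $(a,(-\sigma_1,-\sigma_2,-\sigma_3,0,0,0,0))$ with $a\in G$ lies in the image of $\chi$. (iii) The image $W$ of $\chi$ is star-shaped: if $(a,\xi)\in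 W$ and $0\le\epsilon\le1$, then $(a,\epsilon\xi)\in W$. -/

import Mathlib

open scoped Manifold ContDiff Topology unitInterval

noncomputable section

namespace OctonionicNahm

/-- The space of `C^1` maps `[0,1] → F`. An element is a pair `(f, f')` of continuous maps on
`[0,1]` such that `f'` is the derivative of `f` (one-sided at the end points). As a subspace of
`C([0,1], F) × C([0,1], F)` it carries the norm `max (‖f‖_∞, ‖f'‖_∞)`, i.e. the `C^1` norm. -/
def C1 (F : Type*) [NormedAddCommGroup F] [NormedSpace ℝ F] : Submodule ℝ (C(I, F) × C(I, F)) where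
  carrier := {p | ∀ t : I,
    HasDerivWithinAt (Set.IccExtend (zero_le_one' ℝ) p.1) (p.2 t) (Set.Icc 0 1) (t : ℝ)}
  add_mem' := by
    intro a b ha hb t
    exact (ha t).add (hb t)
  zero_mem' := by
    intro t
    exact hasDerivWithinAt_const (t : ℝ) (Set.Icc (0 : ℝ) 1) (0 : F)
  smul_mem' := by
    intro c a ha t
    exact (ha t).const_smul c

section

variable (E : Type*) [NormedAddCommGroup E] [NormedSpace ℝ E]
variable (G : Type*) [TopologicalSpace G] [ChartedSpace E G] [Group G]

/-- The Lie bracket of the Lie algebra `𝔤 = T_1 G` of `G`. In Mathlib the tangent space at each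
point of a manifold modelled on `E` is the vector space `E` itself, so `𝔤` is `E` with the bracket
of left invariant vector fields. -/
def bracket (x y : E) : E :=
  Bracket.bracket (L := GroupLieAlgebra 𝓘(ℝ, E) G) (M := GroupLieAlgebra 𝓘(ℝ, E) G) x y

/-- The term `[X_0, X] + X × X` of the octonionic Nahm equations, where `×` combines the cross
product of `ℝ⁷` with the bracket of `𝔤`. The argument is `x = (x_0, x_1, …, x_7)`; the entry of the
result with index `i : Fin 7` belongs to the equation for `X_{i+1}`. -/
def nahmTerm (x : Fin 8 → E) : Fin 7 → E :=
  let b : Fin 8 → Fin 8 → E := fun i j => bracket E G (x i) (x j)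
  ![b 0 1 + b 2 3 + b 4 5 + b 6 7,
    b 0 2 - b 1 3 + b 4 6 - b 5 7,
    b 0 3 + b 1 2 - b 4 7 - b 5 6,
    b 0 4 - b 1 5 - b 2 6 + b 3 7,
    b 0 5 + b 1 4 + b 2 7 + b 3 6,
    b 0 6 - b 1 7 + b 2 4 - b 3 5,
    b 0 7 + b 1 6 - b 2 5 - b 3 4]

/-- The space `V` of `C^1` maps `X = (X_0, X_1, …, X_7) : [0,1] → 𝔤 ⊗ ℝ⁸`. -/
abbrev V := C1 (Fin 8 → E)

variable {E} in
/-- The value `X(t)`. -/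
def value (X : V E) (t : I) : Fin 8 → E := X.1.1 t

variable {E} in
/-- The derivative `dX/dt (t)`. -/
def velocity (X : V E) (t : I) : Fin 8 → E := X.1.2 t

/-- The set of solutions of the octonionic Nahm equations on `[0,1]`. -/
def solutions : Set (V E) :=
  {X | ∀ (t : I) (i : Fin 7), velocity X t i.succ + nahmTerm E G (value X t) i = 0}

/-- The gauge group of `C^2` maps `[0,1] → G`, under pointwise multiplication. -/
def gaugeGroup [LieGroup 𝓘(ℝ, E) ∞ G] : Subgroup (I → G) where
  carrier := {g | ContMDiffOn 𝓘(ℝ, ℝ) 𝓘(ℝ, E) 2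
    (Set.IccExtend (zero_le_one' ℝ) g) (Set.Icc 0 1)}
  mul_mem' := by
    intro a b ha hb
    exact ContMDiffOn.mul ha hb
  one_mem' := by
    exact contMDiffOn_const (c := (1 : G))
  inv_mem' := by
    intro a ha
    exact ContMDiffOn.inv ha

variable {G} in
/-- The adjoint action `X ↦ g X g⁻¹` of `g` on `𝔤`: the derivative at `1` of `x ↦ g x g⁻¹`. -/
def Ad (g : G) (x : E) : E :=
  mfderiv 𝓘(ℝ, E) 𝓘(ℝ, E) (fun y : G => g * y * g⁻¹) 1 x

variable {G} in
/-- `(dg/dt) g⁻¹ ∈ 𝔤` at time `t`: the derivative at `s = t` of `s ↦ g(s) g(t)⁻¹`. -/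
def derivMulInv (g : I → G) (t : I) : E :=
  mfderivWithin 𝓘(ℝ, ℝ) 𝓘(ℝ, E) (fun s : ℝ => Set.IccExtend (zero_le_one' ℝ) g s * (g t)⁻¹)
    (Set.Icc 0 1) (t : ℝ) (1 : ℝ)

variable {E G} in
/-- The gauge action `X_0 ↦ g X_0 g⁻¹ - (dg/dt) g⁻¹`, `X_i ↦ g X_i g⁻¹` (`i = 1, …, 7`). -/
def gaugeAct (g : I → G) (X : I → Fin 8 → E) (t : I) : Fin 8 → E :=
  Fin.cons (Ad E (g t) (X t 0) - derivMulInv E g t) (fun i : Fin 7 => Ad E (g t) (X t i.succ))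

variable [LieGroup 𝓘(ℝ, E) ∞ G]

/-- Two solutions lie in the same orbit of the group `𝒢₀` of gauge transformations that are the
identity at both end points. -/
def gaugeRel (X Y : solutions E G) : Prop :=
  ∃ g ∈ gaugeGroup E G, g 0 = 1 ∧ g 1 = 1 ∧ value Y.1 = gaugeAct g (value X.1)

/-- The moduli space: the set of orbits of `𝒢₀` in the space of solutions, with the quotient of the
`C^1` topology. -/
def Moduli : Type _ := Quot (gaugeRel E G)

instance : TopologicalSpace (Moduli E G) := inferInstanceAs (TopologicalSpace (Quot _))

variable {E G} in
/-- The class `[X]` of a solution. -/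
def Moduli.mk (X : solutions E G) : Moduli E G := Quot.mk _ X

/-- `IsQuotientStructure E G c` says that the charts `c` make the moduli space a smooth manifold
which is the quotient manifold of the space of solutions: the projection `X ↦ [X]` is a smooth
submersion on the set of solutions in the Banach space `V`. (A smooth structure with this property
is unique.) The submersion property is that there is a smooth local section of the projection
through each solution. -/
structure IsQuotientStructure (c : ChartedSpace (E × (Fin 7 → E)) (Moduli E G)) : Prop where
  isManifold : IsManifold 𝓘(ℝ, E × (Fin 7 → E)) ∞ (Moduli E G)
  smooth : ∃ p : V E → Moduli E G, (∀ X : solutions E G, p X.1 = Moduli.mk X) ∧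
    ContMDiffOn 𝓘(ℝ, V E) 𝓘(ℝ, E × (Fin 7 → E)) ∞ p (solutions E G)
  sections : ∀ X : solutions E G, ∃ U : Set (Moduli E G), IsOpen U ∧ Moduli.mk X ∈ U ∧
    ∃ s : Moduli E G → V E, s (Moduli.mk X) = X.1 ∧
      ContMDiffOn 𝓘(ℝ, E × (Fin 7 → E)) 𝓘(ℝ, V E) ∞ s U ∧
      ∀ m ∈ U, ∃ h : s m ∈ solutions E G, Moduli.mk ⟨s m, h⟩ = m

end

end OctonionicNahm

end

open scoped Manifold ContDiff Topology unitInterval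

set_option linter.unusedSectionVars false

namespace OctonionicNahm

noncomputable section

/-! ### Superposition operators on spaces of continuous paths -/

section Superposition

universe u

variable {K : Type*} [TopologicalSpace K] [CompactSpace K]
variable {E : Type u} [NormedAddCommGroup E] [NormedSpace ℝ E]
variable {F : Type u} [NormedAddCommGroup F] [NormedSpace ℝ F]

/-! A gauge transformation with value `1` at time `0` that kills `X_0` is the inverse of the path
`h` in `G` with `h(0) = 1` and `h' h⁻¹ = -X_0`. Once `X_0 = 0`, the Nahm equations are an ODE `x' =
-Q(x)` on `𝔤 ⊗ ℝ⁷` with `Q` quadratic, so a solution is determined by its initial value. Hence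
`g(1)` and `X_i(0)` form a complete invariant of the `𝒢₀`-orbit (`gaugeRel_iff`), and `χ` is
injective.

Smoothness rests on local sections. The data `(g(1), X_i(0))` define a smooth map `endData` on the
whole Banach space `V`. Through every solution it has a smooth local section whose values are
solutions (`exists_endData_section`). The section combines two ingredients. First, the Nahm
equations can be solved near a given solution with prescribed `X_0` and `X_i(0)`
(`exists_nahm_section`): apply the inverse function theorem on path space, where the linearisation
is a linear ODE. Second, the holonomy `u ↦ h(1)`, for `h' h⁻¹ = u`, is smooth and has smooth local
sections (`contMDiff_hol`, `exists_hol_section`). So `χ` is an open embedding, the smooth structure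
is pulled back along it, and for any quotient structure `χ` and its inverse are locally compositions
of `endData` or the projection with a section.

Since `G` is connected, the end point can be adjusted freely. Thus `(a, ξ)` is in the image exactly
when the solution with `X_0 = 0` starting at `ξ` lives up to time `1` (`mem_range_modChi_iff`). The
rescaling `X(t) ↦ c X(ct)` makes the image star-shaped, and for abelian `G` the constant paths are
solutions.

For the blow-up, fix an invariant inner product on `𝔤`, and put `N = |x|²`, `P = -⟨x, Q(x)⟩`, `K =
|Q(x)|²`. By invariance `⟨x, Q(x)⟩` has gradient `3Q`, so `N' = 2P` and `P' = 3K`. Cauchy–Schwarz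
gives `(N/P)' = 2 - 3NK/P² ≤ -1` wherever `P > 0`, and survival up to time `1` forces `P(0) < N(0)`
(`neg_pairing_lt`). If `z = [x, y] ≠ 0`, the initial value `c(x, y, -z, 0, …)` has `P` cubic and `N`
quadratic in `c`, so it violates this for large `c`. The triple `-σ` has `P = N` and is excluded
too. -/

/-- The continuous paths with values in `O`. -/
def pathsIn (K : Type*) [TopologicalSpace K] (O : Set E) : Set C(K, E) := {z | ∀ t, z t ∈ O}

theorem isOpen_pathsIn {O : Set E} (hO : IsOpen O) : IsOpen (pathsIn K O) := by
  have : pathsIn K O = {z : C(K, E) | Set.MapsTo z Set.univ O} := by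
    ext z; simp [pathsIn, Set.MapsTo]
  rw [this]
  exact ContinuousMap.isOpen_setOfPred_mapsTo isCompact_univ hO

open Classical in
/-- The superposition operator `z ↦ f ∘ z` (with value `0` if `f ∘ z` is not continuous). -/
def superpose (f : E → F) (z : C(K, E)) : C(K, F) :=
  if h : Continuous (fun t => f (z t)) then ⟨fun t => f (z t), h⟩ else 0

theorem superpose_apply {f : E → F} {O : Set E} (hO : IsOpen O) (hf : ContinuousOn f O)
    {z : C(K, E)} (hz : z ∈ pathsIn K O) (t : K) : superpose f z t = f (z t) := by
  have h : Continuous (fun t => f (z t)) :=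
    continuous_iff_continuousAt.2 fun t =>
      ((hf.continuousAt (hO.mem_nhds (hz t))).comp (f := z) z.continuous.continuousAt)
  simp [superpose, h]

/-- Pointwise application of a path of operators to a path of vectors. -/
def pointwiseApply : C(K, E →L[ℝ] F) →L[ℝ] C(K, E) →L[ℝ] C(K, F) :=
  LinearMap.mkContinuous₂
    (LinearMap.mk₂ ℝ (fun (A : C(K, E →L[ℝ] F)) (z : C(K, E)) =>
        (⟨fun t => A t (z t), A.continuous.clm_apply z.continuous⟩ : C(K, F)))
      (fun _ _ _ => by ext; simp) (fun _ _ _ => by ext; simp)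
      (fun _ _ _ => by ext; simp) (fun _ _ _ => by ext; simp)) 1
    (fun A z => by
      refine (ContinuousMap.norm_le _ (by positivity)).2 fun t => ?_
      simp only [LinearMap.mk₂_apply, ContinuousMap.coe_mk, one_mul]
      exact (A t).le_of_opNorm_le_of_le (A.norm_coe_le_norm t) (z.norm_coe_le_norm t))

@[simp] theorem pointwiseApply_apply (A : C(K, E →L[ℝ] F)) (z : C(K, E)) (t : K) :
    pointwiseApply A z t = A t (z t) := rfl

theorem contDiff_pointwiseApply {n : WithTop ℕ∞} :
    ContDiff ℝ n (pointwiseApply : C(K, E →L[ℝ] F) → C(K, E) →L[ℝ] C(K, F)) :=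
  ContinuousLinearMap.contDiff (𝕜 := ℝ) (E := C(K, E →L[ℝ] F))
    (F := C(K, E) →L[ℝ] C(K, F)) pointwiseApply

/-- Uniform version of continuity along a compact path. -/
theorem exists_uniform_dist_lt {f : E → F} {O : Set E} (hO : IsOpen O) (hf : ContinuousOn f O)
    {z : C(K, E)} (hz : z ∈ pathsIn K O) {ε : ℝ} (hε : 0 < ε) :
    ∃ δ > 0, ∀ t : K, ∀ y, dist (z t) y < δ → dist (f (z t)) (f y) < ε := by
  have hc : IsCompact (Set.range z) := isCompact_range z.continuous
  have := hc.uniformContinuousAt_of_continuousAt f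
    (fun a ⟨t, ht⟩ => hf.continuousAt (hO.mem_nhds (ht ▸ hz t))) (Metric.dist_mem_uniformity hε)
  obtain ⟨δ, hδ, h⟩ := Metric.mem_uniformity_dist.1 this
  exact ⟨δ, hδ, fun t y hy => h hy ⟨t, rfl⟩⟩

theorem continuousOn_superpose {f : E → F} {O : Set E} (hO : IsOpen O) (hf : ContinuousOn f O) :
    ContinuousOn (superpose (K := K) f) (pathsIn K O) := by
  intro z hz
  refine ContinuousAt.continuousWithinAt (Metric.continuousAt_iff.2 fun ε hε => ?_)
  obtain ⟨δ, hδ, h⟩ := exists_uniform_dist_lt hO hf hz (half_pos hε)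
  obtain ⟨δ', hδ', h'⟩ := Metric.isOpen_iff.1 (isOpen_pathsIn hO) z hz
  refine ⟨min δ δ', lt_min hδ hδ', fun {w} hw => ?_⟩
  refine lt_of_le_of_lt ((ContinuousMap.dist_le (half_pos hε).le).2 fun t => ?_) (half_lt_self hε)
  rw [superpose_apply hO hf hz, superpose_apply hO hf (h' (lt_of_lt_of_le hw (min_le_right _ _))),
    dist_comm]
  exact (h t _ (lt_of_le_of_lt ((ContinuousMap.dist_apply_le_dist t).trans_eq (dist_comm _ _))
    (lt_of_lt_of_le hw (min_le_left _ _)))).le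

/-- The remainder is estimated pointwise by the mean value inequality on a ball about `z t`.
Compactness of the path makes the radius of the ball and the modulus of continuity of `f'`
independent of `t`. -/
theorem hasFDerivAt_superpose {f : E → F} {O : Set E} (hO : IsOpen O)
    (hf : ∀ x ∈ O, DifferentiableAt ℝ f x) (hf' : ContinuousOn (fderiv ℝ f) O)
    {z : C(K, E)} (hz : z ∈ pathsIn K O) :
    HasFDerivAt (superpose (K := K) f) (pointwiseApply (superpose (fderiv ℝ f) z)) z := by
  have hfc : ContinuousOn f O := fun x hx => (hf x hx).continuousAt.continuousWithinAt
  rw [hasFDerivAt_iff_isLittleO_nhds_zero, Asymptotics.isLittleO_iff]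
  intro ε hε
  obtain ⟨δ, hδ, h⟩ := exists_uniform_dist_lt hO hf' hz hε
  obtain ⟨δ', hδ', h'⟩ := (isCompact_range z.continuous).exists_thickening_subset_open hO
    (Set.range_subset_iff.2 hz)
  have hball : ∀ t, Metric.ball (z t) (min δ δ') ⊆ O := fun t =>
    (Metric.ball_subset_ball (min_le_right _ _)).trans
      ((Metric.ball_subset_thickening (Set.mem_range_self t) _).trans h')
  filter_upwards [Metric.ball_mem_nhds (0 : C(K, E)) (lt_min hδ hδ')] with w hw
  have hwt : ∀ t, z t + w t ∈ Metric.ball (z t) (min δ δ') := fun t => by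
    rw [mem_ball_iff_norm, add_sub_cancel_left]
    exact lt_of_le_of_lt (w.norm_coe_le_norm t) (mem_ball_zero_iff.1 hw)
  refine (ContinuousMap.norm_le _ (by positivity)).2 fun t => ?_
  have hzw : z + w ∈ pathsIn K O := fun t => hball t (hwt t)
  simp only [ContinuousMap.sub_apply, pointwiseApply_apply, superpose_apply hO hfc hz,
    superpose_apply hO hfc hzw, superpose_apply hO hf' hz, ContinuousMap.add_apply]
  have key := (convex_ball (z t) (min δ δ')).norm_image_sub_le_of_norm_hasFDerivWithin_le'
    (f := f) (f' := fderiv ℝ f) (φ := fderiv ℝ f (z t)) (C := ε)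
    (fun y hy => (hf y (hball t hy)).hasFDerivAt.hasFDerivWithinAt)
    (fun y hy => by
      rw [← dist_eq_norm, dist_comm]
      exact (h t y (lt_of_lt_of_le (by rw [dist_comm]; exact hy) (min_le_left _ _))).le)
    (Metric.mem_ball_self (lt_min hδ hδ')) (hwt t)
  rw [add_sub_cancel_left] at key
  exact key.trans (mul_le_mul_of_nonneg_left (w.norm_coe_le_norm t) hε.le)

/-- The derivative at `z` is pointwise application of the superposition of `f'`, so smoothness
follows by induction. The target changes from `F` to `E →L[ℝ] F`; it is therefore quantified inside
the induction, and both spaces share a universe. -/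
theorem contDiffOn_superpose_nat {E : Type u} [NormedAddCommGroup E] [NormedSpace ℝ E]
    {O : Set E} (hO : IsOpen O) (n : ℕ) :
    ∀ {F : Type u} [NormedAddCommGroup F] [NormedSpace ℝ F] {f : E → F},
    ContDiffOn ℝ n f O → ContDiffOn ℝ n (superpose (K := K) f) (pathsIn K O) := by
  induction n with
  | zero =>
    intro F _ _ f hf
    exact contDiffOn_zero.2 (continuousOn_superpose hO hf.continuousOn)
  | succ n ih =>
    intro F _ _ f hf
    push_cast at hf ⊢
    rw [contDiffOn_succ_iff_fderiv_of_isOpen hO] at hf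
    have hd : ∀ x ∈ O, DifferentiableAt ℝ f x := fun x hx => (hf.1 x hx).differentiableAt
      (hO.mem_nhds hx)
    have hder := fun z hz => hasFDerivAt_superpose (K := K) hO hd hf.2.2.continuousOn (z := z) hz
    rw [contDiffOn_succ_iff_fderiv_of_isOpen (isOpen_pathsIn hO)]
    refine ⟨fun z hz => (hder z hz).differentiableAt.differentiableWithinAt, by simp, ?_⟩
    have hcomp : ContDiffOn ℝ n
        (fun z => pointwiseApply (K := K) (superpose (fderiv ℝ f) z)) (pathsIn K O) :=
      contDiff_pointwiseApply.comp_contDiffOn (ih hf.2.2)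
    exact hcomp.congr fun z hz => (hder z hz).fderiv

theorem contDiffOn_superpose {O : Set E} (hO : IsOpen O) {f : E → F} (hf : ContDiffOn ℝ ∞ f O) :
    ContDiffOn ℝ ∞ (superpose (K := K) f) (pathsIn K O) :=
  contDiffOn_infty.2 fun n => contDiffOn_superpose_nat hO n (contDiffOn_infty.1 hf n)

end Superposition

/-! ### The space of `C^1` paths and linear differential equations -/

section LinearODE

variable {F : Type*} [NormedAddCommGroup F] [NormedSpace ℝ F]

namespace C1

/-- The underlying continuous path. -/
def val : C1 F →L[ℝ] C(I, F) := (ContinuousLinearMap.fst ℝ _ _).comp (C1 F).subtypeL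

/-- The derivative of the path. -/
def der : C1 F →L[ℝ] C(I, F) := (ContinuousLinearMap.snd ℝ _ _).comp (C1 F).subtypeL

/-- Evaluation at a time. -/
def eval (t : I) : C1 F →L[ℝ] F := (ContinuousMap.evalCLM ℝ t).comp val

theorem contDiff_val_apply {n : WithTop ℕ∞} (t : I) : ContDiff ℝ n (fun y : C1 F => val y t) :=
  ContinuousLinearMap.contDiff (𝕜 := ℝ) (E := C1 F) (F := F) (eval t)

theorem contDiff_val {n : WithTop ℕ∞} : ContDiff ℝ n (val : C1 F → C(I, F)) :=
  ContinuousLinearMap.contDiff (𝕜 := ℝ) (E := C1 F) (F := C(I, F)) val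

theorem contDiff_der {n : WithTop ℕ∞} : ContDiff ℝ n (der : C1 F → C(I, F)) :=
  ContinuousLinearMap.contDiff (𝕜 := ℝ) (E := C1 F) (F := C(I, F)) der

theorem hasFDerivAt_val_apply (t : I) (y : C1 F) :
    HasFDerivAt (fun y : C1 F => val y t) (eval t : C1 F →L[ℝ] F) y :=
  ContinuousLinearMap.hasFDerivAt (𝕜 := ℝ) (E := C1 F) (F := F) (eval t)

theorem hasFDerivAt_val (y : C1 F) :
    HasFDerivAt (val : C1 F → C(I, F)) (val : C1 F →L[ℝ] C(I, F)) y :=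
  ContinuousLinearMap.hasFDerivAt (𝕜 := ℝ) (E := C1 F) (F := C(I, F)) val

theorem hasFDerivAt_der (y : C1 F) :
    HasFDerivAt (der : C1 F → C(I, F)) (der : C1 F →L[ℝ] C(I, F)) y :=
  ContinuousLinearMap.hasFDerivAt (𝕜 := ℝ) (E := C1 F) (F := C(I, F)) der

theorem hasDerivWithinAt (y : C1 F) (t : I) :
    HasDerivWithinAt (Set.IccExtend (zero_le_one' ℝ) (val y)) (der y t) (Set.Icc 0 1) (t : ℝ) :=
  y.2 t

/-- The `C^1` path with given value and derivative. -/
def mk (f f' : C(I, F)) (h : ∀ t : I,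
    HasDerivWithinAt (Set.IccExtend (zero_le_one' ℝ) f) (f' t) (Set.Icc 0 1) (t : ℝ)) : C1 F :=
  ⟨(f, f'), h⟩

theorem ext_val_der {y z : C1 F} (h : val y = val z) (h' : der y = der z) : y = z :=
  Subtype.ext (Prod.ext h h')

end C1

/-- Two functions with the same derivative on `[0,1]` and the same initial value agree. -/
theorem eq_of_hasDerivWithinAt {f g : ℝ → F} {f' : ℝ → F}
    (hf : ∀ t ∈ Set.Icc (0 : ℝ) 1, HasDerivWithinAt f (f' t) (Set.Icc 0 1) t)
    (hg : ∀ t ∈ Set.Icc (0 : ℝ) 1, HasDerivWithinAt g (f' t) (Set.Icc 0 1) t)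
    (h0 : f 0 = g 0) {t : ℝ} (ht : t ∈ Set.Icc (0 : ℝ) 1) : f t = g t := by
  have key := (convex_Icc (0 : ℝ) 1).norm_image_sub_le_of_norm_hasDerivWithin_le (C := 0)
    (f := fun s => f s - g s) (f' := fun s => f' s - f' s)
    (fun s hs => (hf s hs).sub (hg s hs)) (fun s _ => by simp)
    (Set.left_mem_Icc.2 zero_le_one) ht
  simp only [h0, sub_self, sub_zero, zero_mul, norm_le_zero_iff] at key
  exact sub_eq_zero.1 key

theorem C1.ext_of_der {y z : C1 F} (h0 : C1.val y 0 = C1.val z 0) (h : C1.der y = C1.der z) :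
    y = z := by
  refine C1.ext_val_der (ContinuousMap.ext fun t => ?_) h
  have := eq_of_hasDerivWithinAt (f := Set.IccExtend (zero_le_one' ℝ) (C1.val y))
    (g := Set.IccExtend (zero_le_one' ℝ) (C1.val z))
    (f' := Set.IccExtend (zero_le_one' ℝ) (C1.der y))
    (fun s hs => by
      rw [Set.IccExtend_of_mem _ _ hs]; exact C1.hasDerivWithinAt y ⟨s, hs⟩)
    (fun s hs => by
      rw [Set.IccExtend_of_mem _ _ hs, h]; exact C1.hasDerivWithinAt z ⟨s, hs⟩)
    (by simpa using h0) t.2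
  simpa using this

variable [CompleteSpace F]

/-- The primitive `t ↦ ∫ s in 0..t, w s` of a continuous path. -/
def primitiveFun (w : C(I, F)) (t : ℝ) : F :=
  ∫ s in (0 : ℝ)..t, Set.IccExtend (zero_le_one' ℝ) w s

theorem hasDerivAt_primitiveFun (w : C(I, F)) (t : ℝ) :
    HasDerivAt (primitiveFun w) (Set.IccExtend (zero_le_one' ℝ) w t) t := by
  have hc : Continuous (Set.IccExtend (zero_le_one' ℝ) w) := w.continuous.Icc_extend'
  exact intervalIntegral.integral_hasDerivAt_right (hc.intervalIntegrable _ _)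
    (hc.stronglyMeasurableAtFilter _ _) hc.continuousAt

/-- The power of `t` is kept in the bound because iterating it produces the factorial in the
estimate for Volterra operators. -/
theorem norm_primitiveFun_le (w : C(I, F)) (n : ℕ) {C : ℝ}
    (h : ∀ s : I, ‖w s‖ ≤ C * (s : ℝ) ^ n) (t : I) :
    ‖primitiveFun w t‖ ≤ C * (t : ℝ) ^ (n + 1) / (n + 1) := by
  have ht := t.2
  have := intervalIntegral.norm_integral_le_of_norm_le (f := Set.IccExtend (zero_le_one' ℝ) w)
    (μ := MeasureTheory.volume) (g := fun s => C * s ^ n) ht.1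
    (Filter.Eventually.of_forall fun s hs => by
      have hs' : s ∈ Set.Icc (0 : ℝ) 1 := ⟨hs.1.le, hs.2.trans ht.2⟩
      rw [Set.IccExtend_of_mem _ _ hs']
      exact h ⟨s, hs'⟩) (Continuous.intervalIntegrable (by fun_prop) _ _)
  refine this.trans_eq ?_
  rw [intervalIntegral.integral_const_mul, integral_pow]
  simp [mul_div_assoc]

/-- Integration from `0` as an operator on continuous paths. -/
def primitive : C(I, F) →L[ℝ] C(I, F) :=
  LinearMap.mkContinuous
    { toFun := fun w => ⟨fun t => primitiveFun w t,
        (continuous_iff_continuousAt.2 fun t =>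
          (hasDerivAt_primitiveFun w t).continuousAt).comp continuous_subtype_val⟩
      map_add' := fun v w => by
        ext t
        have hv : Continuous (Set.IccExtend (zero_le_one' ℝ) v) := v.continuous.Icc_extend'
        have hw : Continuous (Set.IccExtend (zero_le_one' ℝ) w) := w.continuous.Icc_extend'
        exact intervalIntegral.integral_add (hv.intervalIntegrable _ _)
          (hw.intervalIntegrable _ _)
      map_smul' := fun c w => by
        ext t
        exact intervalIntegral.integral_smul c _ } 1
    (fun w => by
      refine (ContinuousMap.norm_le _ (by positivity)).2 fun t => ?_
      refine (norm_primitiveFun_le w 0 (C := ‖w‖) (fun s => by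
        simpa using w.norm_coe_le_norm s) t).trans ?_
      have := t.2.2
      have := norm_nonneg w
      simp only [zero_add, pow_one, Nat.cast_zero, div_one, one_mul]
      nlinarith)

theorem primitive_apply (w : C(I, F)) (t : I) : primitive w t = primitiveFun w t := rfl

theorem primitive_zero_time (w : C(I, F)) : primitive w 0 = 0 := by
  simp [primitive_apply, primitiveFun]

theorem hasDerivWithinAt_primitive (w : C(I, F)) (t : I) :
    HasDerivWithinAt (Set.IccExtend (zero_le_one' ℝ) (primitive w)) (w t) (Set.Icc 0 1) (t : ℝ) := by
  have := (hasDerivAt_primitiveFun w t).hasDerivWithinAt (s := Set.Icc 0 1)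
  rw [Set.IccExtend_val] at this
  refine this.congr (fun s hs => ?_) ?_
  · rw [Set.IccExtend_of_mem _ _ hs, primitive_apply]
  · rw [Set.IccExtend_val, primitive_apply]

/-- The constant paths. -/
def constPath : F →L[ℝ] C(I, F) := ContinuousLinearMap.const ℝ I

@[simp] theorem constPath_apply (v : F) (t : I) : constPath v t = v := rfl

/-- The `C^1` path with initial value `v` and derivative `w`. -/
def C1.ofDer (v : F) (w : C(I, F)) : C1 F :=
  C1.mk (constPath v + primitive w) w fun t => by
    have := (hasDerivWithinAt_primitive w t).const_add v
    exact this

@[simp] theorem C1.ofDer_zero (v : F) (w : C(I, F)) : C1.val (C1.ofDer v w) 0 = v := by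
  change v + primitive w 0 = v
  rw [primitive_zero_time, add_zero]

@[simp] theorem C1.der_ofDer (v : F) (w : C(I, F)) : C1.der (C1.ofDer v w) = w := rfl

/-- A `C^1` path is determined by its initial value and its derivative. -/
def C1.equiv : C1 F ≃L[ℝ] F × C(I, F) where
  toFun y := (C1.val y 0, C1.der y)
  invFun p := C1.ofDer p.1 p.2
  left_inv y := C1.ext_of_der (by simp) (by simp)
  right_inv p := by simp
  map_add' _ _ := rfl
  map_smul' _ _ := rfl
  continuous_toFun := ((continuous_eval_const (0 : I)).comp C1.val.continuous).prodMk
    C1.der.continuous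
  continuous_invFun := by
    refine Continuous.subtype_mk (Continuous.prodMk ?_ continuous_snd) _
    exact (constPath.continuous.comp continuous_fst).add
      (primitive.continuous.comp continuous_snd)

instance : CompleteSpace (C1 F) :=
  (completeSpace_congr (e := (C1.equiv (F := F)).toEquiv)
    (C1.equiv (F := F)).isUniformEmbedding).2 inferInstance

theorem norm_pow_pointwiseApply_comp_primitive_le (A : C(I, F →L[ℝ] F)) (n : ℕ) (w : C(I, F))
    (t : I) : ‖(((pointwiseApply A).comp primitive) ^ n) w t‖ ≤
      ‖A‖ ^ n * ‖w‖ / n.factorial * (t : ℝ) ^ n := by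
  induction n generalizing t with
  | zero => simpa using w.norm_coe_le_norm t
  | succ n ih =>
    rw [pow_succ']
    simp only [mul_apply_eq_comp, ContinuousLinearMap.comp_apply,
      pointwiseApply_apply, primitive_apply]
    refine ((A t).le_of_opNorm_le_of_le (A.norm_coe_le_norm t)
      (norm_primitiveFun_le _ n ih t)).trans_eq ?_
    rw [Nat.factorial_succ]
    push_cast
    field_simp
    ring

/-- The powers of the Volterra operator `T` decay like `‖A‖ ^ n / n!`, so some `T ^ n` has norm
below `1` and `1 - T ^ n` is invertible. It is the product of the commuting factors `1 - T` and `∑ T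
^ i`, so `1 - T` is invertible without any smallness of `A`. -/
theorem isUnit_one_sub_pointwiseApply_comp_primitive (A : C(I, F →L[ℝ] F)) :
    IsUnit (1 - (pointwiseApply A).comp primitive) := by
  set T := (pointwiseApply A).comp primitive with hT
  obtain ⟨n, hn⟩ := ((FloorSemiring.tendsto_pow_div_factorial_atTop ‖A‖).eventually
    (gt_mem_nhds (show (0 : ℝ) < 1 / 2 by norm_num))).exists
  have hnorm : ‖T ^ n‖ < 1 := by
    refine lt_of_le_of_lt (ContinuousLinearMap.opNorm_le_bound _
      (show (0 : ℝ) ≤ 1 / 2 by norm_num) fun w => ?_) (show (1 / 2 : ℝ) < 1 by norm_num)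
    refine (ContinuousMap.norm_le _ (by positivity)).2 fun t => ?_
    refine (norm_pow_pointwiseApply_comp_primitive_le A n w t).trans ?_
    have ht : (t : ℝ) ^ n ≤ 1 := pow_le_one₀ t.2.1 t.2.2
    calc ‖A‖ ^ n * ‖w‖ / n.factorial * (t : ℝ) ^ n ≤ ‖A‖ ^ n * ‖w‖ / n.factorial * 1 :=
          mul_le_mul_of_nonneg_left ht (by positivity)
      _ = ‖A‖ ^ n / n.factorial * ‖w‖ := by ring
      _ ≤ 1 / 2 * ‖w‖ := mul_le_mul_of_nonneg_right hn.le (norm_nonneg _)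
  have hu := (Units.oneSub (R := C(I, F) →L[ℝ] C(I, F)) (T ^ n) hnorm).isUnit
  rw [Units.val_oneSub, ← mul_neg_geom_sum] at hu
  exact ((Commute.sum_right _ _ _ fun i _ =>
    ((Commute.one_left T).sub_left (Commute.refl T)).pow_right i).isUnit_mul_iff.1 hu).1

/-- The inhomogeneous linear equation `y' = A y + b` has exactly one solution with given initial
value. -/
theorem existsUnique_linearODE (A : C(I, F →L[ℝ] F)) (b : C(I, F)) (ξ : F) :
    ∃! y : C1 F, C1.val y 0 = ξ ∧ C1.der y = pointwiseApply A (C1.val y) + b := by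
  obtain ⟨S, hS⟩ := isUnit_one_sub_pointwiseApply_comp_primitive A
  have hval : ∀ y : C1 F, C1.val y = constPath (C1.val y 0) + primitive (C1.der y) := fun y => by
    conv_lhs => rw [← C1.equiv.symm_apply_apply y]
    rfl
  have hinv : ∀ w, S.inv (w - pointwiseApply A (primitive w)) = w := fun w => by
    have := congrArg (fun T => T w) S.inv_val
    simpa [hS] using this
  have hinv' : ∀ w, S.inv w - pointwiseApply A (primitive (S.inv w)) = w := fun w => by
    have := congrArg (fun T => T w) S.val_inv
    rw [hS] at this
    exact this
  -- For `w = y'` the equation reads `w = A (ξ + ∫ w) + b`, that is `(1 - T) w = b + A ξ`.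
  set w := S.inv (b + pointwiseApply A (constPath ξ)) with hw
  refine ⟨C1.ofDer ξ w, ⟨by simp, ?_⟩, ?_⟩
  · have h1 := hinv' (b + pointwiseApply A (constPath ξ))
    rw [← hw] at h1
    rw [hval (C1.ofDer _ _), C1.ofDer_zero, C1.der_ofDer, map_add]
    rw [← sub_eq_zero] at h1 ⊢
    rw [← h1]
    abel
  · rintro y ⟨h0, h⟩
    refine C1.ext_of_der (by simp [h0]) ?_
    rw [C1.der_ofDer, hw, ← hinv (C1.der y)]
    congr 1
    rw [hval, h0, map_add] at h
    refine sub_eq_iff_eq_add.2 (h.trans ?_)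
    abel

end LinearODE

end

end OctonionicNahm

namespace OctonionicNahm

noncomputable section

/-! ### Calculus in the chart at the identity of a Lie group -/

section ChartCalculus

variable (E : Type*) [NormedAddCommGroup E] [NormedSpace ℝ E]
variable (G : Type*) [TopologicalSpace G] [ChartedSpace E G] [Group G]

variable {G} in
/-- The chart at the identity. -/
def toE : G → E := extChartAt 𝓘(ℝ, E) (1 : G)

variable {E} in
/-- The inverse of the chart at the identity. -/
def ofE : E → G := (extChartAt 𝓘(ℝ, E) (1 : G)).symm

/-- The image of the identity under its chart. -/
def origin : E := toE E (1 : G)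

/-- The domain of the chart at the identity. -/
def src : Set G := (extChartAt 𝓘(ℝ, E) (1 : G)).source

/-- The range of the chart at the identity. -/
def dom : Set E := (extChartAt 𝓘(ℝ, E) (1 : G)).target

theorem isOpen_src : IsOpen (src E G) := isOpen_extChartAt_source _

theorem isOpen_dom : IsOpen (dom E G) := isOpen_extChartAt_target _

theorem one_mem_src : (1 : G) ∈ src E G := mem_extChartAt_source _

theorem src_mem_nhds : src E G ∈ 𝓝 (1 : G) := (isOpen_src E G).mem_nhds (one_mem_src E G)

theorem origin_mem_dom : origin E G ∈ dom E G :=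
  (extChartAt 𝓘(ℝ, E) (1 : G)).map_source (one_mem_src E G)

theorem dom_mem_nhds : dom E G ∈ 𝓝 (origin E G) :=
  (isOpen_dom E G).mem_nhds (origin_mem_dom E G)

variable {E G}

theorem ofE_toE {g : G} (hg : g ∈ src E G) : ofE G (toE E g) = g :=
  (extChartAt 𝓘(ℝ, E) (1 : G)).left_inv hg

theorem toE_ofE {x : E} (hx : x ∈ dom E G) : toE E (ofE G x) = x :=
  (extChartAt 𝓘(ℝ, E) (1 : G)).right_inv hx

theorem ofE_mem_src {x : E} (hx : x ∈ dom E G) : ofE G x ∈ src E G :=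
  (extChartAt 𝓘(ℝ, E) (1 : G)).map_target hx

theorem toE_mem_dom {g : G} (hg : g ∈ src E G) : toE E g ∈ dom E G :=
  (extChartAt 𝓘(ℝ, E) (1 : G)).map_source hg

@[simp] theorem ofE_origin : ofE G (origin E G) = 1 := ofE_toE (one_mem_src E G)

theorem toE_one : toE E (1 : G) = origin E G := rfl

variable [LieGroup 𝓘(ℝ, E) ∞ G]

instance isManifold_of_lieGroup : IsManifold 𝓘(ℝ, E) ∞ G :=
  inferInstance

theorem contMDiffAt_ofE {x : E} (hx : x ∈ dom E G) :
    ContMDiffAt 𝓘(ℝ, E) 𝓘(ℝ, E) ∞ (ofE G) x :=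
  
  ContMDiffOn.contMDiffAt (contMDiffOn_extChartAt_symm (1 : G)) ((isOpen_dom E G).mem_nhds hx)

theorem contMDiffAt_toE {g : G} (hg : g ∈ src E G) :
    ContMDiffAt 𝓘(ℝ, E) 𝓘(ℝ, E) ∞ (toE E) g :=
  contMDiffAt_extChartAt' (by rw [← extChartAt_source 𝓘(ℝ, E)]; exact hg)

theorem continuousAt_ofE {x : E} (hx : x ∈ dom E G) : ContinuousAt (ofE G) x :=
  (contMDiffAt_ofE hx).continuousAt

theorem continuousAt_toE {g : G} (hg : g ∈ src E G) : ContinuousAt (toE E) g :=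
  (contMDiffAt_toE hg).continuousAt

include E in
variable (E G) in
theorem isTopologicalGroup : IsTopologicalGroup G :=
  topologicalGroup_of_lieGroup 𝓘(ℝ, E) ∞

theorem ContMDiffAt.contDiffAt_toE {E' : Type*} [NormedAddCommGroup E'] [NormedSpace ℝ E']
    {f : E' → G} {x : E'} {n : WithTop ℕ∞} (hn : n ≤ ∞)
    (hf : ContMDiffAt 𝓘(ℝ, E') 𝓘(ℝ, E) n f x) (hx : f x ∈ src E G) :
    ContDiffAt ℝ n (fun y => toE E (f y)) x :=
  contMDiffAt_iff_contDiffAt.1 (((contMDiffAt_toE hx).of_le hn).comp x hf)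

variable (E G) in
/-- Multiplication in the chart at the identity. -/
def mulE (p : E × E) : E := toE E (ofE G p.1 * ofE G p.2)

variable (E G) in
/-- Right division in the chart at the identity. -/
def divE (p : E × E) : E := toE E (ofE G p.1 * (ofE G p.2)⁻¹)

variable (E G) in
/-- Conjugation `(x, y) ↦ x y x⁻¹` in the chart at the identity. -/
def conjE (p : E × E) : E := toE E (ofE G p.1 * ofE G p.2 * (ofE G p.1)⁻¹)

theorem contMDiffAt_ofE_fst {p : E × E} (h : p.1 ∈ dom E G) :
    ContMDiffAt 𝓘(ℝ, E × E) 𝓘(ℝ, E) ∞ (fun p : E × E => ofE G p.1) p :=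
  ContMDiffAt.comp (I' := 𝓘(ℝ, E)) p (contMDiffAt_ofE h) contDiffAt_fst.contMDiffAt

theorem contMDiffAt_ofE_snd {p : E × E} (h : p.2 ∈ dom E G) :
    ContMDiffAt 𝓘(ℝ, E × E) 𝓘(ℝ, E) ∞ (fun p : E × E => ofE G p.2) p :=
  ContMDiffAt.comp (I' := 𝓘(ℝ, E)) p (contMDiffAt_ofE h) contDiffAt_snd.contMDiffAt

theorem contDiffAt_mulE {x y : E} (hx : x ∈ dom E G) (hy : y ∈ dom E G)
    (h : ofE G x * ofE G y ∈ src E G) : ContDiffAt ℝ ∞ (mulE E G) (x, y) :=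
  ContMDiffAt.contDiffAt_toE le_rfl ((contMDiffAt_ofE_fst hx).mul (contMDiffAt_ofE_snd hy)) h

theorem contDiffAt_divE {x y : E} (hx : x ∈ dom E G) (hy : y ∈ dom E G)
    (h : ofE G x * (ofE G y)⁻¹ ∈ src E G) : ContDiffAt ℝ ∞ (divE E G) (x, y) :=
  ContMDiffAt.contDiffAt_toE le_rfl
    ((contMDiffAt_ofE_fst hx).mul (contMDiffAt_ofE_snd hy).inv) h

theorem contDiffAt_conjE {x y : E} (hx : x ∈ dom E G) (hy : y ∈ dom E G)
    (h : ofE G x * ofE G y * (ofE G x)⁻¹ ∈ src E G) : ContDiffAt ℝ ∞ (conjE E G) (x, y) :=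
  ContMDiffAt.contDiffAt_toE le_rfl
    (((contMDiffAt_ofE_fst hx).mul (contMDiffAt_ofE_snd hy)).mul (contMDiffAt_ofE_fst hx).inv) h

theorem contDiffAt_mulE_left {y : E} (hy : y ∈ dom E G) :
    ContDiffAt ℝ ∞ (mulE E G) (origin E G, y) :=
  contDiffAt_mulE (origin_mem_dom E G) hy (by simpa using ofE_mem_src hy)

theorem contDiffAt_mulE_right {y : E} (hy : y ∈ dom E G) :
    ContDiffAt ℝ ∞ (mulE E G) (y, origin E G) :=
  contDiffAt_mulE hy (origin_mem_dom E G) (by simpa using ofE_mem_src hy)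

theorem contDiffAt_divE_diag {y : E} (hy : y ∈ dom E G) : ContDiffAt ℝ ∞ (divE E G) (y, y) :=
  contDiffAt_divE hy hy (by simpa using one_mem_src E G)

theorem contDiffAt_conjE_right {y : E} (hy : y ∈ dom E G) :
    ContDiffAt ℝ ∞ (conjE E G) (y, origin E G) :=
  contDiffAt_conjE hy (origin_mem_dom E G) (by simpa using one_mem_src E G)

theorem mulE_origin_left {y : E} (hy : y ∈ dom E G) : mulE E G (origin E G, y) = y := by
  simp [mulE, toE_ofE hy]

theorem mulE_origin_right {y : E} (hy : y ∈ dom E G) : mulE E G (y, origin E G) = y := by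
  simp [mulE, toE_ofE hy]

theorem fderiv_mulE_origin (v w : E) :
    fderiv ℝ (mulE E G) (origin E G, origin E G) (v, w) = v + w := by
  have hd := (contDiffAt_mulE_left (origin_mem_dom E G)).differentiableAt (by simp)
  have h1 : HasFDerivAt (fun y => mulE E G (origin E G, y))
      ((fderiv ℝ (mulE E G) (origin E G, origin E G)).comp (ContinuousLinearMap.inr ℝ E E))
      (origin E G) :=
    hd.hasFDerivAt.comp (origin E G) (hasFDerivAt_prodMk_right (origin E G) (origin E G))
  have h2 : HasFDerivAt (fun y => mulE E G (y, origin E G))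
      ((fderiv ℝ (mulE E G) (origin E G, origin E G)).comp (ContinuousLinearMap.inl ℝ E E))
      (origin E G) :=
    HasFDerivAt.comp (f := fun y => (y, origin E G)) (origin E G) hd.hasFDerivAt
      (hasFDerivAt_prodMk_left (origin E G) (origin E G))
  have h1' := h1.unique ((hasFDerivAt_id (origin E G)).congr_of_eventuallyEq
    (Filter.eventually_of_mem (dom_mem_nhds E G) fun y hy => mulE_origin_left hy))
  have h2' := h2.unique ((hasFDerivAt_id (origin E G)).congr_of_eventuallyEq
    (Filter.eventually_of_mem (dom_mem_nhds E G) fun y hy => mulE_origin_right hy))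
  have e1 := congrArg (fun T => T w) h1'
  have e2 := congrArg (fun T => T v) h2'
  simp only [ContinuousLinearMap.comp_apply, ContinuousLinearMap.inr_apply,
    ContinuousLinearMap.inl_apply, ContinuousLinearMap.id_apply] at e1 e2
  rw [show (v, w) = ((v, 0) : E × E) + (0, w) by simp, map_add, e1, e2]

/-- The partial derivative of a function of two variables, as a function on the domain of
smoothness. -/
theorem contDiffAt_fderiv_comp {E₁ E₂ E₃ F : Type*} [NormedAddCommGroup E₁] [NormedSpace ℝ E₁]
    [NormedAddCommGroup E₂] [NormedSpace ℝ E₂] [NormedAddCommGroup E₃] [NormedSpace ℝ E₃]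
    [NormedAddCommGroup F] [NormedSpace ℝ F]
    {f : E₂ → F} {c : E₁ → E₂} {x : E₁} (hf : ContDiffAt ℝ ∞ f (c x)) (hc : ContDiffAt ℝ ∞ c x)
    (T : E₃ →L[ℝ] E₂) : ContDiffAt ℝ ∞ (fun y => (fderiv ℝ f (c y)).comp T) x :=
  ((hf.fderiv_right (m := ∞) (by simp)).comp x hc).clm_comp contDiffAt_const

variable (E G) in
/-- The adjoint action of `ofE G x`, as a function of the coordinate `x`. -/
def adChart (x : E) : E →L[ℝ] E :=
  (fderiv ℝ (conjE E G) (x, origin E G)).comp (ContinuousLinearMap.inr ℝ E E)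

variable (E G) in
/-- The right logarithmic derivative of a path in the chart is `logCoeff z z'`. -/
def logCoeff (x : E) : E →L[ℝ] E :=
  (fderiv ℝ (divE E G) (x, x)).comp (ContinuousLinearMap.inl ℝ E E)

variable (E G) in
/-- A path in the chart with right logarithmic derivative `u` solves `z' = expCoeff z u`. -/
def expCoeff (x : E) : E →L[ℝ] E :=
  (fderiv ℝ (mulE E G) (origin E G, x)).comp (ContinuousLinearMap.inl ℝ E E)

theorem contDiffAt_adChart {x : E} (hx : x ∈ dom E G) : ContDiffAt ℝ ∞ (adChart E G) x :=
  contDiffAt_fderiv_comp (c := fun y => (y, origin E G)) (contDiffAt_conjE_right hx) (contDiffAt_id.prodMk contDiffAt_const) _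

theorem contDiffAt_logCoeff {x : E} (hx : x ∈ dom E G) : ContDiffAt ℝ ∞ (logCoeff E G) x :=
  contDiffAt_fderiv_comp (c := fun y => (y, y)) (contDiffAt_divE_diag hx) (contDiffAt_id.prodMk contDiffAt_id) _

theorem contDiffAt_expCoeff {x : E} (hx : x ∈ dom E G) : ContDiffAt ℝ ∞ (expCoeff E G) x :=
  contDiffAt_fderiv_comp (contDiffAt_mulE_left hx) (contDiffAt_const.prodMk contDiffAt_id) _

theorem logCoeff_origin : logCoeff E G (origin E G) = ContinuousLinearMap.id ℝ E := by
  have hd := (contDiffAt_divE_diag (origin_mem_dom E G)).differentiableAt (by simp)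
  have h2 : HasFDerivAt (fun y => divE E G (y, origin E G)) (logCoeff E G (origin E G))
      (origin E G) :=
    HasFDerivAt.comp (f := fun y => (y, origin E G)) (origin E G) hd.hasFDerivAt
      (hasFDerivAt_prodMk_left (origin E G) (origin E G))
  exact h2.unique ((hasFDerivAt_id (origin E G)).congr_of_eventuallyEq
    (Filter.eventually_of_mem (dom_mem_nhds E G) fun y hy => by simp [divE, toE_ofE hy]))

/-! ### The adjoint representation -/

/-- The adjoint action as a continuous linear map. -/
def AdL (g : G) : E →L[ℝ] E := fderiv ℝ (fun x => toE E (g * ofE G x * g⁻¹)) (origin E G)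

theorem contDiffAt_conj (g : G) :
    ContDiffAt ℝ ∞ (fun x => toE E (g * ofE G x * g⁻¹)) (origin E G) :=
  ContMDiffAt.contDiffAt_toE le_rfl
    ((contMDiffAt_const.mul (contMDiffAt_ofE (origin_mem_dom E G))).mul contMDiffAt_const)
    (by simpa using one_mem_src E G)

theorem hasFDerivAt_conj (g : G) :
    HasFDerivAt (fun x => toE E (g * ofE G x * g⁻¹)) (AdL g) (origin E G) :=
  ((contDiffAt_conj g).differentiableAt (by simp)).hasFDerivAt

theorem mdifferentiableAt_conj (g : G) :
    MDifferentiableAt 𝓘(ℝ, E) 𝓘(ℝ, E) (fun y : G => g * y * g⁻¹) 1 :=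
  ((contMDiffAt_const.mul contMDiffAt_id).mul contMDiffAt_const :
    ContMDiffAt 𝓘(ℝ, E) 𝓘(ℝ, E) ∞ (fun y : G => g * y * g⁻¹) 1).mdifferentiableAt (by simp)

theorem Ad_eq_AdL (g : G) (x : E) : Ad E g x = AdL g x := by
  -- `mfderiv` uses the chart at `g * 1 * g⁻¹`, which is only propositionally `1`; the base point is
  -- generalised so that it can be substituted.
  have key : ∀ p : G, p = 1 → ∀ A : E →L[ℝ] E,
      HasFDerivWithinAt (extChartAt 𝓘(ℝ, E) p ∘ (fun y : G => g * y * g⁻¹) ∘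
        (extChartAt 𝓘(ℝ, E) (1 : G)).symm) A (Set.range 𝓘(ℝ, E)) (origin E G) → A = AdL g := by
    rintro _ rfl A hA
    rw [ModelWithCorners.range_eq_univ, hasFDerivWithinAt_univ] at hA
    exact hA.unique (hasFDerivAt_conj g)
  exact congrArg (fun A : E →L[ℝ] E => A x)
    (key _ (by simp) _ (mdifferentiableAt_conj (E := E) g).hasMFDerivAt.2)

theorem AdL_ofE {x : E} (hx : x ∈ dom E G) : AdL (ofE G x) = adChart E G x :=
  HasFDerivAt.fderiv <|
    ((contDiffAt_conjE_right hx).differentiableAt (by simp)).hasFDerivAt.comp (origin E G)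
      (hasFDerivAt_prodMk_right x (origin E G))

theorem AdL_one : AdL (1 : G) = ContinuousLinearMap.id ℝ E :=
  (hasFDerivAt_conj (1 : G)).unique ((hasFDerivAt_id (origin E G)).congr_of_eventuallyEq
    (Filter.eventually_of_mem (dom_mem_nhds E G) fun y hy => by simp [toE_ofE hy]))

theorem AdL_mul (g h : G) : AdL (E := E) (g * h) = (AdL g).comp (AdL h) := by
  have h0 : toE E (h * ofE G (origin E G) * h⁻¹) = origin E G := by simp [toE_one]
  have h1 := (h0 ▸ hasFDerivAt_conj (E := E) g).comp (origin E G) (hasFDerivAt_conj (E := E) h)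
  refine (hasFDerivAt_conj (g * h)).unique (h1.congr_of_eventuallyEq ?_)
  have hc : ContinuousAt (fun x : E => h * ofE G x * h⁻¹) (origin E G) :=
    ((contMDiffAt_const.mul (contMDiffAt_ofE (origin_mem_dom E G))).mul
      contMDiffAt_const : ContMDiffAt 𝓘(ℝ, E) 𝓘(ℝ, E) ∞ _ _).continuousAt
  filter_upwards [hc.eventually_mem (by simpa using src_mem_nhds E G)] with x hx
  simp only [Function.comp_apply, ofE_toE hx]
  simp [mul_assoc]

theorem AdL_mul_apply (g h : G) (x : E) : AdL (g * h) x = AdL g (AdL h x) := by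
  rw [AdL_mul]; rfl

@[simp] theorem AdL_inv_apply (g : G) (x : E) : AdL g⁻¹ (AdL g x) = x := by
  rw [← AdL_mul_apply, inv_mul_cancel, AdL_one]; rfl

@[simp] theorem AdL_apply_inv (g : G) (x : E) : AdL g (AdL g⁻¹ x) = x := by
  rw [← AdL_mul_apply, mul_inv_cancel, AdL_one]; rfl

/-- This carries continuity and derivatives of `Ad` from the identity, where `adChart` is available,
to every point of the group. -/
theorem AdL_eq_adChart_comp {g h : G} (hg : g * h⁻¹ ∈ src E G) :
    AdL g = (adChart E G (toE E (g * h⁻¹))).comp (AdL h) := by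
  rw [← AdL_ofE (toE_mem_dom hg), ofE_toE hg, ← AdL_mul, inv_mul_cancel_right]

theorem continuous_AdL : Continuous (AdL : G → E →L[ℝ] E) := by
  have := isTopologicalGroup E G
  refine continuous_iff_continuousAt.2 fun h => ?_
  have h1 : ContinuousAt (fun g : G => g * h⁻¹) h := by fun_prop
  have hs : (fun g : G => g * h⁻¹) h ∈ src E G := by simpa using one_mem_src E G
  have h2 : ContinuousAt (fun g : G => (adChart E G (toE E (g * h⁻¹))).comp (AdL h)) h :=
    ((ContinuousAt.comp (f := fun g : G => toE E (g * h⁻¹)) (contDiffAt_adChart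
      (toE_mem_dom hs)).continuousAt
      (ContinuousAt.comp (g := toE E) (continuousAt_toE hs) h1))).clm_comp continuousAt_const
  refine h2.congr ?_
  filter_upwards [h1.eventually_mem ((isOpen_src E G).mem_nhds hs)] with g hg
  exact (AdL_eq_adChart_comp hg).symm

end ChartCalculus

end

end OctonionicNahm

namespace OctonionicNahm

noncomputable section

/-! ### The bracket as the derivative of the adjoint representation -/

section BracketChart

variable {E : Type*} [NormedAddCommGroup E] [NormedSpace ℝ E]
variable {G : Type*} [TopologicalSpace G] [ChartedSpace E G] [Group G]
variable [LieGroup 𝓘(ℝ, E) ∞ G]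

variable (G) in
/-- The left invariant vector field with value `v` at the identity, in the chart at the identity. -/
def chartField (v : E) : E → E :=
  VectorField.mpullbackWithin 𝓘(ℝ, E) 𝓘(ℝ, E) (extChartAt 𝓘(ℝ, E) (1 : G)).symm
    (mulInvariantVectorField (v : GroupLieAlgebra 𝓘(ℝ, E) G)) (Set.range 𝓘(ℝ, E))

/-- The field at `ofE G z` is the derivative of left translation applied to `v`. Read in the chart,
left translation is `y ↦ mulE E G (z, y)`. -/
theorem chartField_eq (v : E) {z : E} (hz : z ∈ dom E G) :
    chartField G v z = fderiv ℝ (mulE E G) (z, origin E G) (0, v) := by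
  have hone : IsManifold 𝓘(ℝ, E) 1 G := IsManifold.of_le (n := ∞) (by simp)
  have hinv := ContinuousLinearMap.inverse_eq
    (mfderivWithin_extChartAt_symm_comp_mfderiv_extChartAt hz)
    (mfderiv_extChartAt_comp_mfderivWithin_extChartAt_symm hz)
  have hL : ContMDiffAt 𝓘(ℝ, E) 𝓘(ℝ, E) ∞ (fun y : G => ofE G z * y) 1 :=
    contMDiffAt_const.mul contMDiffAt_id
  have hT : ContMDiffAt 𝓘(ℝ, E) 𝓘(ℝ, E) ∞ (toE E : G → E) (ofE G z * 1) :=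
    contMDiffAt_toE (by simpa using ofE_mem_src hz)
  have hcomp := mfderiv_comp (1 : G) (hT.mdifferentiableAt (by simp))
    (hL.mdifferentiableAt (by simp))
  have hder := ((hT.comp (1 : G) hL).mdifferentiableAt (by simp)).hasMFDerivAt.2
  have h1 : HasFDerivAt (fun y => mulE E G (z, y))
      ((fderiv ℝ (mulE E G) (z, origin E G)).comp (ContinuousLinearMap.inr ℝ E E)) (origin E G) :=
    ((contDiffAt_mulE_right hz).differentiableAt (by simp)).hasFDerivAt.comp (origin E G)
      (hasFDerivAt_prodMk_right z (origin E G))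
  have key : ∀ A : E →L[ℝ] E, HasFDerivWithinAt (fun y => mulE E G (z, y)) A
      (Set.range 𝓘(ℝ, E)) (origin E G) →
      A v = fderiv ℝ (mulE E G) (z, origin E G) (0, v) := by
    intro A hA
    rw [ModelWithCorners.range_eq_univ, hasFDerivWithinAt_univ] at hA
    rw [hA.unique h1]
    simp
  have h2 := key _ hder
  rw [hcomp] at h2
  unfold chartField
  rw [VectorField.mpullbackWithin_apply, hinv]
  refine Eq.trans ?_ h2
  have h3 : ∀ p : G, p = ofE G z →
      mfderiv 𝓘(ℝ, E) 𝓘(ℝ, E) (toE E : G → E) (ofE G z)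
        (mfderiv 𝓘(ℝ, E) 𝓘(ℝ, E) (fun y : G => ofE G z * y) 1 v) =
      mfderiv 𝓘(ℝ, E) 𝓘(ℝ, E) (toE E : G → E) p
        (mfderiv 𝓘(ℝ, E) 𝓘(ℝ, E) (fun y : G => ofE G z * y) 1 v) := by
    rintro _ rfl; rfl
  exact h3 _ (by simp)

/-- In the chart the bracket of fields is `DW · V - DV · W`; by `chartField_eq` the derivatives are
mixed second derivatives of the multiplication. -/
theorem bracket_eq_fderiv_fderiv (v w : E) :
    bracket E G v w = fderiv ℝ (fderiv ℝ (mulE E G)) (origin E G, origin E G) (v, 0) (0, w) -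
      fderiv ℝ (fderiv ℝ (mulE E G)) (origin E G, origin E G) (w, 0) (0, v) := by
  have hone : IsManifold 𝓘(ℝ, E) 1 G := IsManifold.of_le (n := ∞) (by simp)
  have hD : DifferentiableAt ℝ (fderiv ℝ (mulE E G)) (origin E G, origin E G) :=
    ((contDiffAt_mulE_left (origin_mem_dom E G)).fderiv_right (m := 1)
      (by norm_cast)).differentiableAt (by simp)
  have hV : ∀ a b : E, fderiv ℝ (chartField G a) (origin E G) b =
      fderiv ℝ (fderiv ℝ (mulE E G)) (origin E G, origin E G) (b, 0) (0, a) := by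
    intro a b
    have h1 := (HasFDerivAt.comp (f := fun z => (z, origin E G)) (origin E G) hD.hasFDerivAt
        (hasFDerivAt_prodMk_left (origin E G) (origin E G))).clm_apply
        (hasFDerivAt_const ((0, a) : E × E) (origin E G))
    have h2 := h1.congr_of_eventuallyEq (Filter.eventually_of_mem (dom_mem_nhds E G)
      fun z hz => chartField_eq (G := G) a hz)
    rw [h2.fderiv]
    simp
  have h0 : ∀ a : E, chartField G a (origin E G) = a := by
    intro a
    rw [chartField_eq a (origin_mem_dom E G), fderiv_mulE_origin, zero_add]
  have hb : bracket E G v w = VectorField.lieBracketWithin ℝ (chartField G v) (chartField G w)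
      Set.univ (origin E G) := by
    have key : ∀ (A : E →L[ℝ] E) (s : Set E), A = ContinuousLinearMap.id ℝ E → s = Set.univ →
        A.inverse (VectorField.lieBracketWithin ℝ (chartField G v) (chartField G w) s
          (origin E G)) = VectorField.lieBracketWithin ℝ (chartField G v) (chartField G w)
            Set.univ (origin E G) := by
      rintro _ _ rfl rfl
      rw [ContinuousLinearMap.inverse_id]
      rfl
    have h1 : bracket E G v w = VectorField.mlieBracketWithin 𝓘(ℝ, E)
        (mulInvariantVectorField (v : GroupLieAlgebra 𝓘(ℝ, E) G))
        (mulInvariantVectorField (w : GroupLieAlgebra 𝓘(ℝ, E) G)) Set.univ (1 : G) := by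
      rw [VectorField.mlieBracketWithin_univ]
      rfl
    rw [h1]
    exact VectorField.mlieBracketWithin_apply.trans
      (key _ _ mfderiv_extChartAt_self (by simp))
  rw [hb, VectorField.lieBracketWithin, fderivWithin_univ, fderivWithin_univ, h0, h0, hV, hV]

theorem bracket_swap (v w : E) : bracket E G v w = -bracket E G w v := by
  rw [bracket_eq_fderiv_fderiv, bracket_eq_fderiv_fderiv, neg_sub]

variable (E G) in
/-- The adjoint representation of the Lie algebra, as a continuous bilinear map. -/
def adL : E →L[ℝ] E →L[ℝ] E := fderiv ℝ (adChart E G) (origin E G)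

theorem hasFDerivAt_adChart : HasFDerivAt (adChart E G) (adL E G) (origin E G) :=
  ((contDiffAt_adChart (origin_mem_dom E G)).differentiableAt (by simp)).hasFDerivAt

/-- The differential of the adjoint action is the bracket. -/
theorem bracket_eq_adL (v w : E) : bracket E G v w = adL E G v w := by
  set e := origin E G with he
  have hD : DifferentiableAt ℝ (fderiv ℝ (mulE E G)) (e, e) :=
    ((contDiffAt_mulE_left (origin_mem_dom E G)).fderiv_right (m := 1)
      (by norm_cast)).differentiableAt (by simp)
  have hD1 := HasFDerivAt.comp (f := fun z => (z, e)) e hD.hasFDerivAt (hasFDerivAt_prodMk_left e e)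
  have hD2 := HasFDerivAt.comp (f := fun z => (e, z)) e hD.hasFDerivAt (hasFDerivAt_prodMk_right e e)
  -- The derivative at `y = e` of the identity `z y = (z y z⁻¹) z`. Differentiating this once more,
  -- in `z` at `e`, expresses `ad` through second derivatives of the multiplication.
  have hrel : ∀ z ∈ dom E G, fderiv ℝ (mulE E G) (z, e) (0, w) =
      fderiv ℝ (mulE E G) (e, z) (adChart E G z w, 0) := by
    intro z hz
    have h1 : HasFDerivAt (fun y => mulE E G (z, y))
        ((fderiv ℝ (mulE E G) (z, e)).comp (ContinuousLinearMap.inr ℝ E E)) e :=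
      ((contDiffAt_mulE_right hz).differentiableAt (by simp)).hasFDerivAt.comp e
        (hasFDerivAt_prodMk_right z e)
    have hc : HasFDerivAt (fun y => conjE E G (z, y)) (adChart E G z) e :=
      ((contDiffAt_conjE_right hz).differentiableAt (by simp)).hasFDerivAt.comp e
        (hasFDerivAt_prodMk_right z e)
    have hce : conjE E G (z, e) = e := by simp [conjE, he, toE_one]
    have h2 : HasFDerivAt (fun y => mulE E G (conjE E G (z, y), z))
        (((fderiv ℝ (mulE E G) (e, z)).comp (ContinuousLinearMap.inl ℝ E E)).comp
          (adChart E G z)) e := by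
      have hm : HasFDerivAt (fun y => mulE E G (y, z))
          ((fderiv ℝ (mulE E G) (e, z)).comp (ContinuousLinearMap.inl ℝ E E))
          (conjE E G (z, e)) := by
        rw [hce]
        exact HasFDerivAt.comp (f := fun y => (y, z)) e
          ((contDiffAt_mulE_left hz).differentiableAt (by simp)).hasFDerivAt
          (hasFDerivAt_prodMk_left e z)
      exact hm.comp e hc
    have hcont : ContinuousAt (fun y : E => ofE G z * ofE G y * (ofE G z)⁻¹) e :=
      ((contMDiffAt_const.mul (contMDiffAt_ofE (origin_mem_dom E G))).mul
        contMDiffAt_const : ContMDiffAt 𝓘(ℝ, E) 𝓘(ℝ, E) ∞ _ _).continuousAt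
    have h3 := h1.unique (h2.congr_of_eventuallyEq ?_)
    · have := congrArg (fun T => T w) h3
      simpa using this
    · filter_upwards [hcont.eventually_mem (by simpa [he] using src_mem_nhds E G)] with y hy
      simp [mulE, conjE, ofE_toE hy]
  have h1 := hD1.clm_apply (hasFDerivAt_const ((0, w) : E × E) e)
  have h2 := hD2.clm_apply ((hasFDerivAt_adChart.clm_apply
    (hasFDerivAt_const w e)).prodMk (hasFDerivAt_const (0 : E) e))
  have h3 := h1.unique (h2.congr_of_eventuallyEq
    (Filter.eventually_of_mem (dom_mem_nhds E G) hrel))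
  have h4 := congrArg (fun T => T v) h3
  have hA : adChart E G e = ContinuousLinearMap.id ℝ E := by
    rw [← AdL_ofE (origin_mem_dom E G), ofE_origin, AdL_one]
  have hsymm : fderiv ℝ (fderiv ℝ (mulE E G)) (e, e) (0, v) (w, 0) =
      fderiv ℝ (fderiv ℝ (mulE E G)) (e, e) (w, 0) (0, v) :=
    ((contDiffAt_mulE_left (origin_mem_dom E G)).isSymmSndFDerivAt (by simp; norm_cast)).eq _ _
  simp [hA, hsymm] at h4
  rw [bracket_eq_fderiv_fderiv, h4]
  rw [he, fderiv_mulE_origin]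
  abel

end BracketChart

end

end OctonionicNahm

namespace OctonionicNahm

noncomputable section

/-! ### Right logarithmic derivatives of paths in a Lie group -/

section RightLog

variable {E : Type*} [NormedAddCommGroup E] [NormedSpace ℝ E]
variable {G : Type*} [TopologicalSpace G] [ChartedSpace E G] [Group G]

/-- The path `γ` has right logarithmic derivative `γ' γ⁻¹ = u` at time `t ∈ [0,1]`. -/
def HasRightLog (γ : ℝ → G) (u : E) (t : ℝ) : Prop :=
  -- Continuity is a separate requirement: off `src` the function `toE` is unconstrained, so the
  -- chart expression alone does not control `γ`.
  ContinuousWithinAt γ (Set.Icc 0 1) t ∧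
    HasDerivWithinAt (fun s => toE E (γ s * (γ t)⁻¹)) u (Set.Icc 0 1) t

theorem HasRightLog.unique {γ : ℝ → G} {u v : E} {t : ℝ} (ht : t ∈ Set.Icc (0 : ℝ) 1)
    (h : HasRightLog γ u t) (h' : HasRightLog γ v t) : u = v :=
  (uniqueDiffOn_Icc zero_lt_one t ht).eq_deriv _ h.2 h'.2

theorem hasRightLog_const (g : G) (t : ℝ) : HasRightLog (fun _ => g) (0 : E) t :=
  ⟨continuousWithinAt_const, hasDerivWithinAt_const _ _ _⟩

theorem HasRightLog.congr {γ δ : ℝ → G} {u : E} {t : ℝ} (h : HasRightLog γ u t)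
    (ht : t ∈ Set.Icc (0 : ℝ) 1) (hδ : ∀ s ∈ Set.Icc (0 : ℝ) 1, δ s = γ s) :
    HasRightLog δ u t :=
  ⟨h.1.congr hδ (hδ t ht), h.2.congr (fun s hs => by rw [hδ s hs, hδ t ht]) (by simp)⟩

variable [LieGroup 𝓘(ℝ, E) ∞ G]

theorem hasFDerivAt_mulE_origin : HasFDerivAt (mulE E G)
    (ContinuousLinearMap.fst ℝ E E + ContinuousLinearMap.snd ℝ E E)
    (origin E G, origin E G) := by
  have h : fderiv ℝ (mulE E G) (origin E G, origin E G) =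
      ContinuousLinearMap.fst ℝ E E + ContinuousLinearMap.snd ℝ E E :=
    ContinuousLinearMap.ext fun p => fderiv_mulE_origin p.1 p.2
  rw [← h]
  exact ((contDiffAt_mulE_left (origin_mem_dom E G)).differentiableAt (by simp)).hasFDerivAt

/-- The derivative of a product of two paths through the identity. -/
theorem hasDerivWithinAt_toE_mul {a b : ℝ → G} {s : Set ℝ} {t : ℝ} {u v : E}
    (ha : ContinuousWithinAt a s t) (hb : ContinuousWithinAt b s t) (ha1 : a t = 1) (hb1 : b t = 1)
    (hau : HasDerivWithinAt (fun r => toE E (a r)) u s t)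
    (hbv : HasDerivWithinAt (fun r => toE E (b r)) v s t) :
    HasDerivWithinAt (fun r => toE E (a r * b r)) (u + v) s t := by
  have h1 : HasFDerivAt (mulE E G) (ContinuousLinearMap.fst ℝ E E + ContinuousLinearMap.snd ℝ E E)
      (toE E (a t), toE E (b t)) := by
    rw [ha1, hb1]; exact hasFDerivAt_mulE_origin
  have h2 := h1.comp_hasDerivWithinAt t (hau.prodMk hbv)
  refine (h2.congr_of_eventuallyEq ?_ ?_)
  · filter_upwards [ha.eventually_mem (ha1 ▸ src_mem_nhds E G),
      hb.eventually_mem (hb1 ▸ src_mem_nhds E G)] with r hr hr'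
    simp [mulE, ofE_toE hr, ofE_toE hr']
  · simp [mulE, ha1, hb1, toE_one]

/-- The derivative of a conjugated path through the identity. -/
theorem hasDerivWithinAt_toE_conj (g : G) {a : ℝ → G} {s : Set ℝ} {t : ℝ} {u : E}
    (ha : ContinuousWithinAt a s t) (ha1 : a t = 1)
    (hau : HasDerivWithinAt (fun r => toE E (a r)) u s t) :
    HasDerivWithinAt (fun r => toE E (g * a r * g⁻¹)) (AdL g u) s t := by
  have h1 : HasFDerivAt (fun x => toE E (g * ofE G x * g⁻¹)) (AdL g) (toE E (a t)) := by
    rw [ha1]; exact hasFDerivAt_conj g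
  have h2 := h1.comp_hasDerivWithinAt t hau
  refine h2.congr_of_eventuallyEq ?_ ?_
  · filter_upwards [ha.eventually_mem (ha1 ▸ src_mem_nhds E G)] with r hr
    simp [ofE_toE hr]
  · simp [ha1, toE_one]

/-- With `p(s) = γ(s) γ(t)⁻¹` and `q(s) = δ(s) δ(t)⁻¹`, the quotient for the product path is `p(s) ·
γ(t) q(s) γ(t)⁻¹`. -/
theorem HasRightLog.mul {γ δ : ℝ → G} {u v : E} {t : ℝ} (h : HasRightLog γ u t)
    (h' : HasRightLog δ v t) : HasRightLog (fun s => γ s * δ s) (u + AdL (γ t) v) t := by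
  have := isTopologicalGroup E G
  refine ⟨h.1.mul h'.1, ?_⟩
  have hδ : ContinuousWithinAt (fun s => δ s * (δ t)⁻¹) (Set.Icc 0 1) t :=
    h'.1.mul continuousWithinAt_const
  have h1 := hasDerivWithinAt_toE_conj (γ t) hδ (by simp) h'.2
  have h2 := hasDerivWithinAt_toE_mul (h.1.mul continuousWithinAt_const)
    ((continuousWithinAt_const.mul hδ).mul continuousWithinAt_const) (by simp) (by simp) h.2 h1
  convert h2 using 3 with s
  simp only [Pi.mul_apply]
  group

/-- The derivative of inversion at `1` is read off from the constant product of a path with its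
inverse; conjugation by `γ(t)⁻¹` then gives the formula. -/
theorem HasRightLog.inv {γ : ℝ → G} {u : E} {t : ℝ} (ht : t ∈ Set.Icc (0 : ℝ) 1)
    (h : HasRightLog γ u t) : HasRightLog (fun s => (γ s)⁻¹) (-AdL (γ t)⁻¹ u) t := by
  have := isTopologicalGroup E G
  have hinv : ContDiffAt ℝ ∞ (fun x => toE E (ofE G x)⁻¹) (origin E G) :=
    ContMDiffAt.contDiffAt_toE le_rfl (contMDiffAt_ofE (origin_mem_dom E G)).inv
      (by simpa using one_mem_src E G)
  have hc : ContinuousWithinAt (fun s => γ s * (γ t)⁻¹) (Set.Icc 0 1) t :=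
    h.1.mul continuousWithinAt_const
  have h1 : HasFDerivAt (fun x => toE E (ofE G x)⁻¹)
      (fderiv ℝ (fun x => toE E (ofE G x)⁻¹) (origin E G)) (toE E (γ t * (γ t)⁻¹)) := by
    rw [mul_inv_cancel]; exact (hinv.differentiableAt (by simp)).hasFDerivAt
  have h2 := h1.comp_hasDerivWithinAt t h.2
  have h3 : HasDerivWithinAt (fun s => toE E (γ s * (γ t)⁻¹)⁻¹)
      (fderiv ℝ (fun x => toE E (ofE G x)⁻¹) (origin E G) u) (Set.Icc 0 1) t := by
    refine h2.congr_of_eventuallyEq ?_ (by simp [toE_one])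
    filter_upwards [hc.eventually_mem (by simpa using src_mem_nhds E G)] with r hr
    simp only [Function.comp_apply, ofE_toE hr]
  have h4 := hasDerivWithinAt_toE_mul hc hc.inv (by simp) (by simp) h.2 h3
  have h5 : HasDerivWithinAt (fun _ : ℝ => origin E G)
      (u + fderiv ℝ (fun x => toE E (ofE G x)⁻¹) (origin E G) u) (Set.Icc 0 1) t := by
    simpa [toE_one] using h4
  have h6 := (uniqueDiffOn_Icc zero_lt_one t ht).eq_deriv _ h5 (hasDerivWithinAt_const _ _ _)
  rw [← neg_eq_iff_add_eq_zero] at h6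
  rw [← h6] at h3
  refine ⟨h.1.inv, ?_⟩
  have h7 := hasDerivWithinAt_toE_conj (γ t)⁻¹ hc.inv (by simp) h3
  rw [map_neg] at h7
  convert h7 using 3 with s
  simp only [Pi.inv_apply]
  group

theorem HasRightLog.hasDerivWithinAt_AdL {γ : ℝ → G} {u : E} {t : ℝ} (h : HasRightLog γ u t) :
    HasDerivWithinAt (fun s => AdL (E := E) (γ s)) ((adL E G u).comp (AdL (γ t)))
      (Set.Icc 0 1) t := by
  have := isTopologicalGroup E G
  have hc : ContinuousWithinAt (fun s => γ s * (γ t)⁻¹) (Set.Icc 0 1) t :=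
    h.1.mul continuousWithinAt_const
  have h1 : HasFDerivAt (adChart E G) (adL E G) (toE E (γ t * (γ t)⁻¹)) := by
    rw [mul_inv_cancel]; exact hasFDerivAt_adChart
  have h2 := ((ContinuousLinearMap.compL ℝ E E E).flip
    (AdL (γ t))).hasFDerivAt.comp_hasDerivWithinAt t (h1.comp_hasDerivWithinAt t h.2)
  refine HasDerivWithinAt.congr_of_eventuallyEq (f := fun s =>
    (adChart E G (toE E (γ s * (γ t)⁻¹))).comp (AdL (γ t))) h2 ?_ ?_
  · filter_upwards [hc.eventually_mem (by simpa using src_mem_nhds E G)] with r hr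
    exact AdL_eq_adChart_comp hr
  · exact AdL_eq_adChart_comp (by simpa using one_mem_src E G)

/-- The right factor `c` cancels in `γ(s) γ(t)⁻¹`, so one chart, translated, serves at every point.
`HasRightLog.hasDerivWithinAt_chart` is the converse passage. -/
theorem HasRightLog.of_chart {γ : ℝ → G} {z : ℝ → E} {z' : E} {c : G} {t : ℝ}
    (ht : t ∈ Set.Icc (0 : ℝ) 1) (hz : HasDerivWithinAt z z' (Set.Icc 0 1) t)
    (hd : z t ∈ dom E G) (hγ : ∀ᶠ s in 𝓝[Set.Icc 0 1] t, γ s = ofE G (z s) * c) :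
    HasRightLog γ (logCoeff E G (z t) z') t := by
  have := isTopologicalGroup E G
  have hγt := hγ.self_of_nhdsWithin ht
  refine ⟨ContinuousWithinAt.congr_of_eventuallyEq (f := fun s => ofE G (z s) * c)
    (((continuousAt_ofE hd).comp_continuousWithinAt hz.continuousWithinAt).mul
      continuousWithinAt_const) hγ hγt, ?_⟩
  have h1 : HasFDerivAt (fun x => divE E G (x, z t)) (logCoeff E G (z t)) (z t) :=
    HasFDerivAt.comp (f := fun x => (x, z t)) (z t)
      ((contDiffAt_divE_diag hd).differentiableAt (by simp)).hasFDerivAt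
      (hasFDerivAt_prodMk_left (z t) (z t))
  refine (h1.comp_hasDerivWithinAt t hz).congr_of_eventuallyEq ?_ ?_
  · filter_upwards [hγ] with s hs
    simp [divE, hs, hγt]
  · simp [divE]

theorem HasRightLog.hasDerivWithinAt_chart {γ : ℝ → G} {u : E} {t : ℝ} (h : HasRightLog γ u t)
    {c : G} (hc : γ t * c⁻¹ ∈ src E G) :
    HasDerivWithinAt (fun s => toE E (γ s * c⁻¹)) (expCoeff E G (toE E (γ t * c⁻¹)) u)
      (Set.Icc 0 1) t := by
  have := isTopologicalGroup E G
  set y := toE E (γ t * c⁻¹) with hy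
  have hyd : y ∈ dom E G := toE_mem_dom hc
  have h1 : HasFDerivAt (fun x => mulE E G (x, y)) (expCoeff E G y) (toE E (γ t * (γ t)⁻¹)) := by
    rw [mul_inv_cancel]
    exact HasFDerivAt.comp (f := fun x => (x, y)) (origin E G)
      ((contDiffAt_mulE_left hyd).differentiableAt (by simp)).hasFDerivAt
      (hasFDerivAt_prodMk_left (origin E G) y)
  have hcont : ContinuousWithinAt (fun s => γ s * (γ t)⁻¹) (Set.Icc 0 1) t :=
    h.1.mul continuousWithinAt_const
  refine (h1.comp_hasDerivWithinAt t h.2).congr_of_eventuallyEq ?_ ?_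
  · filter_upwards [hcont.eventually_mem (by simpa using src_mem_nhds E G)] with s hs
    simp [mulE, ofE_toE hs, hy, ofE_toE hc]
  · simp [mulE, hy, toE_one, ofE_toE hc]

/-- A smooth function along a path with vanishing logarithmic derivative has derivative zero. -/
theorem HasRightLog.hasDerivWithinAt_zero {γ : ℝ → G} {t : ℝ} (h : HasRightLog γ (0 : E) t)
    {f : G → ℝ} (hf : ContMDiff 𝓘(ℝ, E) 𝓘(ℝ, ℝ) ∞ f) :
    HasDerivWithinAt (fun s => f (γ s)) 0 (Set.Icc 0 1) t := by
  have := isTopologicalGroup E G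
  have hd : DifferentiableAt ℝ (fun x => f (ofE G x * γ t)) (toE E (γ t * (γ t)⁻¹)) := by
    rw [mul_inv_cancel]
    exact (contMDiffAt_iff_contDiffAt.1 (ContMDiffAt.comp (I' := 𝓘(ℝ, E)) (origin E G)
      hf.contMDiffAt ((contMDiffAt_ofE (origin_mem_dom E G)).mul
      contMDiffAt_const))).differentiableAt (by simp)
  have hcont : ContinuousWithinAt (fun s => γ s * (γ t)⁻¹) (Set.Icc 0 1) t :=
    h.1.mul continuousWithinAt_const
  have h1 := hd.hasFDerivAt.comp_hasDerivWithinAt t h.2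
  rw [map_zero] at h1
  refine h1.congr_of_eventuallyEq ?_ ?_
  · filter_upwards [hcont.eventually_mem (by simpa using src_mem_nhds E G)] with s hs
    simp [ofE_toE hs]
  · simp [toE_one]

/-- A path with vanishing logarithmic derivative is constant. -/
theorem eq_of_hasRightLog_zero [FiniteDimensional ℝ E] [T2Space G] {γ : ℝ → G}
    (h : ∀ t ∈ Set.Icc (0 : ℝ) 1, HasRightLog γ (0 : E) t) {t : ℝ} (ht : t ∈ Set.Icc (0 : ℝ) 1) :
    γ t = γ 0 := by
  by_contra hne
  -- A bump function at `γ 0` whose support misses `γ t` would be constant along the path, although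
  -- it is `1` at one end and `0` at the other.
  obtain ⟨f, hf⟩ : ∃ f : SmoothBumpFunction 𝓘(ℝ, E) (γ 0), True ∧ tsupport f ⊆ {γ t}ᶜ :=
    (SmoothBumpFunction.nhds_basis_tsupport (γ 0)).mem_iff.1
      (isOpen_compl_singleton.mem_nhds (Ne.symm hne))
  have h1 := eq_of_hasDerivWithinAt (f := fun s => f (γ s)) (g := fun _ => f (γ 0)) (f' := 0)
    (fun s hs => (h s hs).hasDerivWithinAt_zero f.contMDiff)
    (fun s _ => hasDerivWithinAt_const _ _ _) rfl ht
  have h2 : f (γ t) ≠ 0 := by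
    rw [h1, f.eq_one]; exact one_ne_zero
  exact hf.2 (subset_tsupport _ h2) rfl

end RightLog

end

end OctonionicNahm

namespace OctonionicNahm

noncomputable section

/-! ### Gauge transformations -/

/-- The extension of a path on `[0,1]` to `ℝ` by constants. -/
abbrev pathExt {X : Type*} (g : I → X) : ℝ → X := Set.IccExtend (zero_le_one' ℝ) g

theorem pathExt_coe {X : Type*} (g : I → X) (t : I) : pathExt g t = g t :=
  Set.IccExtend_val _ _ _

theorem pathExt_restrict {X : Type*} (f : ℝ → X) {s : ℝ} (hs : s ∈ Set.Icc (0 : ℝ) 1) :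
    pathExt (fun t : I => f t) s = f s := Set.IccExtend_of_mem _ _ hs

theorem pathExt_of_mem {X : Type*} (g : I → X) {s : ℝ} (hs : s ∈ Set.Icc (0 : ℝ) 1) :
    pathExt g s = g ⟨s, hs⟩ := Set.IccExtend_of_mem _ _ hs

namespace C1

variable {F : Type*} [NormedAddCommGroup F] [NormedSpace ℝ F]

theorem contDiffOn_val (y : C1 F) : ContDiffOn ℝ 1 (pathExt (C1.val y)) (Set.Icc 0 1) := by
  have hder : ∀ t ∈ Set.Icc (0 : ℝ) 1,
      derivWithin (pathExt (C1.val y)) (Set.Icc 0 1) t = pathExt (C1.der y) t := fun t ht => by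
    rw [pathExt_of_mem _ ht]
    exact (C1.hasDerivWithinAt y ⟨t, ht⟩).derivWithin (uniqueDiffOn_Icc zero_lt_one t ht)
  exact (contDiffOn_one_iff_derivWithin (uniqueDiffOn_Icc (zero_lt_one' ℝ))).2 ⟨fun t ht =>
    (C1.hasDerivWithinAt y ⟨t, ht⟩).differentiableWithinAt,
    (C1.der y).continuous.Icc_extend'.continuousOn.congr hder⟩

/-- The `C^1` path given by a continuously differentiable function. -/
theorem exists_val_eq {f f' : ℝ → F} (hf' : ContinuousOn f' (Set.Icc 0 1))
    (h : ∀ t ∈ Set.Icc (0 : ℝ) 1, HasDerivWithinAt f (f' t) (Set.Icc 0 1) t) :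
    ∃ y : C1 F, ∀ t : I, C1.val y t = f t ∧ C1.der y t = f' t :=
  ⟨C1.mk ⟨fun t => f t, (continuousOn_iff_continuous_domRestrict.1
      fun t ht => (h t ht).continuousWithinAt)⟩
    ⟨fun t => f' t, continuousOn_iff_continuous_domRestrict.1 hf'⟩
    fun t => (h t t.2).congr (fun _ hs => pathExt_restrict f hs) (pathExt_restrict f t.2),
    fun _ => ⟨rfl, rfl⟩⟩

theorem exists_val_eq_of_contDiffOn {f : ℝ → F} (hf : ContDiffOn ℝ 1 f (Set.Icc 0 1)) :
    ∃ y : C1 F, ∀ t : I, C1.val y t = f t := by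
  have hu := uniqueDiffOn_Icc (zero_lt_one' ℝ)
  obtain ⟨y, hy⟩ := exists_val_eq (f := f) (f' := derivWithin f (Set.Icc 0 1))
    (hf.continuousOn_derivWithin hu le_rfl)
    (fun t ht => (hf.differentiableOn (by simp) t ht).hasDerivWithinAt)
  exact ⟨y, fun t => (hy t).1⟩

end C1

section Gauge

variable {E : Type*} [NormedAddCommGroup E] [NormedSpace ℝ E]
variable {G : Type*} [TopologicalSpace G] [ChartedSpace E G] [Group G]

/-- The path `g` on `[0,1]` has right logarithmic derivative `g' g⁻¹ = u`. -/
def HasRD (g : I → G) (u : I → E) : Prop := ∀ t : I, HasRightLog (pathExt g) (u t) t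

theorem hasRD_const (c : G) : HasRD (fun _ => c) (0 : I → E) := fun t => hasRightLog_const c t

variable [LieGroup 𝓘(ℝ, E) ∞ G]

theorem HasRD.mul {g h : I → G} {u v : I → E} (hg : HasRD g u) (hh : HasRD h v) :
    HasRD (fun t => g t * h t) (fun t => u t + AdL (g t) (v t)) := fun t => by
  have := (hg t).mul (hh t)
  rwa [pathExt_coe] at this

theorem HasRD.inv {g : I → G} {u : I → E} (hg : HasRD g u) :
    HasRD (fun t => (g t)⁻¹) (fun t => -AdL (g t)⁻¹ (u t)) := fun t => by
  have := (hg t).inv t.2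
  rwa [pathExt_coe] at this

theorem HasRD.eq_of_zero [FiniteDimensional ℝ E] [T2Space G] {g : I → G}
    (hg : HasRD g (0 : I → E)) (t : I) : g t = g 0 := by
  have := eq_of_hasRightLog_zero (E := E) (γ := pathExt g) (fun s hs => hg ⟨s, hs⟩) t.2
  rw [pathExt_coe] at this
  rw [this]
  exact pathExt_coe g 0

/-- The path `g⁻¹ h` has vanishing logarithmic derivative, hence is constant. -/
theorem HasRD.eq [FiniteDimensional ℝ E] [T2Space G] {g h : I → G} {u : I → E} (hg : HasRD g u)
    (hh : HasRD h u) (h0 : g 0 = h 0) : g = h := by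
  funext t
  have h1 : HasRD (fun t => (g t)⁻¹ * h t) (0 : I → E) := by
    convert hg.inv.mul hh using 2 with t
    simp
  have h2 := h1.eq_of_zero t
  simp only [h0, inv_mul_cancel] at h2
  exact (inv_mul_eq_one.1 h2)

theorem HasRD.continuous {g : I → G} {u : I → E} (hg : HasRD g u) : Continuous g := by
  have h : ContinuousOn (pathExt g) (Set.Icc 0 1) := fun t ht => (hg ⟨t, ht⟩).1
  exact (continuousOn_iff_continuous_domRestrict.1 h).congr fun t => pathExt_coe g t

theorem derivMulInv_eq {g : I → G} {u : E} {t : I} (h : HasRightLog (pathExt g) u t) :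
    derivMulInv E g t = u := by
  have htop := isTopologicalGroup E G
  have key : ∀ p : G, p = 1 → ∀ T : Set ℝ, T = Set.Icc 0 1 → HasFDerivWithinAt
      (extChartAt 𝓘(ℝ, E) p ∘ fun s : ℝ => pathExt g s * (g t)⁻¹)
      (ContinuousLinearMap.toSpanSingleton ℝ u) T (t : ℝ) := by
    rintro _ rfl _ rfl
    have := h.2
    rw [pathExt_coe] at this
    exact this.hasFDerivWithinAt
  have hm : HasMFDerivWithinAt 𝓘(ℝ, ℝ) 𝓘(ℝ, E) (fun s : ℝ => pathExt g s * (g t)⁻¹)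
      (Set.Icc 0 1) (t : ℝ) (ContinuousLinearMap.toSpanSingleton ℝ u : ℝ →L[ℝ] E) :=
    ⟨h.1.mul continuousWithinAt_const,
      key _ (by simp) _
        (by rw [ModelWithCorners.range_eq_univ, Set.inter_univ]; rfl)⟩
  have h1 := hm.mfderivWithin ((uniqueDiffOn_Icc (zero_lt_one' ℝ) t t.2).uniqueMDiffWithinAt)
  unfold derivMulInv
  have h2 := congrArg (fun A : ℝ →L[ℝ] E => A 1) h1
  simp only [ContinuousLinearMap.toSpanSingleton_apply, one_smul] at h2
  exact h2

theorem HasRD.derivMulInv_eq {g : I → G} {u : I → E} (h : HasRD g u) (t : I) :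
    derivMulInv E g t = u t := OctonionicNahm.derivMulInv_eq (h t)

theorem contDiffWithinAt_toE_div {γ : ℝ → G} {n : WithTop ℕ∞} (hn : n ≤ ∞) {t : ℝ} {s : Set ℝ}
    (hγ : ContMDiffWithinAt 𝓘(ℝ, ℝ) 𝓘(ℝ, E) n γ s t) (c : G) (hc : γ t * c⁻¹ ∈ src E G) :
    ContDiffWithinAt ℝ n (fun r => toE E (γ r * c⁻¹)) s t := by
  have hL : LieGroup 𝓘(ℝ, E) n G := LieGroup.of_le hn
  refine contMDiffWithinAt_iff_contDiffWithinAt.1 ?_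
  exact ContMDiffAt.comp_contMDiffWithinAt (g := toE E) t ((contMDiffAt_toE hc).of_le hn)
    (hγ.mul contMDiffWithinAt_const)

theorem hasRD_of_mem_gaugeGroup {g : I → G} (hg : g ∈ gaugeGroup E G) :
    HasRD g (derivMulInv E g) := by
  intro t
  have h1 := contDiffWithinAt_toE_div (by norm_cast) (hg t t.2) (pathExt g t)
    (by simpa using one_mem_src E G)
  have h2 : HasRightLog (pathExt g) _ (t : ℝ) :=
    ⟨(hg t t.2).continuousWithinAt, (h1.differentiableWithinAt (by simp)).hasDerivWithinAt⟩
  rw [derivMulInv_eq h2]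
  exact h2

/-- Near each time the logarithmic derivative is `logCoeff E G z z'` for a chart expression `z` of
class `C^2`. -/
theorem exists_C1_derivMulInv {g : I → G} (hg : g ∈ gaugeGroup E G) :
    ∃ v : C1 E, ∀ t : I, C1.val v t = derivMulInv E g t := by
  have htop := isTopologicalGroup E G
  have hu := uniqueDiffOn_Icc (zero_lt_one' ℝ)
  have hcont : ContDiffOn ℝ 1 (pathExt (derivMulInv E g)) (Set.Icc 0 1) := by
    intro t₀ ht₀
    set z : ℝ → E := fun r => toE E (pathExt g r * (pathExt g t₀)⁻¹) with hz
    have hmem : pathExt g t₀ * (pathExt g t₀)⁻¹ ∈ src E G := by simpa using one_mem_src E G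
    have h1 : ContDiffWithinAt ℝ 2 z (Set.Icc 0 1) t₀ :=
      contDiffWithinAt_toE_div (by norm_cast) (hg t₀ ht₀) _ hmem
    have h2 : ContDiffWithinAt ℝ 1 (derivWithin z (Set.Icc 0 1)) (Set.Icc 0 1) t₀ :=
      ContDiffWithinAt.derivWithin h1 hu (by norm_num) ht₀
    have h3 : ContDiffWithinAt ℝ 1 (fun s => logCoeff E G (z s) (derivWithin z (Set.Icc 0 1) s))
        (Set.Icc 0 1) t₀ :=
      ContDiffWithinAt.clm_apply (f := fun s => logCoeff E G (z s))
        (((contDiffAt_logCoeff (toE_mem_dom hmem)).of_le (by norm_cast)).comp_contDiffWithinAt t₀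
          (h1.of_le (by norm_num))) h2
    have hev : ∀ᶠ s in 𝓝[Set.Icc 0 1] t₀, pathExt (derivMulInv E g) s =
        logCoeff E G (z s) (derivWithin z (Set.Icc 0 1) s) := by
      have hsrc : ∀ᶠ s in 𝓝[Set.Icc 0 1] t₀, pathExt g s * (pathExt g t₀)⁻¹ ∈ src E G :=
        ((hg t₀ ht₀).continuousWithinAt.mul continuousWithinAt_const).eventually_mem
          ((isOpen_src E G).mem_nhds hmem)
      filter_upwards [eventually_eventually_nhdsWithin.2 hsrc, self_mem_nhdsWithin] with s hs hsI
      have hs0 := hs.self_of_nhdsWithin hsI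
      have hzs : HasDerivWithinAt z (derivWithin z (Set.Icc 0 1) s) (Set.Icc 0 1) s :=
        ((contDiffWithinAt_toE_div (by norm_cast) (hg s hsI) _
          hs0).differentiableWithinAt (by simp)).hasDerivWithinAt
      have := HasRightLog.of_chart (γ := pathExt g) (c := pathExt g t₀) hsI hzs (toE_mem_dom hs0)
        (hs.mono fun r hr => by simp only [hz, ofE_toE hr, inv_mul_cancel_right])
      rw [pathExt_of_mem _ hsI]
      exact derivMulInv_eq (t := ⟨s, hsI⟩) this
    exact h3.congr_of_eventuallyEq hev (hev.self_of_nhdsWithin ht₀)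
  obtain ⟨v, hv⟩ := C1.exists_val_eq_of_contDiffOn hcont
  exact ⟨v, fun t => (hv t).trans (pathExt_coe _ t)⟩

/-- Bootstrapping: in a translated chart the path satisfies `z' = expCoeff E G z u` with `u` of
class `C^1`. Two rounds starting from continuity give class `C^2`. -/
theorem mem_gaugeGroup_of_hasRD {g : I → G} {u : C1 E} (hg : HasRD g (C1.val u)) :
    g ∈ gaugeGroup E G := by
  have htop := isTopologicalGroup E G
  intro t₀ ht₀
  set c := pathExt g t₀ with hc
  set z : ℝ → E := fun r => toE E (pathExt g r * c⁻¹) with hz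
  have hmem : pathExt g t₀ * c⁻¹ ∈ src E G := by simpa [hc] using one_mem_src E G
  set w : Set ℝ := {s | s ∈ Set.Icc (0 : ℝ) 1 ∧ pathExt g s * c⁻¹ ∈ src E G} with hw
  have hwI : w ⊆ Set.Icc 0 1 := fun s hs => hs.1
  have hcg : ∀ s ∈ Set.Icc (0 : ℝ) 1, ContinuousWithinAt (pathExt g) (Set.Icc 0 1) s :=
    fun s hs => (hg ⟨s, hs⟩).1
  have hwn : w ∈ 𝓝[Set.Icc 0 1] t₀ := Filter.inter_mem self_mem_nhdsWithin
    (((hcg t₀ ht₀).mul continuousWithinAt_const).eventually_mem ((isOpen_src E G).mem_nhds hmem))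
  have hder : ∀ s ∈ w, HasDerivWithinAt z (expCoeff E G (z s) (pathExt (C1.val u) s)) w s := by
    intro s hs
    have h1 : HasRightLog (pathExt g) (pathExt (C1.val u) s) s := by
      rw [pathExt_of_mem _ hs.1]; exact hg ⟨s, hs.1⟩
    exact (h1.hasDerivWithinAt_chart hs.2).mono hwI
  have step : ∀ n : ℕ, n ≤ 1 → ContDiffOn ℝ n z w → ContDiffOn ℝ (n + 1 : ℕ) z w := by
    intro n hn h s hs
    have hF : ContDiffOn ℝ n (fun s => expCoeff E G (z s) (pathExt (C1.val u) s)) w := by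
      intro r hr
      refine ContDiffWithinAt.clm_apply (f := fun s => expCoeff E G (z s))
        (ContDiffAt.comp_contDiffWithinAt (g := expCoeff E G) r
          ((contDiffAt_expCoeff (toE_mem_dom hr.2)).of_le (by norm_cast; exact le_top))
          (h r hr)) ?_
      exact ((C1.contDiffOn_val u).of_le (by exact_mod_cast hn) r hr.1).mono hwI
    push_cast
    rw [contDiffWithinAt_succ_iff_hasFDerivWithinAt (by simp)]
    refine ⟨w, by rw [Set.insert_eq_of_mem hs]; exact self_mem_nhdsWithin, by simp, fun s =>
      ContinuousLinearMap.toSpanSingleton ℝ (expCoeff E G (z s) (pathExt (C1.val u) s)),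
      fun r hr => (hder r hr).hasFDerivWithinAt, ?_⟩
    exact (ContinuousLinearMap.toSpanSingletonCLE (𝕜 := ℝ) (E := E)).contDiff.comp_contDiffWithinAt
      (hF s hs)
  have h0 : ContDiffOn ℝ (0 : ℕ) z w :=
    contDiffOn_zero.2 fun s hs => (hder s hs).continuousWithinAt
  have h2 := step 1 le_rfl (step 0 zero_le_one h0)
  have hzt : ContDiffWithinAt ℝ 2 z (Set.Icc 0 1) t₀ :=
    (h2 t₀ ⟨ht₀, hmem⟩).mono_of_mem_nhdsWithin hwn
  have hL : LieGroup 𝓘(ℝ, E) 2 G := LieGroup.of_le (n := ∞) (by norm_cast)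
  have h3 : ContMDiffWithinAt 𝓘(ℝ, ℝ) 𝓘(ℝ, E) 2 (fun s => ofE G (z s) * c) (Set.Icc 0 1) t₀ :=
    (ContMDiffAt.comp_contMDiffWithinAt (I' := 𝓘(ℝ, E)) t₀
      ((contMDiffAt_ofE (toE_mem_dom hmem)).of_le (by norm_cast))
      hzt.contMDiffWithinAt).mul contMDiffWithinAt_const
  refine h3.congr_of_eventuallyEq ?_ ?_
  · filter_upwards [hwn] with s hs
    simp only [hz, ofE_toE hs.2, inv_mul_cancel_right]
  · simp only [hz, ofE_toE hmem, inv_mul_cancel_right]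

/-- The adjoint action preserves the bracket. -/
theorem AdL_bracket (g : G) (x y : E) :
    AdL g (bracket E G x y) = bracket E G (AdL g x) (AdL g y) := by
  have h0 : (0 : ℝ) ∈ Set.Icc (0 : ℝ) 1 := Set.left_mem_Icc.2 zero_le_one
  -- A curve through `1` with velocity `x`. The claim is the derivative at `0` of `Ad(g γ g⁻¹) Ad(g)
  -- y = Ad(g) Ad(γ) y`.
  set γ : ℝ → G := fun s => ofE G (origin E G + s • x) with hγ
  have hz : HasDerivWithinAt (fun s : ℝ => origin E G + s • x) x (Set.Icc 0 1) 0 := by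
    simpa using ((hasDerivAt_id (0 : ℝ)).smul_const x).const_add (origin E G) |>.hasDerivWithinAt
  have h1 : HasRightLog γ x 0 := by
    have := HasRightLog.of_chart (G := G) (γ := γ) (c := 1) h0 hz
      (by simpa using origin_mem_dom E G) (Filter.Eventually.of_forall fun s => by simp [hγ])
    simpa [logCoeff_origin] using this
  have hγ0 : γ 0 = 1 := by simp [hγ]
  have h2 : HasRightLog (fun s => g * γ s * g⁻¹) (AdL g x) 0 := by
    have := ((hasRightLog_const (E := E) g 0).mul h1).mul (hasRightLog_const (E := E) g⁻¹ 0)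
    simpa using this
  have h3 := (h2.hasDerivWithinAt_AdL.clm_apply (hasDerivWithinAt_const _ _ (AdL g y)))
  have h4 := (AdL (E := E) g).hasFDerivAt.comp_hasDerivWithinAt (0 : ℝ)
    (h1.hasDerivWithinAt_AdL.clm_apply (hasDerivWithinAt_const _ _ y))
  have h5 : HasDerivWithinAt (fun s => AdL (g * γ s * g⁻¹) (AdL g y)) _ (Set.Icc 0 1) 0 :=
    h4.congr (fun s _ => by simp [AdL_mul_apply]) (by simp [AdL_mul_apply])
  have h6 := (uniqueDiffOn_Icc zero_lt_one 0 h0).eq_deriv _ h5 h3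
  simpa [hγ0, AdL_one, bracket_eq_adL] using h6

end Gauge

end

end OctonionicNahm

namespace OctonionicNahm

noncomputable section

/-! ### Holonomy -/

/-- The inverse function theorem, in a convenient form. -/
theorem exists_smooth_localInverse {X Y : Type*} [NormedAddCommGroup X] [NormedSpace ℝ X]
    [CompleteSpace X] [NormedAddCommGroup Y] [NormedSpace ℝ Y] {f : X → Y} {a : X}
    (hf : ∀ᶠ x in 𝓝 a, ContDiffAt ℝ ∞ f x) {f' : X ≃L[ℝ] Y}
    (hf' : HasFDerivAt f (f' : X →L[ℝ] Y) a) :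
    ∃ g : Y → X, (∀ᶠ y in 𝓝 (f a), ContDiffAt ℝ ∞ g y) ∧ g (f a) = a ∧
      (∀ᶠ y in 𝓝 (f a), f (g y) = y) ∧ HasFDerivAt g (f'.symm : Y →L[ℝ] X) (f a) := by
  have hn : (∞ : WithTop ℕ∞) ≠ 0 := by simp
  have hfa := hf.self_of_nhds
  have hs : HasStrictFDerivAt f (f' : X →L[ℝ] Y) a := hfa.hasStrictFDerivAt' hf' hn
  have hga := hs.localInverse_apply_image
  have hgc : Filter.Tendsto (hs.localInverse f f' a) (𝓝 (f a)) (𝓝 a) := by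
    have := hs.to_localInverse.hasFDerivAt.continuousAt
    rwa [ContinuousAt, hga] at this
  -- Isomorphisms form an open set, so the derivative stays invertible near `a`; this gives
  -- smoothness of the inverse on a neighbourhood and not only at `f a`.
  have hinv : ∀ᶠ x in 𝓝 a, fderiv ℝ f x ∈ Set.range ((↑) : (X ≃L[ℝ] Y) → X →L[ℝ] Y) := by
    have hc : ContinuousAt (fderiv ℝ f) a :=
      (hfa.fderiv_right (m := 0) (by simp)).continuousAt
    exact hc.eventually_mem (by rw [hf'.fderiv]; exact f'.nhds)
  refine ⟨hs.localInverse f f' a, ?_, hga, hs.eventually_right_inverse,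
    hs.to_localInverse.hasFDerivAt⟩
  filter_upwards [hgc.eventually hf, hgc.eventually hinv,
    (hs.toOpenPartialHomeomorph f).open_target.mem_nhds
      hs.image_mem_toOpenPartialHomeomorph_target] with y h1 h2 h3
  obtain ⟨e, he⟩ := h2
  refine (hs.toOpenPartialHomeomorph f).contDiffAt_symm h3 (f₀' := e) ?_ h1
  rw [he]
  exact (h1.differentiableAt hn).hasFDerivAt

section Holonomy

variable {E : Type*} [NormedAddCommGroup E] [NormedSpace ℝ E] [CompleteSpace E]
variable {G : Type*} [TopologicalSpace G] [ChartedSpace E G] [Group G]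
variable [LieGroup 𝓘(ℝ, E) ∞ G]

variable (E G) in
/-- The right logarithmic derivative of a path in the chart, together with its initial value. -/
def chartLog (z : C1 E) : E × C(I, E) :=
  (C1.val z 0, pointwiseApply (superpose (logCoeff E G) (C1.val z)) (C1.der z))

theorem contDiffAt_chartLog {z : C1 E} (hz : C1.val z ∈ pathsIn I (dom E G)) :
    ContDiffAt ℝ ∞ (chartLog E G) z := by
  have h1 : ContDiffAt ℝ ∞ (fun z : C1 E => C1.val z 0) z := (C1.contDiff_val_apply 0).contDiffAt
  have h2 : ContDiffAt ℝ ∞ (superpose (K := I) (logCoeff E G)) (C1.val z) :=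
    (contDiffOn_superpose (isOpen_dom E G)
      (fun x hx => (contDiffAt_logCoeff hx).contDiffWithinAt)).contDiffAt
      ((isOpen_pathsIn (isOpen_dom E G)).mem_nhds hz)
  have h3 : ContDiffAt ℝ ∞ (fun z : C1 E => superpose (K := I) (logCoeff E G) (C1.val z)) z :=
    h2.comp z C1.contDiff_val.contDiffAt
  exact h1.prodMk (((contDiff_pointwiseApply (K := I) (E := E) (F := E)).contDiffAt.comp z h3).clm_apply
    C1.contDiff_der.contDiffAt)

variable (E G) in
-- The equation `h' h⁻¹ = u` is solved for all small `u` at once by inverting `chartLog` at the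
-- constant path. There its derivative is the isomorphism `C1.equiv`, because `logCoeff` is the
-- identity at the origin. The third clause says that `S` has derivative `w ↦ ∫ w` at `0`; it is
-- needed in `exists_log`.
theorem exists_localPath : ∃ S : C(I, E) → C1 E, (∀ᶠ u in 𝓝 0, ContDiffAt ℝ ∞ S u) ∧
    S 0 = C1.ofDer (origin E G) 0 ∧
    (∀ Z : C(I, E) →L[ℝ] C1 E, HasFDerivAt S Z 0 → ∀ w, Z w = C1.ofDer 0 w) ∧
    ∀ᶠ u in 𝓝 0, C1.val (S u) 0 = origin E G ∧ C1.val (S u) ∈ pathsIn I (dom E G) ∧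
      HasRD (fun t => ofE G (C1.val (S u) t)) u := by
  set z₀ : C1 E := C1.ofDer (origin E G) 0 with hz₀
  have hval : C1.val z₀ = constPath (origin E G) := by
    change constPath (origin E G) + primitive 0 = _
    rw [map_zero, add_zero]
  have hz₀d : C1.val z₀ ∈ pathsIn I (dom E G) := fun t => by
    rw [hval]; exact origin_mem_dom E G
  have hlog : superpose (logCoeff E G) (C1.val z₀) = constPath (ContinuousLinearMap.id ℝ E) := by
    ext1 t
    rw [superpose_apply (isOpen_dom E G)
      (fun x hx => (contDiffAt_logCoeff hx).continuousAt.continuousWithinAt) hz₀d, hval]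
    exact logCoeff_origin
  have hΦ : chartLog E G z₀ = (origin E G, 0) := by
    simp [chartLog, hz₀]
  have hder : HasFDerivAt (chartLog E G) ((C1.equiv : C1 E ≃L[ℝ] E × C(I, E)) :
      C1 E →L[ℝ] E × C(I, E)) z₀ := by
    have h1 : HasFDerivAt (fun z : C1 E => C1.val z 0) _ z₀ :=
      C1.hasFDerivAt_val_apply 0 z₀
    have h2 : DifferentiableAt ℝ
        (fun z : C1 E => pointwiseApply (superpose (K := I) (logCoeff E G) (C1.val z))) z₀ := by
      have h2 : ContDiffAt ℝ ∞ (superpose (K := I) (logCoeff E G)) (C1.val z₀) :=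
        (contDiffOn_superpose (isOpen_dom E G)
          (fun x hx => (contDiffAt_logCoeff hx).contDiffWithinAt)).contDiffAt
          ((isOpen_pathsIn (isOpen_dom E G)).mem_nhds hz₀d)
      exact (((contDiff_pointwiseApply (K := I) (E := E) (F := E)).contDiffAt.comp z₀
        (h2.comp z₀ C1.contDiff_val.contDiffAt))).differentiableAt (by simp)
    have h3 := h1.prodMk (HasFDerivAt.clm_apply (c := fun z : C1 E =>
      pointwiseApply (superpose (K := I) (logCoeff E G) (C1.val z))) (u := C1.der)
      h2.hasFDerivAt (C1.hasFDerivAt_der z₀))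
    refine h3.congr_fderiv ?_
    ext1 h
    refine Prod.ext rfl ?_
    ext1 t
    -- The base path is constant, so the term with the derivative of `logCoeff` vanishes.
    have hd0 : C1.der z₀ = 0 := C1.der_ofDer _ _
    simp [hlog, hd0]
    rfl
  obtain ⟨g, hg, hg0, hgr, hgd⟩ := exists_smooth_localInverse
    (Filter.eventually_of_mem ((C1.val.continuous.continuousAt (x := z₀)).preimage_mem_nhds
      ((isOpen_pathsIn (isOpen_dom E G)).mem_nhds hz₀d)) fun z hz => contDiffAt_chartLog hz) hder
  rw [hΦ] at hg hg0 hgr hgd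
  have hi : ContDiff ℝ ∞ (fun u : C(I, E) => (origin E G, u)) := contDiff_const.prodMk contDiff_id
  have hS : ∀ᶠ u in 𝓝 (0 : C(I, E)), ContDiffAt ℝ ∞ (fun u : C(I, E) => g (origin E G, u)) u := by
    filter_upwards [(hi.continuous.continuousAt (x := 0)).eventually hg] with u hu
    exact ContDiffAt.comp (g := g) u hu hi.contDiffAt
  refine ⟨fun u => g (origin E G, u), hS, hg0, ?_, ?_⟩
  · intro Z hZ w
    have h1 := (HasFDerivAt.comp (f := fun u : C(I, E) => (origin E G, u)) (0 : C(I, E)) hgd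
      (hasFDerivAt_prodMk_right (origin E G) (0 : C(I, E))))
    rw [hZ.unique h1]
    rfl
  · have h1 : ∀ᶠ u in 𝓝 (0 : C(I, E)), C1.val (g (origin E G, u)) ∈ pathsIn I (dom E G) :=
      (C1.val.continuous.continuousAt.comp hS.self_of_nhds.continuousAt).eventually_mem
        ((isOpen_pathsIn (isOpen_dom E G)).mem_nhds (by
          simp only [Function.comp_apply, hg0]; exact hz₀d))
    filter_upwards [h1, (hi.continuous.continuousAt (x := 0)).eventually hgr] with u hu1 hu2
    have e1 := congrArg Prod.fst hu2
    have e2 := congrArg Prod.snd hu2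
    refine ⟨e1, hu1, fun t => ?_⟩
    set z := g (origin E G, u)
    have h3 := HasRightLog.of_chart (γ := pathExt fun t => ofE G (C1.val z t)) (c := 1) t.2
      (C1.hasDerivWithinAt z t) (by rw [Set.IccExtend_val]; exact hu1 t)
      (Filter.Eventually.of_forall fun s => by rw [mul_one]; rfl)
    rw [Set.IccExtend_val] at h3
    convert h3 using 1
    have e3 := congrArg (fun w : C(I, E) => w t) e2
    rw [← e3]
    change superpose (logCoeff E G) (C1.val z) t (C1.der z t) = _
    rw [superpose_apply (isOpen_dom E G)
      (fun x hx => (contDiffAt_logCoeff hx).continuousAt.continuousWithinAt) hu1]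

/-- The path of inverse adjoint actions along a path in the group. -/
def invAdPath {h : I → G} (hh : Continuous h) : C(I, E →L[ℝ] E) :=
  ⟨fun t => AdL (h t)⁻¹, by
    have := isTopologicalGroup E G
    exact continuous_AdL.comp hh.inv⟩

/-- The product rule solved for the second factor. It reduces the equation near an arbitrary `u` to
the equation near `0`. -/
theorem HasRD.mul_of_invAdPath {h k : I → G} {u v : C(I, E)} (hh : HasRD h u)
    (hc : Continuous h) (hk : HasRD k (pointwiseApply (invAdPath (E := E) hc) (v - u))) :
    HasRD (fun t => h t * k t) v := by
  convert hh.mul hk using 2 with t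
  simp [invAdPath]

variable [CompactSpace G]

/-- Continuation along the segment from `0` to `u`. Compactness of `G` bounds `Ad` uniformly, so the
admissible step length does not depend on the path already built and finitely many steps suffice. -/
theorem exists_hasRD (u : C(I, E)) : ∃ h : I → G, h 0 = 1 ∧ HasRD h u := by
  obtain ⟨S, -, -, -, hS⟩ := exists_localPath E G
  obtain ⟨δ, hδ, hball⟩ := Metric.eventually_nhds_iff.1 hS
  obtain ⟨C, hC⟩ := (isCompact_range (continuous_AdL (E := E) (G := G))).isBounded.exists_norm_le
  have hC0 : 0 ≤ C := (norm_nonneg _).trans (hC _ ⟨1, rfl⟩)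
  have step : ∀ v w : C(I, E), ‖w - v‖ < δ / (C + 1) → (∃ h : I → G, h 0 = 1 ∧ HasRD h v) →
      ∃ h : I → G, h 0 = 1 ∧ HasRD h w := by
    rintro v w hvw ⟨h, h0, hh⟩
    set Z := pointwiseApply (invAdPath (E := E) hh.continuous) (w - v) with hZ
    have hZn : ‖Z‖ < δ := by
      have h1 : ‖Z‖ ≤ C * ‖w - v‖ := (ContinuousMap.norm_le _ (by positivity)).2 fun t =>
        (AdL (h t)⁻¹).le_of_opNorm_le_of_le (hC _ ⟨_, rfl⟩) ((w - v).norm_coe_le_norm t)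
      rw [lt_div_iff₀ (by positivity)] at hvw
      nlinarith [norm_nonneg (w - v)]
    obtain ⟨k0, -, hk⟩ := hball (by simpa using hZn : dist Z 0 < δ)
    exact ⟨_, by simp [h0, k0], hh.mul_of_invAdPath hh.continuous hk⟩
  obtain ⟨n, hn⟩ := exists_nat_gt (‖u‖ / (δ / (C + 1)))
  have hn0 : (0 : ℝ) < n := lt_of_le_of_lt (by positivity) hn
  have hj : ∀ j : ℕ, ∃ h : I → G, h 0 = 1 ∧ HasRD h (((j : ℝ) / n) • u : C(I, E)) := by
    intro j
    induction j with
    | zero =>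
      refine ⟨fun _ => 1, rfl, ?_⟩
      simpa using hasRD_const (E := E) (1 : G)
    | succ j ih =>
      refine step _ _ ?_ ih
      rw [← sub_smul, norm_smul, ← sub_div, Nat.cast_succ, add_sub_cancel_left,
        Real.norm_of_nonneg (by positivity), one_div, inv_mul_lt_iff₀ hn0]
      rwa [div_lt_iff₀ (by positivity)] at hn
  have := hj n
  rwa [div_self hn0.ne', one_smul] at this

variable (G) in
/-- The path starting at the identity with right logarithmic derivative `u`. -/
def develop (u : C(I, E)) : I → G := (exists_hasRD u).choose

variable (G) in
theorem develop_zero (u : C(I, E)) : develop G u 0 = 1 := (exists_hasRD u).choose_spec.1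

variable (G) in
theorem hasRD_develop (u : C(I, E)) : HasRD (develop G u) u := (exists_hasRD u).choose_spec.2

variable (G) in
/-- The end point of the path with right logarithmic derivative `u`. -/
def hol (u : C(I, E)) : G := develop G u 1

variable [T2Space G] [FiniteDimensional ℝ E]

theorem develop_eq {u : C(I, E)} {h : I → G} (hh : HasRD h u) (h0 : h 0 = 1) : develop G u = h :=
  (hasRD_develop G u).eq hh (by rw [develop_zero, h0])

/-- Near `u₀` the holonomy is `hol G u₀` times the holonomy of the small path `Ad(h⁻¹)(u - u₀)`,
which `exists_localPath` describes smoothly. -/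
theorem contMDiff_hol : ContMDiff 𝓘(ℝ, C(I, E)) 𝓘(ℝ, E) ∞ (hol G : C(I, E) → G) := by
  intro u₀
  obtain ⟨S, hS, hS0, -, hev⟩ := exists_localPath E G
  have hh := hasRD_develop G u₀
  set T := pointwiseApply (invAdPath (E := E) hh.continuous) with hT
  have hL : ContDiffAt ℝ ∞ (fun u : C(I, E) => T (u - u₀)) u₀ :=
    T.contDiff.contDiffAt.comp u₀ (contDiffAt_id.sub contDiffAt_const)
  have hL0 : T (u₀ - u₀) = 0 := by simp
  have hf : ContDiffAt ℝ ∞ (fun u : C(I, E) => C1.val (S (T (u - u₀))) 1) u₀ := by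
    have h1 : ContDiffAt ℝ ∞ (fun u : C(I, E) => S (T (u - u₀))) u₀ :=
      ContDiffAt.comp (g := S) u₀ (by rw [hL0]; exact hS.self_of_nhds) hL
    exact (C1.contDiff_val_apply 1).contDiffAt.comp u₀ h1
  have hev' := hL.continuousAt.eventually (hL0.symm ▸ hev)
  have hg : ContMDiffAt 𝓘(ℝ, C(I, E)) 𝓘(ℝ, E) ∞
      (fun u => hol G u₀ * ofE G (C1.val (S (T (u - u₀))) 1)) u₀ :=
    contMDiffAt_const.mul (ContMDiffAt.comp (I' := 𝓘(ℝ, E)) u₀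
      (contMDiffAt_ofE (hev'.self_of_nhds.2.1 1)) hf.contMDiffAt)
  refine hg.congr_of_eventuallyEq ?_
  filter_upwards [hev'] with u hu
  have h1 := hh.mul_of_invAdPath hh.continuous (v := u) hu.2.2
  have h2 := develop_eq h1 (by simp only [develop_zero, hu.1, ofE_origin, mul_one])
  rw [hol, h2]
  rfl

end Holonomy

end

end OctonionicNahm

namespace OctonionicNahm

noncomputable section

/-! ### Sections of the holonomy -/

section HolonomySection

variable {E : Type*} [NormedAddCommGroup E] [NormedSpace ℝ E] [FiniteDimensional ℝ E]
  [CompleteSpace E]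
variable {G : Type*} [TopologicalSpace G] [ChartedSpace E G] [Group G]
variable [LieGroup 𝓘(ℝ, E) ∞ G] [CompactSpace G] [T2Space G]

/-- The map `y ↦ hol G (constPath y)` plays the role of the exponential map. In the chart its
derivative at `0` is the identity, so it has a smooth local inverse `ℓ`. -/
theorem exists_log : ∃ ℓ : E → E, (∀ᶠ x in 𝓝 (origin E G), ContDiffAt ℝ ∞ ℓ x) ∧ ℓ (origin E G) = 0 ∧
    ∀ᶠ x in 𝓝 (origin E G), hol G (constPath (ℓ x)) = ofE G x := by
  obtain ⟨S, hS, hS0, hSd, hev⟩ := exists_localPath E G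
  have hc0 : constPath (0 : E) = 0 := map_zero _
  set f : E → E := fun y => C1.val (S (constPath y)) 1 with hf
  have hfs : ∀ᶠ y in 𝓝 (0 : E), ContDiffAt ℝ ∞ f y := by
    filter_upwards [(constPath.continuous.continuousAt (x := (0 : E))).eventually
      (hc0.symm ▸ hS)] with y hy
    have hSc : ContDiffAt ℝ ∞ (fun y : E => S (constPath y)) y := ContDiffAt.comp (g := S) y hy
      (ContinuousLinearMap.contDiff (𝕜 := ℝ) (E := E) (F := C(I, E)) constPath).contDiffAt
    exact (C1.contDiff_val_apply 1).contDiffAt.comp y hSc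
  have hf0 : f 0 = origin E G := by
    simp only [hf, hc0, hS0]
    change origin E G + primitive 0 1 = _
    rw [map_zero]
    exact add_zero _
  have hSdiff := (hS.self_of_nhds.differentiableAt (by simp)).hasFDerivAt
  have hder : HasFDerivAt f ((ContinuousLinearEquiv.refl ℝ E : E ≃L[ℝ] E) : E →L[ℝ] E) 0 := by
    have h1 : HasFDerivAt S (fderiv ℝ S 0) (constPath (0 : E)) := by rw [hc0]; exact hSdiff
    have h2 : HasFDerivAt f ((C1.eval 1).comp ((fderiv ℝ S 0).comp constPath)) 0 :=
      HasFDerivAt.comp (g := fun z : C1 E => C1.val z 1) (0 : E) (C1.hasFDerivAt_val_apply 1 _)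
        (HasFDerivAt.comp (g := S) (0 : E) h1
          (ContinuousLinearMap.hasFDerivAt (𝕜 := ℝ) (E := E) (F := C(I, E)) constPath))
    refine h2.congr_fderiv ?_
    ext1 y
    simp only [ContinuousLinearMap.comp_apply, hSd _ hSdiff]
    change (0 : E) + primitiveFun (constPath y) 1 = y
    have hconst : Set.IccExtend (zero_le_one' ℝ) (constPath y) = fun _ => y := rfl
    simp [primitiveFun, hconst]
  obtain ⟨g, hg, hg0, hgr, -⟩ := exists_smooth_localInverse hfs hder
  rw [hf0] at hg hg0 hgr
  refine ⟨g, hg, hg0, ?_⟩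
  have hcont : ContinuousAt (fun x => constPath (g x)) (origin E G) :=
    constPath.continuous.continuousAt.comp hg.self_of_nhds.continuousAt
  have hg0' : constPath (g (origin E G)) = 0 := by rw [hg0, hc0]
  filter_upwards [hgr, hcont.eventually (hg0'.symm ▸ hev)] with x hx hx2
  rw [hol, develop_eq hx2.2.2 (by simp only [hx2.1, ofE_origin])]
  exact congrArg (ofE G) hx

/-- The path `t ↦ Ad(h(t)) y` along the development of a `C^1` path. -/
theorem exists_adPath (u : C1 E) : ∃ A : E →L[ℝ] C1 E, ∀ y t,
    C1.val (A y) t = AdL (develop G (C1.val u) t) y := by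
  set h := develop G (C1.val u) with hh
  have hRD : HasRD h (C1.val u) := hasRD_develop G (C1.val u)
  have hc : Continuous fun t => AdL (E := E) (h t) := continuous_AdL.comp hRD.continuous
  let A : E →ₗ[ℝ] C1 E :=
    { toFun := fun y => C1.mk ⟨fun t => AdL (h t) y, hc.clm_apply continuous_const⟩
        ⟨fun t => adL E G (C1.val u t) (AdL (h t) y),
          ((adL E G).continuous.comp (C1.val u).continuous).clm_apply
            (hc.clm_apply continuous_const)⟩ fun t => by
        have h1 := (hRD t).hasDerivWithinAt_AdL.clm_apply
          (hasDerivWithinAt_const (t : ℝ) (Set.Icc 0 1) y)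
        rw [pathExt_coe] at h1
        simp only [map_zero, add_zero] at h1
        exact h1
      map_add' := fun x y => C1.ext_val_der (by ext t; simp; rfl) (by ext t; simp; rfl)
      map_smul' := fun c y => C1.ext_val_der (by ext t; simp; rfl) (by ext t; simp; rfl) }
  exact ⟨LinearMap.toContinuousLinearMap A, fun y t => rfl⟩

/-- If `h` develops `u₀` and `k` develops the constant path `y`, then `h k` develops `u₀ + Ad(h) y`.
Its end point is `a₀ * k(1)`, so `y = ℓ(a₀⁻¹ a)` reaches `a`. -/
theorem exists_hol_section (u₀ : C1 E) : ∃ sec : G → C1 E,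
    (∀ᶠ a in 𝓝 (hol G (C1.val u₀)), ContMDiffAt 𝓘(ℝ, E) 𝓘(ℝ, C1 E) ∞ sec a) ∧ sec (hol G (C1.val u₀)) = u₀ ∧
    ∀ᶠ a in 𝓝 (hol G (C1.val u₀)), hol G (C1.val (sec a)) = a := by
  have htop := isTopologicalGroup E G
  obtain ⟨ℓ, hℓ, hℓ0, hev⟩ := exists_log (E := E) (G := G)
  obtain ⟨A, hA⟩ := exists_adPath (G := G) u₀
  set a₀ := hol G (C1.val u₀) with ha₀
  have hAhol : ∀ y, hol G (C1.val (u₀ + A y)) = a₀ * hol G (constPath y) := by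
    intro y
    have h1 := (hasRD_develop G (C1.val u₀)).mul (hasRD_develop G (constPath y))
    have h2 : HasRD (fun t => develop G (C1.val u₀) t * develop G (constPath y) t)
        (C1.val (u₀ + A y)) := by
      convert h1 using 2 with t
      rw [map_add, ContinuousMap.add_apply, hA]
      rfl
    rw [hol, develop_eq h2 (by simp [develop_zero])]
    rfl
  have hone : a₀⁻¹ * a₀ ∈ src E G := by simpa using one_mem_src E G
  have hc : ContinuousAt (fun a : G => a₀⁻¹ * a) a₀ := by fun_prop
  have hsrc := hc.eventually_mem ((isOpen_src E G).mem_nhds hone)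
  have h1 : ∀ a, a₀⁻¹ * a ∈ src E G →
      ContMDiffAt 𝓘(ℝ, E) 𝓘(ℝ, E) ∞ (fun a : G => toE E (a₀⁻¹ * a)) a := fun a ha =>
    ContMDiffAt.comp (g := toE E) a (contMDiffAt_toE ha) (contMDiffAt_const.mul contMDiffAt_id)
  have h10 : toE E (a₀⁻¹ * a₀) = origin E G := by simp [toE_one]
  have hAs : ContDiff ℝ ∞ (fun y : E => u₀ + A y) := contDiff_const.add
    (ContinuousLinearMap.contDiff (𝕜 := ℝ) (E := E) (F := C1 E) A)
  refine ⟨fun a => u₀ + A (ℓ (toE E (a₀⁻¹ * a))), ?_, ?_, ?_⟩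
  · filter_upwards [hsrc, (h1 a₀ hone).continuousAt.eventually (h10.symm ▸ hℓ)] with a ha hb
    exact hAs.contMDiff.contMDiffAt.comp a (ContMDiffAt.comp (g := ℓ) a hb.contMDiffAt (h1 a ha))
  · simp only [h10, hℓ0, map_zero, add_zero]
  · filter_upwards [hsrc, (h1 a₀ hone).continuousAt.eventually (h10.symm ▸ hev)] with a ha ha2
    rw [hAhol, ha2, ofE_toE ha, mul_inv_cancel_left]

theorem develop_mem_gaugeGroup (u : C1 E) : develop G (C1.val u) ∈ gaugeGroup E G :=
  mem_gaugeGroup_of_hasRD (hasRD_develop G (C1.val u))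

/-- In a connected group every element is the end point of a gauge transformation starting
at the identity. -/
theorem exists_mem_gaugeGroup_eq [ConnectedSpace G] (a : G) :
    ∃ g ∈ gaugeGroup E G, g 0 = 1 ∧ g 1 = a := by
  have htop := isTopologicalGroup E G
  let H : Subgroup G :=
    { carrier := {a | ∃ g ∈ gaugeGroup E G, g 0 = 1 ∧ g 1 = a}
      mul_mem' := by
        rintro _ _ ⟨g, hg, hg0, rfl⟩ ⟨h, hh, hh0, rfl⟩
        exact ⟨g * h, mul_mem hg hh, by simp [hg0, hh0], rfl⟩
      one_mem' := ⟨1, one_mem _, rfl, rfl⟩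
      inv_mem' := by
        rintro _ ⟨g, hg, hg0, rfl⟩
        exact ⟨g⁻¹, inv_mem hg, by simp [hg0], rfl⟩ }
  have h0 : hol G (C1.val (0 : C1 E)) = 1 := by
    rw [map_zero, hol, develop_eq (h := fun _ => 1) (hasRD_const 1) rfl]
  obtain ⟨sec, -, -, hsec⟩ := exists_hol_section (G := G) (0 : C1 E)
  rw [h0] at hsec
  -- Local sections at `1` make the subgroup of end points open, hence closed, hence everything.
  have hopen : IsOpen (H : Set G) := H.isOpen_of_mem_nhds (g := 1) <| by
    filter_upwards [hsec] with a ha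
    exact ⟨_, develop_mem_gaugeGroup (sec a), develop_zero _ _, ha⟩
  have huniv : (H : Set G) = Set.univ :=
    IsClopen.eq_univ ⟨H.isClosed_of_isOpen hopen, hopen⟩ ⟨1, H.one_mem⟩
  exact (huniv ▸ Set.mem_univ a : a ∈ (H : Set G))

end HolonomySection

end

end OctonionicNahm

namespace OctonionicNahm

noncomputable section

/-! ### The octonionic Nahm equations as an ordinary differential equation -/

section PostComp

variable {F F' : Type*} [NormedAddCommGroup F] [NormedSpace ℝ F]
variable [NormedAddCommGroup F'] [NormedSpace ℝ F']

/-- Composition of a `C^1` path with a continuous linear map. -/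
def C1.map (L : F →L[ℝ] F') : C1 F →L[ℝ] C1 F' :=
  (((L.compLeftContinuous ℝ I).comp C1.val).prod
    ((L.compLeftContinuous ℝ I).comp C1.der)).codRestrict (C1 F') fun y t =>
      L.hasFDerivAt.comp_hasDerivWithinAt (t : ℝ) (C1.hasDerivWithinAt y t)

@[simp] theorem C1.val_map (L : F →L[ℝ] F') (y : C1 F) (t : I) :
    C1.val (C1.map L y) t = L (C1.val y t) := rfl

theorem C1.ext_val {y z : C1 F} (h : ∀ t, C1.val y t = C1.val z t) : y = z := by
  have hv : C1.val y = C1.val z := ContinuousMap.ext h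
  refine C1.ext_val_der hv (ContinuousMap.ext fun t => ?_)
  have h1 := C1.hasDerivWithinAt z t
  rw [← hv] at h1
  exact (uniqueDiffOn_Icc zero_lt_one (t : ℝ) t.2).eq_deriv _ (C1.hasDerivWithinAt y t) h1

end PostComp

section Nahm

universe u

variable {E : Type u} [NormedAddCommGroup E] [NormedSpace ℝ E]

/-- The components `1, …, 7` of an element of `𝔤 ⊗ ℝ⁸`. -/
def tailL : (Fin 8 → E) →L[ℝ] (Fin 7 → E) :=
  ContinuousLinearMap.pi fun i => ContinuousLinearMap.proj i.succ

@[simp] theorem tailL_apply (x : Fin 8 → E) (i : Fin 7) : tailL x i = x i.succ := rfl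

/-- The component `0` of an element of `𝔤 ⊗ ℝ⁸`. -/
def headL : (Fin 8 → E) →L[ℝ] E := ContinuousLinearMap.proj 0

/-- The inclusion of the component `0`. -/
def inHead : E →L[ℝ] (Fin 8 → E) :=
  ContinuousLinearMap.pi fun j => Fin.cases (ContinuousLinearMap.id ℝ E) (fun _ => 0) j

/-- The inclusion of the components `1, …, 7`. -/
def inTail : (Fin 7 → E) →L[ℝ] (Fin 8 → E) :=
  ContinuousLinearMap.pi fun j => Fin.cases 0 (fun i => ContinuousLinearMap.proj i) j

@[simp] theorem headL_inHead (x : E) : headL (inHead x) = x := rfl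
@[simp] theorem headL_inTail (x : Fin 7 → E) : headL (inTail x) = 0 := rfl
@[simp] theorem tailL_inHead (x : E) : tailL (inHead x) = 0 := rfl
@[simp] theorem tailL_inTail (x : Fin 7 → E) : tailL (inTail x) = x := rfl

theorem inHead_add_inTail (x : Fin 8 → E) : inHead (headL x) + inTail (tailL x) = x := by
  ext j
  refine Fin.cases ?_ (fun i => ?_) j
  · exact add_zero _
  · exact zero_add _

variable [FiniteDimensional ℝ E]
variable {G : Type*} [TopologicalSpace G] [ChartedSpace E G] [Group G]
variable [LieGroup 𝓘(ℝ, E) ∞ G]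

variable (E G) in
/-- The polarisation of the quadratic map `nahmTerm`. -/
def nahmBil : (Fin 8 → E) →L[ℝ] (Fin 8 → E) →L[ℝ] (Fin 7 → E) :=
  LinearMap.toContinuousLinearMap
    ((LinearMap.toContinuousLinearMap : ((Fin 8 → E) →ₗ[ℝ] (Fin 7 → E)) ≃ₗ[ℝ] _).toLinearMap.comp
      (LinearMap.mk₂ ℝ (fun x y : Fin 8 → E =>
        let b : Fin 8 → Fin 8 → E := fun i j => bracket E G (x i) (y j)
        (![b 0 1 + b 2 3 + b 4 5 + b 6 7,
          b 0 2 - b 1 3 + b 4 6 - b 5 7,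
          b 0 3 + b 1 2 - b 4 7 - b 5 6,
          b 0 4 - b 1 5 - b 2 6 + b 3 7,
          b 0 5 + b 1 4 + b 2 7 + b 3 6,
          b 0 6 - b 1 7 + b 2 4 - b 3 5,
          b 0 7 + b 1 6 - b 2 5 - b 3 4] : Fin 7 → E))
        (fun x y z => by
          ext i
          fin_cases i <;> simp [bracket_eq_adL] <;> abel)
        (fun c x y => by
          ext i
          fin_cases i <;> simp [bracket_eq_adL, smul_add, smul_sub])
        (fun x y z => by
          ext i
          fin_cases i <;> simp [bracket_eq_adL] <;> abel)
        (fun c x y => by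
          ext i
          fin_cases i <;> simp [bracket_eq_adL, smul_add, smul_sub])))

theorem nahmTerm_eq (x : Fin 8 → E) : nahmTerm E G x = nahmBil E G x x := rfl

theorem nahmTerm_sub (x y : Fin 8 → E) : nahmTerm E G x - nahmTerm E G y =
    nahmBil E G x (x - y) + nahmBil E G (x - y) y := by
  simp [nahmTerm_eq]

theorem hasFDerivAt_nahmTerm (x : Fin 8 → E) :
    HasFDerivAt (nahmTerm E G) (nahmBil E G x + (nahmBil E G).flip x) x := by
  have := ((nahmBil E G).hasFDerivAt (x := x)).clm_apply (hasFDerivAt_id x)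
  refine this.congr_fderiv ?_
  ext1 h
  simp

theorem contDiff_nahmTerm : ContDiff ℝ ∞ (nahmTerm E G) :=
  (nahmBil E G).contDiff.clm_apply contDiff_id

theorem mem_pathsIn_univ (z : C(I, Fin 8 → E)) : z ∈ pathsIn I Set.univ := fun _ => trivial

variable (E G) in
/-- The left hand side of the Nahm equations. -/
def residual (X : V E) : C(I, Fin 7 → E) :=
  tailL.compLeftContinuous ℝ I (C1.der X) + superpose (nahmTerm E G) (C1.val X)

theorem residual_apply (X : V E) (t : I) :
    residual E G X t = tailL (C1.der X t) + nahmTerm E G (C1.val X t) := by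
  simp only [residual, ContinuousMap.add_apply, superpose_apply isOpen_univ
    (contDiff_nahmTerm (E := E) (G := G)).continuous.continuousOn (mem_pathsIn_univ (C1.val X))]
  rfl

theorem mem_solutions_iff (X : V E) : X ∈ solutions E G ↔ residual E G X = 0 := by
  constructor
  · intro h
    ext t i
    rw [residual_apply]
    exact h t i
  · intro h t i
    have := congrFun (congrArg (fun f : C(I, Fin 7 → E) => f t) h) i
    simp only [residual_apply] at this
    exact this

variable (E G) in
/-- The linearisation of the Nahm equations at `X`. -/
def linCoeff (X : V E) : C(I, (Fin 8 → E) →L[ℝ] (Fin 7 → E)) :=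
  ⟨fun t => nahmBil E G (C1.val X t) + (nahmBil E G).flip (C1.val X t), by
    exact ((nahmBil E G).continuous.comp (C1.val X).continuous).add
      ((nahmBil E G).flip.continuous.comp (C1.val X).continuous)⟩

variable (E G) in
/-- The map `X ↦ (X_0, X_i(0), residual)`. -/
def nahmMap (X : V E) : C1 E × (Fin 7 → E) × C(I, Fin 7 → E) :=
  (C1.map headL X, tailL (C1.val X 0), residual E G X)

variable (E G) in
/-- The derivative of `nahmMap`. -/
def nahmMapDeriv (X : V E) : V E →L[ℝ] C1 E × (Fin 7 → E) × C(I, Fin 7 → E) :=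
  (C1.map headL).prod ((tailL.comp (C1.eval 0)).prod
    ((tailL.compLeftContinuous ℝ I).comp C1.der + (pointwiseApply (linCoeff E G X)).comp C1.val))

theorem contDiff_nahmMap : ContDiff ℝ ∞ (nahmMap E G) := by
  have h1 : ContDiff ℝ ∞ (superpose (K := I) (nahmTerm E G)) := by
    have := contDiffOn_superpose (K := I) isOpen_univ
      (contDiff_nahmTerm (E := E) (G := G)).contDiffOn
    rwa [show pathsIn I (Set.univ : Set (Fin 8 → E)) = Set.univ from
      Set.eq_univ_of_forall mem_pathsIn_univ, contDiffOn_univ] at this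
  have h2 : ContDiff ℝ ∞ (fun X : V E => superpose (nahmTerm E G) (C1.val X)) :=
    h1.comp C1.contDiff_val
  have h3 : ContDiff ℝ ∞ (fun X : V E => tailL.compLeftContinuous ℝ I (C1.der X)) :=
    (ContinuousLinearMap.contDiff (𝕜 := ℝ) (E := C(I, Fin 8 → E)) (F := C(I, Fin 7 → E))
      (tailL.compLeftContinuous ℝ I)).comp C1.contDiff_der
  have h4 : ContDiff ℝ ∞ (fun X : V E => tailL (C1.val X 0)) :=
    (tailL (E := E)).contDiff.comp (C1.contDiff_val_apply 0)
  have h5 : ContDiff ℝ ∞ (residual E G) := ContDiff.add (𝕜 := ℝ)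
    (f := fun X : V E => tailL.compLeftContinuous ℝ I (C1.der X))
    (g := fun X : V E => superpose (nahmTerm E G) (C1.val X)) h3 h2
  have h6 : ContDiff ℝ ∞ (fun X : V E => C1.map (headL (E := E)) X) :=
    ContinuousLinearMap.contDiff (𝕜 := ℝ) (E := V E) (F := C1 E) (C1.map (headL (E := E)))
  have h7 : ContDiff ℝ ∞ (fun X : V E => (tailL (C1.val X 0), residual E G X)) :=
    ContDiff.prodMk (𝕜 := ℝ) (f := fun X : V E => tailL (C1.val X 0))
      (g := fun X : V E => residual E G X) h4 h5
  exact ContDiff.prodMk (𝕜 := ℝ) (f := fun X : V E => C1.map (headL (E := E)) X)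
      (g := fun X : V E => (tailL (C1.val X 0), residual E G X)) h6 h7

theorem hasFDerivAt_nahmMap (X : V E) : HasFDerivAt (nahmMap E G) (nahmMapDeriv E G X) X := by
  have h1 := hasFDerivAt_superpose (K := I) isOpen_univ (f := nahmTerm E G)
    (fun x _ => (hasFDerivAt_nahmTerm x).differentiableAt)
    ((contDiff_nahmTerm (E := E) (G := G)).continuous_fderiv (by simp)).continuousOn
    (mem_pathsIn_univ (C1.val X))
  have hlin : superpose (fderiv ℝ (nahmTerm E G)) (C1.val X) = linCoeff E G X := by
    ext1 t
    rw [superpose_apply isOpen_univ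
      ((contDiff_nahmTerm (E := E) (G := G)).continuous_fderiv (by simp)).continuousOn
      (mem_pathsIn_univ (C1.val X)), (hasFDerivAt_nahmTerm _).fderiv]
    rfl
  rw [hlin] at h1
  have h2 : HasFDerivAt (fun X : V E => superpose (nahmTerm E G) (C1.val X))
      ((pointwiseApply (linCoeff E G X)).comp C1.val) X :=
    HasFDerivAt.comp (g := superpose (K := I) (nahmTerm E G)) X h1 (C1.hasFDerivAt_val X)
  have h3 : HasFDerivAt (fun X : V E => tailL.compLeftContinuous ℝ I (C1.der X))
      ((tailL.compLeftContinuous ℝ I).comp C1.der) X :=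
    HasFDerivAt.comp (g := tailL.compLeftContinuous ℝ I) X
      (ContinuousLinearMap.hasFDerivAt (𝕜 := ℝ) (E := C(I, Fin 8 → E)) (F := C(I, Fin 7 → E))
        (tailL.compLeftContinuous ℝ I)) (C1.hasFDerivAt_der X)
  have h4 : HasFDerivAt (fun X : V E => tailL (C1.val X 0)) (tailL.comp (C1.eval 0)) X :=
    HasFDerivAt.comp (g := tailL (E := E)) X (tailL (E := E)).hasFDerivAt
      (C1.hasFDerivAt_val_apply 0 X)
  have h5 : HasFDerivAt (residual E G) ((tailL.compLeftContinuous ℝ I).comp C1.der +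
      (pointwiseApply (linCoeff E G X)).comp C1.val) X := HasFDerivAt.add (𝕜 := ℝ)
    (f := fun X : V E => tailL.compLeftContinuous ℝ I (C1.der X))
    (g := fun X : V E => superpose (nahmTerm E G) (C1.val X)) h3 h2
  have h6 : HasFDerivAt (fun X : V E => C1.map headL X) (C1.map headL) X :=
    ContinuousLinearMap.hasFDerivAt (𝕜 := ℝ) (E := V E) (F := C1 E) (C1.map headL)
  have h7 := HasFDerivAt.prodMk (𝕜 := ℝ) (f₁ := fun X : V E => tailL (C1.val X 0))
      (f₂ := fun X : V E => residual E G X) h4 h5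
  exact HasFDerivAt.prodMk (𝕜 := ℝ) (f₁ := fun X : V E => C1.map headL X)
      (f₂ := fun X : V E => (tailL (C1.val X 0), residual E G X)) h6 h7

variable [CompleteSpace E]

/-- The component `0` of the preimage is prescribed; the other seven then solve an inhomogeneous
linear ODE with prescribed initial value. -/
theorem nahmMapDeriv_bijective (X : V E) : Function.Bijective (nahmMapDeriv E G X) := by
  set A : C(I, (Fin 7 → E) →L[ℝ] (Fin 7 → E)) :=
    ⟨fun t => -((linCoeff E G X t).comp inTail), by
      exact ((linCoeff E G X).continuous.clm_comp continuous_const).neg⟩ with hA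
  have hval : ∀ (h : V E), nahmMapDeriv E G X h = (C1.map headL h, tailL (C1.val h 0),
      tailL.compLeftContinuous ℝ I (C1.der h) + pointwiseApply (linCoeff E G X) (C1.val h)) :=
    fun h => rfl
  constructor
  · refine (injective_iff_map_eq_zero (nahmMapDeriv E G X)).2 fun h hh => ?_
    rw [hval] at hh
    have e1 := congrArg Prod.fst hh
    have e2 := congrArg (fun p => p.2.1) hh
    have e3 := congrArg (fun p => p.2.2) hh
    have hhead : ∀ t, headL (C1.val h t) = 0 := fun t =>
      congrArg (fun y : C1 E => C1.val y t) e1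
    have hdec : ∀ t, C1.val h t = inTail (tailL (C1.val h t)) := fun t => by
      conv_lhs => rw [← inHead_add_inTail (C1.val h t), hhead, map_zero, zero_add]
    have hy : C1.map tailL h = 0 := by
      refine (existsUnique_linearODE A 0 0).unique ⟨e2, ?_⟩ ⟨by simp, by simp⟩
      ext1 t
      have e3t := congrArg (fun f : C(I, Fin 7 → E) => f t) e3
      have e3t' : tailL (C1.der h t) + linCoeff E G X t (C1.val h t) = 0 := e3t
      rw [hdec t] at e3t'
      rw [add_zero]
      exact eq_neg_of_add_eq_zero_left e3t'
    refine C1.ext_val fun t => ?_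
    rw [hdec t]
    have : tailL (C1.val h t) = 0 := congrArg (fun y : C1 (Fin 7 → E) => C1.val y t) hy
    rw [this]
    simp
  · rintro ⟨u, ξ, r⟩
    set b : C(I, Fin 7 → E) := r - pointwiseApply (linCoeff E G X) (C1.val (C1.map inHead u))
      with hb
    obtain ⟨y, ⟨hy0, hy⟩, -⟩ := existsUnique_linearODE A b ξ
    refine ⟨C1.map inHead u + C1.map inTail y, ?_⟩
    rw [hval]
    refine Prod.ext ?_ (Prod.ext ?_ ?_)
    · refine C1.ext_val fun t => ?_
      change headL (inHead (C1.val u t) + inTail (C1.val y t)) = C1.val u t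
      rw [map_add, headL_inHead, headL_inTail, add_zero]
    · change tailL (inHead (C1.val u 0) + inTail (C1.val y 0)) = ξ
      rw [map_add, tailL_inHead, tailL_inTail, zero_add, hy0]
    · ext1 t
      have hyt : C1.der y t = -(linCoeff E G X t (inTail (C1.val y t))) +
          (r t - linCoeff E G X t (inHead (C1.val u t))) :=
        congrArg (fun f : C(I, Fin 7 → E) => f t) hy
      change tailL (inHead (C1.der u t) + inTail (C1.der y t)) +
        linCoeff E G X t (inHead (C1.val u t) + inTail (C1.val y t)) = r t
      simp only [map_add, tailL_inHead, tailL_inTail, hyt]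
      abel

/-- Solutions of the Nahm equations near a given one depend smoothly on `X_0` and the initial
values. -/
theorem exists_nahm_section {X : V E} (hX : X ∈ solutions E G) :
    ∃ R : C1 E × (Fin 7 → E) → V E,
      (∀ᶠ p in 𝓝 (C1.map headL X, tailL (C1.val X 0)), ContDiffAt ℝ ∞ R p) ∧
      R (C1.map headL X, tailL (C1.val X 0)) = X ∧
      ∀ᶠ p in 𝓝 (C1.map headL X, tailL (C1.val X 0)), R p ∈ solutions E G ∧
        C1.map headL (R p) = p.1 ∧ tailL (C1.val (R p) 0) = p.2 := by
  have hbij := nahmMapDeriv_bijective (G := G) X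
  obtain ⟨g, hg, hg0, hgr, -⟩ := exists_smooth_localInverse
    (Filter.Eventually.of_forall fun _ => (contDiff_nahmMap (G := G)).contDiffAt)
    (f' := ContinuousLinearEquiv.ofBijective (nahmMapDeriv E G X)
      (LinearMap.ker_eq_bot.2 hbij.1) (LinearMap.range_eq_top.2 hbij.2))
    (a := X) (hasFDerivAt_nahmMap X)
  have hX0 : nahmMap E G X = (C1.map headL X, tailL (C1.val X 0), 0) := by
    rw [nahmMap, (mem_solutions_iff X).1 hX]
  rw [hX0] at hg hg0 hgr
  have hi : ContDiff ℝ ∞ (fun p : C1 E × (Fin 7 → E) =>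
      ((p.1, p.2, 0) : C1 E × (Fin 7 → E) × C(I, Fin 7 → E))) :=
    contDiff_fst.prodMk (contDiff_snd.prodMk contDiff_const)
  -- Restricting the local inverse of `nahmMap` to residual `0` yields solutions.
  refine ⟨fun p => g (p.1, p.2, 0), ?_, hg0, ?_⟩
  · filter_upwards [hi.continuous.continuousAt.eventually hg] with p hp
    exact ContDiffAt.comp (g := g) p hp hi.contDiffAt
  filter_upwards [hi.continuous.continuousAt.eventually hgr] with p hp
  exact ⟨(mem_solutions_iff _).2 (congrArg (fun q => q.2.2) hp), congrArg Prod.fst hp,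
    congrArg (fun q => q.2.1) hp⟩

/-- Solutions of the Nahm equations are determined by `X_0` and the initial values. -/
theorem solutions_ext {X Y : V E} (hX : X ∈ solutions E G) (hY : Y ∈ solutions E G)
    (h0 : ∀ t, C1.val X t 0 = C1.val Y t 0) (h : tailL (C1.val X 0) = tailL (C1.val Y 0)) :
    X = Y := by
  -- As `nahmTerm` is quadratic, the difference of two solutions with the same `X_0` satisfies a
  -- linear homogeneous ODE with this coefficient.
  set A : C(I, (Fin 7 → E) →L[ℝ] (Fin 7 → E)) :=
    ⟨fun t => -((nahmBil E G (C1.val X t) + (nahmBil E G).flip (C1.val Y t)).comp inTail), by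
      exact ((((nahmBil E G).continuous.comp (C1.val X).continuous).add
        ((nahmBil E G).flip.continuous.comp (C1.val Y).continuous)).clm_comp
          continuous_const).neg⟩ with hA
  have hdec : ∀ t, C1.val X t - C1.val Y t = inTail (tailL (C1.val X t - C1.val Y t)) := by
    intro t
    conv_lhs => rw [← inHead_add_inTail (C1.val X t - C1.val Y t)]
    have : headL (C1.val X t - C1.val Y t) = 0 := sub_eq_zero.2 (h0 t)
    rw [this, map_zero, zero_add]
  have hD : C1.map tailL (X - Y) = 0 := by
    refine (existsUnique_linearODE A 0 0).unique ⟨?_, ?_⟩ ⟨by simp, by simp⟩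
    · rw [C1.val_map, map_sub, ContinuousMap.sub_apply, map_sub, h, sub_self]
    · ext1 t
      have e1 : tailL (C1.der X t) + nahmTerm E G (C1.val X t) = 0 := by
        rw [← residual_apply, (mem_solutions_iff X).1 hX]; rfl
      have e2 : tailL (C1.der Y t) + nahmTerm E G (C1.val Y t) = 0 := by
        rw [← residual_apply, (mem_solutions_iff Y).1 hY]; rfl
      have e3 := nahmTerm_sub (G := G) (C1.val X t) (C1.val Y t)
      rw [hdec t] at e3
      have e4 : tailL (C1.der X t) - tailL (C1.der Y t) =
          -(nahmTerm E G (C1.val X t) - nahmTerm E G (C1.val Y t)) := by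
        rw [eq_neg_of_add_eq_zero_left e1, eq_neg_of_add_eq_zero_left e2]
        abel
      rw [add_zero]
      change tailL (C1.der X t - C1.der Y t) = -(nahmBil E G (C1.val X t)
        (inTail (tailL (C1.val X t - C1.val Y t))) +
        nahmBil E G (inTail (tailL (C1.val X t - C1.val Y t))) (C1.val Y t))
      rw [map_sub, e4, e3]
  refine C1.ext_val fun t => sub_eq_zero.1 ?_
  rw [hdec t]
  have : tailL (C1.val X t - C1.val Y t) = 0 :=
    congrArg (fun y : C1 (Fin 7 → E) => C1.val y t) hD
  rw [this, map_zero]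

end Nahm

end

end OctonionicNahm

namespace OctonionicNahm

noncomputable section

/-! ### The gauge action on solutions -/

section Gauge

universe u

variable {E : Type u} [NormedAddCommGroup E] [NormedSpace ℝ E]
variable {G : Type*} [TopologicalSpace G] [ChartedSpace E G] [Group G]
variable [LieGroup 𝓘(ℝ, E) ∞ G]

theorem gaugeAct_zero {g : I → G} {u : I → E} (hg : HasRD g u) (X : I → Fin 8 → E) (t : I) :
    gaugeAct g X t 0 = AdL (g t) (X t 0) - u t := by
  rw [gaugeAct, Fin.cons_zero, Ad_eq_AdL, hg.derivMulInv_eq]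

theorem gaugeAct_succ (g : I → G) (X : I → Fin 8 → E) (t : I) (i : Fin 7) :
    gaugeAct g X t i.succ = AdL (g t) (X t i.succ) := by
  rw [gaugeAct, Fin.cons_succ, Ad_eq_AdL]

theorem HasRD.pi_mul {g h : I → G} {u v : I → E} (hg : HasRD g u) (hh : HasRD h v) :
    HasRD (g * h) (fun t => u t + AdL (g t) (v t)) := hg.mul hh

theorem HasRD.pi_inv {g : I → G} {u : I → E} (hg : HasRD g u) :
    HasRD g⁻¹ (fun t => -AdL (g t)⁻¹ (u t)) := hg.inv

theorem hasRD_one : HasRD (1 : I → G) (0 : I → E) := hasRD_const 1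

theorem gaugeAct_mul {g h : I → G} {u v : I → E} (hg : HasRD g u) (hh : HasRD h v)
    (X : I → Fin 8 → E) : gaugeAct (g * h) X = gaugeAct g (gaugeAct h X) := by
  funext t j
  refine Fin.cases ?_ (fun i => ?_) j
  · rw [gaugeAct_zero (hg.pi_mul hh), gaugeAct_zero hg, gaugeAct_zero hh, Pi.mul_apply,
      AdL_mul_apply, map_sub]
    abel
  · rw [gaugeAct_succ, gaugeAct_succ, gaugeAct_succ, Pi.mul_apply, AdL_mul_apply]

theorem gaugeAct_one (X : I → Fin 8 → E) : gaugeAct (1 : I → G) X = X := by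
  funext t j
  refine Fin.cases ?_ (fun i => ?_) j
  · rw [gaugeAct_zero (hasRD_one (E := E)), Pi.one_apply, AdL_one]
    simp
  · rw [gaugeAct_succ, Pi.one_apply, AdL_one]
    rfl

theorem gaugeAct_inv_gaugeAct {g : I → G} {u : I → E} (hg : HasRD g u) (X : I → Fin 8 → E) :
    gaugeAct g⁻¹ (gaugeAct g X) = X := by
  rw [← gaugeAct_mul hg.pi_inv hg, inv_mul_cancel, gaugeAct_one]

variable [FiniteDimensional ℝ E]

theorem nahmTerm_AdL (g : G) (x : Fin 8 → E) (i : Fin 7) :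
    nahmTerm E G (fun j => AdL g (x j)) i = AdL g (nahmTerm E G x i) := by
  fin_cases i <;> simp [nahmTerm, AdL_bracket]

/-- The component `0` enters the equation for `X_i` only through `[X_0, X_i]`. The resulting
correction compensates the derivative of `Ad(g)` under a gauge transformation. -/
theorem nahmTerm_sub_inHead (x : Fin 8 → E) (w : E) (i : Fin 7) :
    nahmTerm E G (x - inHead w) i = nahmTerm E G x i - bracket E G w (x i.succ) := by
  have h0 : (x - inHead w) 0 = x 0 - w := rfl
  have h1 : ∀ j : Fin 7, (x - inHead w) j.succ = x j.succ := fun j => sub_zero _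
  have e1 := h1 0
  have e2 := h1 1
  have e3 := h1 2
  have e4 := h1 3
  have e5 := h1 4
  have e6 := h1 5
  have e7 := h1 6
  simp only [Fin.reduceSucc] at e1 e2 e3 e4 e5 e6 e7
  fin_cases i <;>
    simp [nahmTerm, h0, e1, e2, e3, e4, e5, e6, e7, -Pi.sub_apply, bracket_eq_adL] <;> abel

/-- Gauge transformations map solutions to solutions. -/
theorem exists_solution_gaugeAct {g : I → G} (hg : g ∈ gaugeGroup E G) {X : V E}
    (hX : X ∈ solutions E G) : ∃ Y ∈ solutions E G, value Y = gaugeAct g (value X) := by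
  obtain ⟨v, hv⟩ := exists_C1_derivMulInv hg
  have hRD : HasRD g (C1.val v) := by
    have h := hasRD_of_mem_gaugeGroup hg
    rwa [← funext hv] at h
  have hAc : Continuous fun t => AdL (E := E) (g t) := continuous_AdL.comp hRD.continuous
  set f : ℝ → Fin 8 → E := fun s j => AdL (pathExt g s) (pathExt (C1.val X) s j) -
    inHead (pathExt (C1.val v) s) j with hf
  set d : I → Fin 8 → E := fun t j => (adL E G (C1.val v t) (AdL (g t) (C1.val X t j)) +
    AdL (g t) (C1.der X t j)) - inHead (C1.der v t) j with hd
  have hdc : Continuous d := by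
    refine continuous_pi fun j => ?_
    have c1 : Continuous fun t => C1.val X t j := (continuous_apply j).comp (C1.val X).continuous
    have c2 : Continuous fun t => C1.der X t j := (continuous_apply j).comp (C1.der X).continuous
    have c3 : Continuous fun t => inHead (C1.der v t) j :=
      (continuous_apply j).comp (inHead.continuous.comp (C1.der v).continuous)
    exact ((((adL E G).continuous.comp (C1.val v).continuous).clm_apply (hAc.clm_apply c1)).add
      (hAc.clm_apply c2)).sub c3
  obtain ⟨Y, hY⟩ := C1.exists_val_eq (f := f) (f' := pathExt d)
    (hdc.Icc_extend').continuousOn (fun s hs => by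
      set t : I := ⟨s, hs⟩ with ht
      rw [pathExt_of_mem d hs]
      refine hasDerivWithinAt_pi.2 fun j => ?_
      have h1 := (hRD t).hasDerivWithinAt_AdL
      have h2 := hasDerivWithinAt_pi.1 (C1.hasDerivWithinAt X t) j
      have h3 := hasDerivWithinAt_pi.1 (inHead.hasFDerivAt.comp_hasDerivWithinAt (t : ℝ)
        (C1.hasDerivWithinAt v t)) j
      have h4 := (h1.clm_apply h2).sub h3
      simp only [pathExt_coe] at h4
      exact h4)
  have hval : ∀ t, value Y t = (fun j => AdL (g t) (value X t j)) - inHead (C1.val v t) := by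
    intro t
    refine ((hY t).1).trans ?_
    funext j
    simp only [hf, pathExt_coe]
    rfl
  refine ⟨Y, fun t i => ?_, ?_⟩
  · have h1 : velocity Y t i.succ = (adL E G (C1.val v t) (AdL (g t) (value X t i.succ)) +
        AdL (g t) (velocity X t i.succ)) - 0 := by
      refine (congrFun (hY t).2 i.succ).trans ?_
      rw [pathExt_coe]
      rfl
    -- The term `[v, Ad(g) X_i]` from differentiating `Ad(g)` cancels the one from replacing `Ad(g)
    -- X_0` by `Ad(g) X_0 - v`.
    rw [h1, hval, nahmTerm_sub_inHead, nahmTerm_AdL, bracket_eq_adL]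
    have h2 := congrArg (AdL (g t)) (hX t i)
    rw [map_add, map_zero] at h2
    refine Eq.trans ?_ h2
    abel
  · funext t j
    rw [hval]
    refine Fin.cases ?_ (fun i => ?_) j
    · rw [gaugeAct_zero hRD]
      rfl
    · rw [gaugeAct_succ]
      exact sub_zero _

variable [CompactSpace G] [T2Space G]

/-- The component `X_0`. -/
def head (X : V E) : C1 E := C1.map (headL (E := E)) X

variable (G) in
/-- The gauge transformation with value `1` at `0` that transforms `X_0` to `0`. -/
def killGauge (X : V E) : I → G := (develop G (C1.val (-head X)))⁻¹

/-- This is the condition `g' g⁻¹ = Ad(g) X_0` for killing `X_0`; it is equivalent to `g⁻¹` having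
right logarithmic derivative `-X_0`. -/
theorem hasRD_killGauge (X : V E) :
    HasRD (killGauge G X) (fun t => AdL (killGauge G X t) (value X t 0)) := by
  have h := (hasRD_develop G (C1.val (-head X))).pi_inv
  have h2 : (fun t => -AdL (develop G (C1.val (-head X)) t)⁻¹ (C1.val (-head X) t)) =
      fun t => AdL (killGauge G X t) (value X t 0) := by
    funext t
    rw [map_neg, ContinuousMap.neg_apply, map_neg, neg_neg]
    rfl
  rwa [h2] at h

theorem killGauge_mem (X : V E) : killGauge G X ∈ gaugeGroup E G :=
  inv_mem (develop_mem_gaugeGroup (-head X))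

theorem killGauge_zero (X : V E) : killGauge G X 0 = 1 := by
  rw [killGauge, Pi.inv_apply, develop_zero, inv_one]

theorem gaugeAct_killGauge (X : V E) (t : I) :
    gaugeAct (killGauge G X) (value X) t 0 = 0 := by
  rw [gaugeAct_zero (hasRD_killGauge X), sub_self]

theorem eq_killGauge {X : V E} {g : I → G} {u : I → E} (hg : HasRD g u) (h0 : g 0 = 1)
    (h : ∀ t, gaugeAct g (value X) t 0 = 0) : g = killGauge G X := by
  have h1 : HasRD g⁻¹ (C1.val (-head X)) := by
    refine (congrArg (HasRD g⁻¹) (funext fun t => ?_)).mp hg.pi_inv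
    have h2 := h t
    rw [gaugeAct_zero hg, sub_eq_zero] at h2
    rw [← h2, AdL_inv_apply, map_neg]
    rfl
  rw [killGauge, develop_eq h1 (by simp [h0]), inv_inv]

theorem existsUnique_killGauge (X : V E) : ∃! g : I → G, g ∈ gaugeGroup E G ∧
    g 0 = 1 ∧ ∀ t : I, gaugeAct g (value X) t 0 = 0 :=
  ⟨killGauge G X, ⟨killGauge_mem X, killGauge_zero X, gaugeAct_killGauge X⟩,
    fun _ hg => eq_killGauge (hasRD_of_mem_gaugeGroup hg.1) hg.2.1 hg.2.2⟩

variable (G) in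
/-- The map `X ↦ (g(1), X_1(0), …, X_7(0))` on all of `V`. -/
def endData (X : V E) : G × (Fin 7 → E) := (killGauge G X 1, tailL (C1.val X 0))

/-- If `Y = g X`, then `killGauge G X * g⁻¹` kills `Y_0`, so by uniqueness it is `killGauge G Y`,
and `g` is `1` at both ends. Conversely, equal data give equal normal forms with `X_0 = 0`, since
these solve one ODE with the same initial value; then `(killGauge G Y)⁻¹ * killGauge G X` relates
the two. -/
theorem gaugeRel_iff (X Y : solutions E G) :
    gaugeRel E G X Y ↔ endData G X.1 = endData G Y.1 := by
  have hX := hasRD_killGauge (G := G) X.1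
  have hY := hasRD_killGauge (G := G) Y.1
  constructor
  · rintro ⟨g, hg, h0, h1, hXY⟩
    have hRD := hasRD_of_mem_gaugeGroup hg
    have hk : killGauge G X.1 * g⁻¹ = killGauge G Y.1 := by
      refine eq_killGauge (hX.pi_mul hRD.pi_inv) (by simp [h0, killGauge_zero]) fun t => ?_
      rw [gaugeAct_mul hX hRD.pi_inv, hXY, gaugeAct_inv_gaugeAct hRD, gaugeAct_killGauge]
    refine Prod.ext ?_ ?_
    · change killGauge G X.1 1 = killGauge G Y.1 1
      rw [← hk, Pi.mul_apply, Pi.inv_apply, h1, inv_one, mul_one]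
    · funext i
      change value X.1 0 i.succ = value Y.1 0 i.succ
      rw [hXY, gaugeAct_succ, h0, AdL_one]
      rfl
  · intro h
    have h1 : killGauge G X.1 1 = killGauge G Y.1 1 := congrArg Prod.fst h
    have h2 : tailL (C1.val X.1 0) = tailL (C1.val Y.1 0) := congrArg Prod.snd h
    obtain ⟨X', hX', hXv⟩ := exists_solution_gaugeAct (killGauge_mem X.1) X.2
    obtain ⟨Y', hY', hYv⟩ := exists_solution_gaugeAct (killGauge_mem Y.1) Y.2
    have hXY : X' = Y' := by
      refine solutions_ext hX' hY' (fun t => ?_) ?_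
      · exact ((congrFun (congrFun hXv t) 0).trans (gaugeAct_killGauge X.1 t)).trans
          ((congrFun (congrFun hYv t) 0).trans (gaugeAct_killGauge Y.1 t)).symm
      · funext i
        refine (congrFun (congrFun hXv 0) i.succ).trans
          (Eq.trans ?_ (congrFun (congrFun hYv 0) i.succ).symm)
        rw [gaugeAct_succ, gaugeAct_succ, killGauge_zero, killGauge_zero]
        exact congrArg (AdL (1 : G)) (congrFun h2 i)
    refine ⟨(killGauge G Y.1)⁻¹ * killGauge G X.1,
      mul_mem (inv_mem (killGauge_mem Y.1)) (killGauge_mem X.1), ?_, ?_, ?_⟩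
    · simp [killGauge_zero]
    · simp [h1]
    · rw [gaugeAct_mul hY.pi_inv hX, ← hXv, hXY, hYv, gaugeAct_inv_gaugeAct hY]

variable (E G) in
/-- The map `χ` on the moduli space. -/
def modChi : Moduli E G → G × (Fin 7 → E) :=
  Quot.lift (fun X : solutions E G => endData G X.1) fun X Y h => (gaugeRel_iff X Y).1 h

theorem modChi_injective : Function.Injective (modChi E G) := by
  rintro ⟨X⟩ ⟨Y⟩ h
  exact Quot.sound ((gaugeRel_iff X Y).2 h)

theorem modChi_eq {X : solutions E G} {g : I → G} (hg : g ∈ gaugeGroup E G) (h0 : g 0 = 1)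
    (h : ∀ t, gaugeAct g (value X.1) t 0 = 0) :
    modChi E G (Moduli.mk X) = (g 1, fun i : Fin 7 => value X.1 0 i.succ) := by
  rw [eq_killGauge (hasRD_of_mem_gaugeGroup hg) h0 h]
  rfl

theorem range_modChi : Set.range (modChi E G) = endData G '' solutions E G := by
  ext p
  constructor
  · rintro ⟨⟨X⟩, rfl⟩
    exact ⟨X.1, X.2, rfl⟩
  · rintro ⟨X, hX, rfl⟩
    exact ⟨Moduli.mk ⟨X, hX⟩, rfl⟩

/-- The image of `χ` consists of the pairs `(a, ξ)` for which the solution of the Nahm equations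
with `X_0 = 0` and initial value `ξ` exists on `[0,1]`. -/
theorem mem_range_modChi_iff [ConnectedSpace G] {a : G} {ξ : Fin 7 → E} :
    (a, ξ) ∈ Set.range (modChi E G) ↔
      ∃ X ∈ solutions E G, (∀ t, value X t 0 = 0) ∧ ∀ i : Fin 7, value X 0 i.succ = ξ i := by
  rw [range_modChi]
  constructor
  · rintro ⟨X, hX, h⟩
    obtain ⟨Y, hY, hYv⟩ := exists_solution_gaugeAct (killGauge_mem X) hX
    refine ⟨Y, hY, fun t => ?_, fun i => ?_⟩
    · rw [hYv, gaugeAct_killGauge]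
    · rw [hYv, gaugeAct_succ, killGauge_zero, AdL_one]
      exact congrFun (congrArg Prod.snd h) i
  · rintro ⟨X, hX, hX0, hXξ⟩
    -- Moving the normal form by a path from `1` to `a⁻¹` gives a solution whose killing
    -- transformation is `g⁻¹`, with end point `a`.
    obtain ⟨g, hg, g0, g1⟩ := exists_mem_gaugeGroup_eq (E := E) a⁻¹
    have hRD := hasRD_of_mem_gaugeGroup hg
    obtain ⟨Y, hY, hYv⟩ := exists_solution_gaugeAct hg hX
    have hk : g⁻¹ = killGauge G Y := eq_killGauge hRD.pi_inv (by simp [g0]) fun t => by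
      rw [hYv, gaugeAct_inv_gaugeAct hRD, hX0]
    refine ⟨Y, hY, Prod.ext ?_ ?_⟩
    · change killGauge G Y 1 = a
      rw [← hk, Pi.inv_apply, g1, inv_inv]
    · funext i
      change value Y 0 i.succ = ξ i
      rw [hYv, gaugeAct_succ, g0, AdL_one]
      exact hXξ i

end Gauge

end

end OctonionicNahm

namespace OctonionicNahm

noncomputable section

/-! ### The smooth structure on the moduli space -/

/-! ### Smooth structures pulled back along open embeddings -/

section Pullback

variable {F H M N : Type*} [NormedAddCommGroup F] [NormedSpace ℝ F] [TopologicalSpace H]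
variable {J : ModelWithCorners ℝ F H} [TopologicalSpace M] [TopologicalSpace N]
variable [ChartedSpace H N] {n : WithTop ℕ∞} [IsManifold J n N]

/-- The smooth structure pulled back along an open embedding. -/
theorem exists_pullback_structure [Nonempty M] {f : M → N} (hf : Topology.IsOpenEmbedding f) :
    ∃ _ : ChartedSpace H M, IsManifold J n M ∧ ContMDiff J J n f ∧
      ContMDiffOn J J n (hf.toOpenPartialHomeomorph f).symm (Set.range f) := by
  set φ := hf.toOpenPartialHomeomorph f with hφ
  have hsrc : φ.source = Set.univ := rfl
  let c0 : ChartedSpace N M := φ.singletonChartedSpace hsrc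
  let c : ChartedSpace H M := ChartedSpace.comp H N M
  -- The charts are those of `N` composed with `f`, so each transition map is a restriction of one
  -- of `N`.
  have hM : IsManifold J n M := by
    refine isManifold_of_contDiffOn J n M fun e e' he he' => ?_
    obtain ⟨φ₁, h1, c₁, hc₁, rfl⟩ := he
    obtain ⟨φ₂, h2, c₂, hc₂, rfl⟩ := he'
    obtain rfl : φ₁ = φ := φ.singletonChartedSpace_mem_atlas_eq hsrc _ h1
    obtain rfl : φ₂ = φ := φ.singletonChartedSpace_mem_atlas_eq hsrc _ h2
    have hcomp := (mem_groupoid_of_pregroupoid.1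
      (HasGroupoid.compatible (G := contDiffGroupoid n J) hc₁ hc₂)).1
    refine (ContDiffOn.mono hcomp ?_).congr ?_
    · rintro x ⟨hx, hxr⟩
      simp only [mfld_simps] at hx ⊢
      rw [φ.right_inv hx.1.2] at hx
      exact ⟨⟨hx.1.1, hx.2.2⟩, Set.mem_range.1 hxr⟩
    · rintro x ⟨hx, -⟩
      simp only [mfld_simps] at hx ⊢
      rw [φ.right_inv hx.1.2]
  refine ⟨c, hM, fun m => ?_, fun y hy => ?_⟩
  · have h1 : ContMDiffAt J 𝓘(ℝ, F) n (extChartAt J m) m := contMDiffAt_extChartAt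
    have h2 : ContMDiffWithinAt 𝓘(ℝ, F) J n (extChartAt J (f m)).symm (Set.range J)
        (extChartAt J m m) :=
      contMDiffWithinAt_extChartAt_symm_range_self (f m)
    have h3 := ContMDiffWithinAt.comp (t := Set.range J) m h2 h1.contMDiffWithinAt
      (s := Set.univ) (fun x _ => Set.mem_range_self _)
    refine (contMDiffWithinAt_univ.1 h3).congr_of_eventuallyEq ?_
    filter_upwards [hf.continuous.continuousAt.preimage_mem_nhds
      (show (extChartAt J (f m)).source ∈ 𝓝 (f m) from extChartAt_source_mem_nhds _)] with x hx
    exact ((extChartAt J (f m)).left_inv hx).symm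
  · obtain ⟨m, rfl⟩ := hy
    have h1 : ContMDiffAt J 𝓘(ℝ, F) n (extChartAt J (f m)) (f m) := contMDiffAt_extChartAt
    have h2 : ContMDiffWithinAt 𝓘(ℝ, F) J n (extChartAt J m).symm (Set.range J)
        (extChartAt J (f m) (f m)) :=
      contMDiffWithinAt_extChartAt_symm_range_self m
    have h3 := ContMDiffWithinAt.comp (t := Set.range J) (f m) h2 h1.contMDiffWithinAt
      (s := Set.univ) (fun x _ => Set.mem_range_self _)
    refine ((contMDiffWithinAt_univ.1 h3).congr_of_eventuallyEq ?_).contMDiffWithinAt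
    filter_upwards [show (extChartAt J (f m)).source ∈ 𝓝 (f m) from extChartAt_source_mem_nhds _] with x hx
    change φ.symm x = φ.symm ((extChartAt J (f m)).symm (extChartAt J (f m) x))
    rw [(extChartAt J (f m)).left_inv hx]

end Pullback

/-! ### The quotient structure and the diffeomorphism `χ` -/

section Moduli

universe u

variable {E : Type u} [NormedAddCommGroup E] [NormedSpace ℝ E] [FiniteDimensional ℝ E]
variable {G : Type*} [TopologicalSpace G] [ChartedSpace E G] [Group G]
variable [LieGroup 𝓘(ℝ, E) ∞ G] [CompactSpace G] [T2Space G]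

theorem contDiff_head : ContDiff ℝ ∞ (head : V E → C1 E) :=
  ContinuousLinearMap.contDiff (𝕜 := ℝ) (E := V E) (F := C1 E) (C1.map (headL (E := E)))

theorem contMDiff_endData :
    ContMDiff 𝓘(ℝ, V E) ((𝓘(ℝ, E)).prod 𝓘(ℝ, Fin 7 → E)) ∞ (endData G : V E → _) := by
  have h1 : ContDiff ℝ ∞ (fun X : V E => C1.val (-head X)) :=
    C1.contDiff_val.comp (ContDiff.neg (f := fun X : V E => head X) contDiff_head)
  have h2 : ContMDiff 𝓘(ℝ, V E) 𝓘(ℝ, E) ∞ (fun X : V E => (hol G (C1.val (-head X)))⁻¹) :=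
    (contMDiff_hol.comp h1.contMDiff).inv
  have h3 : ContDiff ℝ ∞ (fun X : V E => tailL (C1.val X 0)) :=
    (tailL (E := E)).contDiff.comp (C1.contDiff_val_apply 0)
  exact h2.prodMk h3.contMDiff

/-- There are smooth local sections of `endData` through solutions, consisting of solutions. -/
theorem exists_endData_section {X : V E} (hX : X ∈ solutions E G) :
    ∃ (S : G × (Fin 7 → E) → V E) (O : Set (G × (Fin 7 → E))), IsOpen O ∧ endData G X ∈ O ∧
      S (endData G X) = X ∧
      ContMDiffOn ((𝓘(ℝ, E)).prod 𝓘(ℝ, Fin 7 → E)) 𝓘(ℝ, V E) ∞ S O ∧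
      ∀ p ∈ O, S p ∈ solutions E G ∧ endData G (S p) = p := by
  have htop := isTopologicalGroup E G
  have : CompleteSpace E := FiniteDimensional.complete ℝ E
  obtain ⟨R, hR, hR0, hRev⟩ := exists_nahm_section hX
  obtain ⟨sec, hsec, hsec0, hsecev⟩ := exists_hol_section (G := G) (-head X)
  have hinv : (endData G X).1⁻¹ = hol G (C1.val (-head X)) := inv_inv _
  have hc : ContinuousAt (fun p : G × (Fin 7 → E) => p.1⁻¹) (endData G X) := by fun_prop
  rw [← hinv] at hsec hsec0 hsecev
  -- The first datum is the inverse of the holonomy of `-X_0`; this accounts for the sign and for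
  -- the inverse.
  set q : G × (Fin 7 → E) → C1 E × (Fin 7 → E) := fun p => (-sec p.1⁻¹, p.2) with hq
  have hqs : ∀ p : G × (Fin 7 → E), ContMDiffAt 𝓘(ℝ, E) 𝓘(ℝ, C1 E) ∞ sec p.1⁻¹ →
      ContMDiffAt ((𝓘(ℝ, E)).prod 𝓘(ℝ, Fin 7 → E)) 𝓘(ℝ, C1 E × (Fin 7 → E)) ∞ q p := by
    intro p hp
    have h1 : ContMDiffAt ((𝓘(ℝ, E)).prod 𝓘(ℝ, Fin 7 → E)) 𝓘(ℝ, E) ∞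
        (fun p : G × (Fin 7 → E) => p.1⁻¹) p := contMDiffAt_fst.inv
    have h2 : ContMDiffAt ((𝓘(ℝ, E)).prod 𝓘(ℝ, Fin 7 → E)) 𝓘(ℝ, C1 E) ∞
        (fun p : G × (Fin 7 → E) => sec p.1⁻¹) p := ContMDiffAt.comp (g := sec) p hp h1
    exact h2.neg.prodMk_space contMDiffAt_snd
  have hq0 : q (endData G X) = (C1.map headL X, tailL (C1.val X 0)) := by
    refine Prod.ext ?_ rfl
    change -sec (endData G X).1⁻¹ = _
    rw [hsec0, neg_neg]
    rfl
  have hqc := (hqs _ hsec.self_of_nhds).continuousAt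
  have hev : ∀ᶠ p in 𝓝 (endData G X),
      ContMDiffAt ((𝓘(ℝ, E)).prod 𝓘(ℝ, Fin 7 → E)) 𝓘(ℝ, V E) ∞ (fun p => R (q p)) p ∧
      R (q p) ∈ solutions E G ∧ endData G (R (q p)) = p := by
    filter_upwards [hc.eventually hsec, hc.eventually hsecev, hqc.eventually (hq0.symm ▸ hR),
      hqc.eventually (hq0.symm ▸ hRev)] with p h1 h2 h3 h4
    refine ⟨ContMDiffAt.comp (g := R) p h3.contMDiffAt (hqs p h1), h4.1, Prod.ext ?_ h4.2.2⟩
    change (hol G (C1.val (-head (R (q p)))))⁻¹ = p.1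
    have h5 : head (R (q p)) = -sec p.1⁻¹ := h4.2.1
    rw [h5, neg_neg, h2, inv_inv]
  obtain ⟨O, hO, hOo, hXO⟩ := eventually_nhds_iff.1 hev
  exact ⟨fun p => R (q p), O, hOo, hXO, (congrArg R hq0).trans hR0,
    fun p hp => (hO p hp).1.contMDiffWithinAt, fun p hp => (hO p hp).2⟩

/-- Openness comes from the local sections: every point `p` near `χ[X]` is `χ[S p]`, and `S p` is
close to `X`. -/
theorem isOpenEmbedding_modChi : Topology.IsOpenEmbedding (modChi E G) := by
  have hcont : Continuous (modChi E G) :=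
    continuous_quot_lift _ (contMDiff_endData.continuous.comp continuous_subtype_val)
  refine .of_continuous_injective_isOpenMap hcont modChi_injective fun U hU => ?_
  refine isOpen_iff_mem_nhds.2 ?_
  rintro _ ⟨⟨X⟩, hXU, rfl⟩
  obtain ⟨S, O, hO, hXO, hS0, hS, hSO⟩ := exists_endData_section X.2
  have hpre : IsOpen ((fun Y : solutions E G => Moduli.mk Y) ⁻¹' U) := hU.preimage continuous_quot_mk
  obtain ⟨T, hT, hTU⟩ := isOpen_induced_iff.1 hpre
  have hXT : X.1 ∈ T := by
    have : X ∈ Subtype.val ⁻¹' T := by rw [hTU]; exact hXU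
    exact this
  have hSc : ContinuousAt S (endData G X.1) :=
    (hS _ hXO).continuousWithinAt.continuousAt (hO.mem_nhds hXO)
  filter_upwards [hO.mem_nhds hXO, hSc.preimage_mem_nhds (hT.mem_nhds (by rw [hS0]; exact hXT))]
    with p hp hpT
  refine ⟨Moduli.mk ⟨S p, (hSO p hp).1⟩, ?_, (hSO p hp).2⟩
  have : (⟨S p, (hSO p hp).1⟩ : solutions E G) ∈ Subtype.val ⁻¹' T := hpT
  rw [hTU] at this
  exact this

theorem zero_mem_solutions : (0 : V E) ∈ solutions E G := by
  intro t i
  change (0 : E) + nahmTerm E G 0 i = 0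
  rw [nahmTerm_eq, map_zero]
  exact add_zero _

instance : Nonempty (Moduli E G) := ⟨Moduli.mk ⟨0, zero_mem_solutions⟩⟩

/-- In the structure pulled back along `χ`, the projection is `χ⁻¹ ∘ endData` and the local sections
are `S ∘ χ`. -/
theorem exists_isQuotientStructure :
    ∃ c : ChartedSpace (E × (Fin 7 → E)) (Moduli E G), IsQuotientStructure E G c := by
  obtain ⟨c, hM, hχ, hψ⟩ := exists_pullback_structure
    (J := (𝓘(ℝ, E)).prod 𝓘(ℝ, Fin 7 → E)) (n := ∞) (isOpenEmbedding_modChi (E := E) (G := G))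
  set ψ := (isOpenEmbedding_modChi (E := E) (G := G)).toOpenPartialHomeomorph.symm with hψd
  have hψχ : ∀ m, ψ (modChi E G m) = m := fun m =>
    (isOpenEmbedding_modChi (E := E) (G := G)).toOpenPartialHomeomorph_left_inv
  let c' : ChartedSpace (E × (Fin 7 → E)) (Moduli E G) := c
  refine ⟨c', ?_, ?_, ?_⟩
  · rw [modelWithCornersSelf_prod]
    exact hM
  · rw [modelWithCornersSelf_prod]
    refine ⟨fun X => ψ (endData G X), fun X => hψχ (Moduli.mk X), ?_⟩
    exact ContMDiffOn.comp (g := ψ) hψ contMDiff_endData.contMDiffOn fun X hX =>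
      ⟨Moduli.mk ⟨X, hX⟩, rfl⟩
  · intro X
    rw [modelWithCornersSelf_prod]
    obtain ⟨S, O, hO, hXO, hS0, hS, hSO⟩ := exists_endData_section X.2
    refine ⟨modChi E G ⁻¹' O, hO.preimage hχ.continuous, hXO, fun m => S (modChi E G m), hS0,
      ContMDiffOn.comp (g := S) hS hχ.contMDiffOn fun m hm => hm, fun m hm => ?_⟩
    exact ⟨(hSO _ hm).1, modChi_injective (hSO _ hm).2⟩

/-- Only the quotient property is used: locally `χ = endData ∘ s` for a section `s` of the
projection `π`, and `χ⁻¹ = π ∘ S` for a section `S` of `endData`. -/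
theorem exists_diffeomorph (c : ChartedSpace (E × (Fin 7 → E)) (Moduli E G))
    (hc : IsQuotientStructure E G c) (W : TopologicalSpace.Opens (G × (Fin 7 → E)))
    (hW : (W : Set (G × (Fin 7 → E))) = Set.range (modChi E G)) :
    ∃ Φ : Diffeomorph 𝓘(ℝ, E × (Fin 7 → E)) ((𝓘(ℝ, E)).prod 𝓘(ℝ, Fin 7 → E))
      (Moduli E G) W ∞, ∀ m : Moduli E G, (Φ m : G × (Fin 7 → E)) = modChi E G m := by
  have hmem : ∀ m, modChi E G m ∈ W := fun m => by
    have : modChi E G m ∈ (W : Set (G × (Fin 7 → E))) := by rw [hW]; exact ⟨m, rfl⟩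
    exact this
  have hbij : Function.Bijective (fun m => (⟨modChi E G m, hmem m⟩ : W)) := by
    refine ⟨fun m m' h => modChi_injective (congrArg Subtype.val h), fun p => ?_⟩
    have h1 : p.1 ∈ (W : Set (G × (Fin 7 → E))) := p.2
    rw [hW] at h1
    obtain ⟨m, hm⟩ := h1
    exact ⟨m, Subtype.ext hm⟩
  obtain ⟨π, hπ, hπs⟩ := hc.smooth
  have hχ : ContMDiff 𝓘(ℝ, E × (Fin 7 → E)) ((𝓘(ℝ, E)).prod 𝓘(ℝ, Fin 7 → E)) ∞
      (modChi E G) := by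
    rintro ⟨X⟩
    obtain ⟨U, hU, hXU, s, hs0, hs, hsU⟩ := hc.sections X
    have h1 : ContMDiffAt 𝓘(ℝ, E × (Fin 7 → E)) 𝓘(ℝ, V E) ∞ s (Moduli.mk X) :=
      (hs _ hXU).contMDiffAt (hU.mem_nhds hXU)
    refine ((contMDiff_endData (G := G)).contMDiffAt.comp _ h1).congr_of_eventuallyEq ?_
    filter_upwards [hU.mem_nhds hXU] with m hm
    obtain ⟨h, hm'⟩ := hsU m hm
    exact (congrArg (modChi E G) hm').symm
  refine ⟨⟨Equiv.ofBijective _ hbij, ?_, ?_⟩, fun m => rfl⟩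
  · exact (ContMDiff.subtypeVal_comp_iff W _).1 hχ
  · intro p
    obtain ⟨m, rfl⟩ := hbij.2 p
    revert m
    rintro ⟨X⟩
    obtain ⟨S, O, hO, hXO, hS0, hS, hSO⟩ := exists_endData_section X.2
    have hval : ContMDiff ((𝓘(ℝ, E)).prod 𝓘(ℝ, Fin 7 → E)) ((𝓘(ℝ, E)).prod 𝓘(ℝ, Fin 7 → E)) ∞
      (Subtype.val : W → G × (Fin 7 → E)) := contMDiff_subtype_val
    have hOW : IsOpen ((Subtype.val : W → G × (Fin 7 → E)) ⁻¹' O) := hO.preimage hval.continuous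
    have h1 : ContMDiffOn ((𝓘(ℝ, E)).prod 𝓘(ℝ, Fin 7 → E)) 𝓘(ℝ, E × (Fin 7 → E)) ∞
        (fun p : W => π (S p.1)) (Subtype.val ⁻¹' O) :=
      ContMDiffOn.comp (g := π) (t := solutions E G) hπs
        (ContMDiffOn.comp (g := S) hS hval.contMDiffOn fun p hp => hp)
        fun p hp => (hSO _ hp).1
    refine (h1.contMDiffAt (hOW.mem_nhds hXO)).congr_of_eventuallyEq ?_
    filter_upwards [hOW.mem_nhds hXO] with p hp
    refine (Equiv.symm_apply_eq _).2 (Subtype.ext ?_)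
    have h2 := hSO _ hp
    have h3 := hπ ⟨_, h2.1⟩
    change p.1 = modChi E G (π (S p.1))
    rw [h3]
    exact h2.2.symm

end Moduli

end

end OctonionicNahm

namespace OctonionicNahm

noncomputable section

/-! ### The image of `χ` -/

section Image

universe u

variable {E : Type u} [NormedAddCommGroup E] [NormedSpace ℝ E] [FiniteDimensional ℝ E]
variable {G : Type*} [TopologicalSpace G] [ChartedSpace E G] [Group G]
variable [LieGroup 𝓘(ℝ, E) ∞ G]

theorem nahmTerm_smul (c : ℝ) (x : Fin 8 → E) :
    nahmTerm E G (c • x) = c ^ 2 • nahmTerm E G x := by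
  simp only [nahmTerm_eq, map_smul, smul_apply, smul_smul, sq]

section Compact

variable [CompactSpace G] [T2Space G] [ConnectedSpace G]

theorem mem_range_modChi_zero (a : G) : (a, (0 : Fin 7 → E)) ∈ Set.range (modChi E G) :=
  mem_range_modChi_iff.2 ⟨0, zero_mem_solutions, fun _ => rfl, fun _ => rfl⟩

/-- If `X` is a solution with `X_0 = 0`, so is `t ↦ c X(ct)`, because the nonlinearity is quadratic;
for `0 ≤ c ≤ 1` it is still defined on `[0,1]`. -/
theorem starConvex_range_modChi (a : G) :
    StarConvex ℝ 0 {ξ : Fin 7 → E | (a, ξ) ∈ Set.range (modChi E G)} := by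
  refine starConvex_zero_iff.2 fun ξ hξ c hc0 hc1 => ?_
  obtain ⟨X, hX, hX0, hXξ⟩ := mem_range_modChi_iff.1 hξ
  have hmem : ∀ s ∈ Set.Icc (0 : ℝ) 1, c * s ∈ Set.Icc (0 : ℝ) 1 := fun s hs =>
    ⟨mul_nonneg hc0 hs.1, mul_le_one₀ hc1 hs.1 hs.2⟩
  obtain ⟨Y, hY⟩ := C1.exists_val_eq (f := fun s => c • pathExt (C1.val X) (c * s))
    (f' := fun s => c • c • pathExt (C1.der X) (c * s))
    (by
      have : Continuous (pathExt (C1.der X)) := (C1.der X).continuous.Icc_extend'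
      exact Continuous.continuousOn (by fun_prop))
    (fun s hs => by
      have h1 := C1.hasDerivWithinAt X ⟨c * s, hmem s hs⟩
      have h2 : HasDerivWithinAt (fun s : ℝ => c * s) c (Set.Icc 0 1) s := by
        simpa using ((hasDerivAt_id s).const_mul c).hasDerivWithinAt
      have h3 := (HasDerivWithinAt.scomp (h := fun s : ℝ => c * s) s h1 h2 hmem).const_smul c
      rw [pathExt_of_mem _ (hmem s hs)]
      exact h3)
  have hv : ∀ t : I, value Y t = c • value X ⟨c * t, hmem t t.2⟩ := fun t => by
    refine (hY t).1.trans ?_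
    simp only [pathExt_of_mem _ (hmem t t.2)]
    rfl
  have hd : ∀ t : I, velocity Y t = c ^ 2 • velocity X ⟨c * t, hmem t t.2⟩ := fun t => by
    refine (hY t).2.trans ?_
    simp only [pathExt_of_mem _ (hmem t t.2), smul_smul, sq]
    rfl
  refine mem_range_modChi_iff.2 ⟨Y, fun t i => ?_, fun t => ?_, fun i => ?_⟩
  · rw [hv, hd, nahmTerm_smul, Pi.smul_apply, Pi.smul_apply, ← smul_add, hX, smul_zero]
  · rw [hv, Pi.smul_apply, hX0, smul_zero]
  · have h0 : (⟨c * ((0 : I) : ℝ), hmem _ (0 : I).2⟩ : I) = 0 := Subtype.ext (mul_zero c)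
    rw [hv, h0, Pi.smul_apply, Pi.smul_apply, ← hXξ i]

end Compact

theorem AdL_eq_id_of_comm (h : ∀ a b : G, a * b = b * a) (g : G) :
    AdL g = ContinuousLinearMap.id ℝ E := by
  have h1 : (fun y : G => g * y * g⁻¹) = fun y => y := funext fun y => by
    rw [h g y, mul_inv_cancel_right]
  have h2 : mfderiv 𝓘(ℝ, E) 𝓘(ℝ, E) (fun y : G => y) 1 =
      ContinuousLinearMap.id ℝ (TangentSpace 𝓘(ℝ, E) (1 : G)) := mfderiv_id
  ext1 x
  rw [← Ad_eq_AdL, Ad, h1]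
  exact congrArg (fun L : E →L[ℝ] E => L x) h2

theorem AdL_eq_id_of_bracket_eq_zero [CompactSpace G] [T2Space G] [ConnectedSpace G]
    (h : ∀ x y, bracket E G x y = 0) (a : G) : AdL a = ContinuousLinearMap.id ℝ E := by
  have hc : CompleteSpace E := FiniteDimensional.complete ℝ E
  obtain ⟨g, hg, g0, g1⟩ := exists_mem_gaugeGroup_eq (E := E) a
  have hRD := hasRD_of_mem_gaugeGroup hg
  have hd : ∀ t ∈ Set.Icc (0 : ℝ) 1,
      HasDerivWithinAt (fun s => AdL (E := E) (pathExt g s)) 0 (Set.Icc 0 1) t := by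
    intro t ht
    have h1 := (hRD ⟨t, ht⟩).hasDerivWithinAt_AdL
    have h2 : adL E G (derivMulInv E g ⟨t, ht⟩) = 0 := by
      ext1 y
      rw [← bracket_eq_adL, h]
      rfl
    rw [h2, ContinuousLinearMap.zero_comp] at h1
    exact h1
  have h2 := eq_of_hasDerivWithinAt hd (fun t _ => hasDerivWithinAt_const t _ (AdL (1 : G)))
    (by rw [← g0]; exact congrArg AdL (pathExt_coe g 0)) (t := 1) ⟨zero_le_one, le_rfl⟩
  rw [← g1, ← pathExt_coe g 1, ← AdL_one (G := G)]
  exact h2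

theorem bracket_eq_zero_of_comm [CompactSpace G] [T2Space G] (h : ∀ a b : G, a * b = b * a)
    (x y : E) : bracket E G x y = 0 := by
  have hc : CompleteSpace E := FiniteDimensional.complete ℝ E
  have h1 := (hasRD_develop G (constPath x) 0).hasDerivWithinAt_AdL
  simp only [AdL_eq_id_of_comm h] at h1
  have h2 := (uniqueDiffOn_Icc (zero_lt_one' ℝ) _ (0 : I).2).eq_deriv _ h1
    (hasDerivWithinAt_const _ _ (ContinuousLinearMap.id ℝ E))
  rw [bracket_eq_adL]
  exact congrArg (fun L : E →L[ℝ] E => L y) h2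

/-- A path from `1` to `b` and its conjugate by `a` have the same logarithmic derivative, as `Ad` is
trivial, and the same starting point; so they agree at time `1`. -/
theorem comm_of_bracket_eq_zero [CompactSpace G] [T2Space G] [ConnectedSpace G]
    (h : ∀ x y, bracket E G x y = 0) (a b : G) : a * b = b * a := by
  obtain ⟨g, hg, g0, g1⟩ := exists_mem_gaugeGroup_eq (E := E) b
  have hRD := hasRD_of_mem_gaugeGroup hg
  have h1 := ((hasRD_const (E := E) a).mul hRD).mul (hasRD_const (E := E) a⁻¹)
  have h2 : HasRD (fun t => a * g t * a⁻¹) (derivMulInv E g) := by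
    refine (congrArg (HasRD fun t => a * g t * a⁻¹) (funext fun t => ?_)).mp h1
    simp only [Pi.zero_apply, map_zero, zero_add, add_zero, AdL_eq_id_of_bracket_eq_zero h]
    rfl
  have h3 := congrFun (h2.eq hRD (by simp [g0])) 1
  rw [← g1]
  exact mul_inv_eq_iff_eq_mul.1 h3

theorem surjective_modChi_of_comm [CompactSpace G] [T2Space G] [ConnectedSpace G]
    (h : ∀ a b : G, a * b = b * a) : Function.Surjective (modChi E G) := by
  rintro ⟨a, ξ⟩
  refine mem_range_modChi_iff.2
    ⟨C1.mk (constPath (inTail ξ)) 0 fun t => hasDerivWithinAt_const _ _ _, fun t i => ?_,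
      fun t => rfl, fun i => rfl⟩
  have h1 : nahmTerm E G (inTail ξ) i = 0 := by
    fin_cases i <;> simp [nahmTerm, bracket_eq_zero_of_comm h]
  exact (zero_add _).trans h1

/-! ### The explicit singular solution -/

theorem nahmTerm_triple {σ₁ σ₂ σ₃ : E} (h12 : bracket E G σ₁ σ₂ = σ₃)
    (h23 : bracket E G σ₂ σ₃ = σ₁) (h31 : bracket E G σ₃ σ₁ = σ₂) :
    nahmTerm E G (![0, σ₁, σ₂, σ₃, 0, 0, 0, 0] : Fin 8 → E) = ![σ₁, σ₂, σ₃, 0, 0, 0, 0] := by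
  have h13 : bracket E G σ₁ σ₃ = -σ₂ := by rw [bracket_swap, h31]
  have h0 : ∀ x : E, bracket E G 0 x = 0 := fun x => by rw [bracket_eq_adL]; simp
  have h0' : ∀ x : E, bracket E G x 0 = 0 := fun x => by rw [bracket_eq_adL]; simp
  funext i
  fin_cases i <;> simp [nahmTerm, h12, h23, h13, h0, h0']

theorem hasDerivAt_triple {σ₁ σ₂ σ₃ : E} (h12 : bracket E G σ₁ σ₂ = σ₃)
    (h23 : bracket E G σ₂ σ₃ = σ₁) (h31 : bracket E G σ₃ σ₁ = σ₂) {t : ℝ} (ht : t < 1)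
    (i : Fin 7) :
    HasDerivAt (fun s : ℝ => (s - 1)⁻¹ • (![σ₁, σ₂, σ₃, 0, 0, 0, 0] : Fin 7 → E) i)
      (-nahmTerm E G ((t - 1)⁻¹ • (![0, σ₁, σ₂, σ₃, 0, 0, 0, 0] : Fin 8 → E)) i) t := by
  have hne : t - 1 ≠ 0 := (sub_neg.2 ht).ne
  have h1 := (((hasDerivAt_id t).sub_const 1).inv hne).smul_const
    ((![σ₁, σ₂, σ₃, 0, 0, 0, 0] : Fin 7 → E) i)
  refine h1.congr_deriv ?_
  rw [nahmTerm_smul, nahmTerm_triple h12 h23 h31, Pi.smul_apply, ← neg_smul]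
  congr 1
  simp only [id, neg_div, one_div, inv_pow]

theorem tendsto_norm_inv_smul {F : Type*} [NormedAddCommGroup F] [NormedSpace ℝ F] {v : F}
    (hv : v ≠ 0) :
    Filter.Tendsto (fun s : ℝ => ‖(s - 1)⁻¹ • v‖) (𝓝[<] 1) Filter.atTop := by
  simp only [norm_smul, norm_inv]
  refine Filter.Tendsto.atTop_mul_const (norm_pos_iff.2 hv) ?_
  have h1 : Filter.Tendsto (fun s : ℝ => ‖s - 1‖) (𝓝[<] 1) (𝓝[>] 0) := by
    refine tendsto_nhdsWithin_iff.2 ⟨?_, ?_⟩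
    · have : Filter.Tendsto (fun s : ℝ => ‖s - 1‖) (𝓝 1) (𝓝 ‖(1 : ℝ) - 1‖) :=
        (by fun_prop : Continuous fun s : ℝ => ‖s - 1‖).tendsto 1
      rw [sub_self, norm_zero] at this
      exact this.mono_left nhdsWithin_le_nhds
    · filter_upwards [self_mem_nhdsWithin] with s hs
      exact norm_pos_iff.2 (sub_ne_zero.2 (ne_of_lt hs))
  exact tendsto_inv_nhdsGT_zero.comp h1

end Image

end

end OctonionicNahm

namespace OctonionicNahm

noncomputable section

/-! ### Blow-up of solutions -/

/-- The differential inequality behind the blow-up: if `N' = 2 P` and `P' = 3 K` with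
`P ^ 2 ≤ N K`, then `N / P` decreases with slope at most `-1`. -/
theorem lt_of_hasDerivWithinAt_blowup {N P K : ℝ → ℝ}
    (hN : ∀ t ∈ Set.Icc (0 : ℝ) 1, HasDerivWithinAt N (2 * P t) (Set.Icc 0 1) t)
    (hP : ∀ t ∈ Set.Icc (0 : ℝ) 1, HasDerivWithinAt P (3 * K t) (Set.Icc 0 1) t)
    (hK : ∀ t ∈ Set.Icc (0 : ℝ) 1, 0 ≤ K t) (hN0 : ∀ t ∈ Set.Icc (0 : ℝ) 1, 0 ≤ N t)
    (hcs : ∀ t ∈ Set.Icc (0 : ℝ) 1, P t ^ 2 ≤ N t * K t) (h0 : 0 < P 0) : P 0 < N 0 := by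
  have m0 : (0 : ℝ) ∈ Set.Icc (0 : ℝ) 1 := ⟨le_rfl, zero_le_one⟩
  have m1 : (1 : ℝ) ∈ Set.Icc (0 : ℝ) 1 := ⟨zero_le_one, le_rfl⟩
  have hPm : MonotoneOn P (Set.Icc 0 1) := monotoneOn_of_hasDerivWithinAt_nonneg (convex_Icc 0 1)
    (fun t ht => (hP t ht).continuousWithinAt)
    (fun t ht => (hP t (interior_subset ht)).mono interior_subset)
    fun t ht => mul_nonneg (by norm_num) (hK t (interior_subset ht))
  have hPpos : ∀ t ∈ Set.Icc (0 : ℝ) 1, 0 < P t := fun t ht => h0.trans_le (hPm m0 ht ht.1)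
  -- This derivative equals `3 - 3NK/P²`, which is nonpositive by Cauchy–Schwarz.
  have hF : ∀ t ∈ Set.Icc (0 : ℝ) 1, HasDerivWithinAt (fun s => N s / P s + s)
      ((2 * P t * P t - N t * (3 * K t)) / P t ^ 2 + 1) (Set.Icc 0 1) t := fun t ht =>
    ((hN t ht).div (hP t ht) (hPpos t ht).ne').add (hasDerivWithinAt_id t _)
  have hFm : AntitoneOn (fun s => N s / P s + s) (Set.Icc 0 1) :=
    antitoneOn_of_hasDerivWithinAt_nonpos (convex_Icc 0 1)
      (fun t ht => (hF t ht).continuousWithinAt)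
      (fun t ht => (hF t (interior_subset ht)).mono interior_subset) fun t ht => by
        have h1 := hcs t (interior_subset ht)
        have h2 := hPpos t (interior_subset ht)
        rw [div_add_one (by positivity)]
        exact div_nonpos_of_nonpos_of_nonneg (by nlinarith) (by positivity)
  have h1 : N 1 / P 1 + 1 ≤ N 0 / P 0 + 0 := hFm m0 m1 zero_le_one
  have h2 : 0 < N 1 := by
    refine (hN0 1 m1).lt_of_ne fun h => ?_
    have := hcs 1 m1
    rw [← h, zero_mul] at this
    exact absurd this (not_le.2 (pow_pos (hPpos 1 m1) 2))
  have h3 : 0 < N 1 / P 1 := div_pos h2 (hPpos 1 m1)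
  have h4 : 1 < N 0 / P 0 := by linarith
  exact (one_lt_div h0).1 h4

/-! ### Invariant inner products on the Lie algebra -/

section InnerProduct

universe u

variable {E : Type u} [NormedAddCommGroup E] [NormedSpace ℝ E] [FiniteDimensional ℝ E]
variable {G : Type*} [TopologicalSpace G] [ChartedSpace E G] [Group G]
variable [LieGroup 𝓘(ℝ, E) ∞ G] [CompactSpace G]

variable (E G) in
/-- A compact Lie group has an invariant inner product on its Lie algebra. -/
theorem exists_invariant_inner : ∃ β : E →L[ℝ] E →L[ℝ] ℝ, (∀ x y, β x y = β y x) ∧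
    (∀ x, x ≠ 0 → 0 < β x x) ∧ ∀ (g : G) x y, β (AdL g x) (AdL g y) = β x y := by
  have htop := isTopologicalGroup E G
  let _ : MeasurableSpace G := borel G
  have _ : BorelSpace G := ⟨rfl⟩
  set μ : MeasureTheory.Measure G := MeasureTheory.Measure.haar
  set ι : E ≃L[ℝ] EuclideanSpace ℝ (Fin (Module.finrank ℝ E)) := toEuclidean with hι
  -- An arbitrary inner product is averaged over Haar measure. The inverse in `AdL h⁻¹` turns the
  -- action of `g` into left translation by `g⁻¹`.
  set F : E → E → G → ℝ := fun x y h => inner ℝ (ι (AdL h⁻¹ x)) (ι (AdL h⁻¹ y)) with hF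
  have hc : ∀ x : E, Continuous fun h : G => ι (AdL h⁻¹ x) := fun x =>
    ι.continuous.comp (((continuous_AdL (E := E)).comp continuous_inv).clm_apply continuous_const)
  have hFc : ∀ x y, Continuous (F x y) := fun x y => (hc x).inner (hc y)
  have hFi : ∀ x y, MeasureTheory.Integrable (F x y) μ := fun x y =>
    (hFc x y).integrable_of_hasCompactSupport (HasCompactSupport.of_compactSpace _)
  let B : E →ₗ[ℝ] E →ₗ[ℝ] ℝ := LinearMap.mk₂ ℝ (fun x y => ∫ h, F x y h ∂μ)
    (fun x x' y => by
      rw [← MeasureTheory.integral_add (hFi _ _) (hFi _ _)]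
      simp only [hF, map_add, inner_add_left])
    (fun c x y => by
      rw [smul_eq_mul, ← MeasureTheory.integral_const_mul]
      simp only [hF, map_smul, real_inner_smul_left])
    (fun x y y' => by
      rw [← MeasureTheory.integral_add (hFi _ _) (hFi _ _)]
      simp only [hF, map_add, inner_add_right])
    (fun c x y => by
      rw [smul_eq_mul, ← MeasureTheory.integral_const_mul]
      simp only [hF, map_smul, real_inner_smul_right])
  refine ⟨LinearMap.toContinuousLinearMap
    ((LinearMap.toContinuousLinearMap : (E →ₗ[ℝ] ℝ) ≃ₗ[ℝ] _).toLinearMap.comp B), ?_, ?_, ?_⟩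
  · intro x y
    change ∫ h, F x y h ∂μ = ∫ h, F y x h ∂μ
    simp only [hF, real_inner_comm]
  · intro x hx
    change 0 < ∫ h, F x x h ∂μ
    refine (hFc x x).integral_pos_of_hasCompactSupport_nonneg_nonzero
      (HasCompactSupport.of_compactSpace _) (fun h => real_inner_self_nonneg) (x := 1) ?_
    simp only [hF]
    rw [inv_one, AdL_one]
    simpa using hx
  · intro g x y
    change ∫ h, F (AdL g x) (AdL g y) h ∂μ = ∫ h, F x y h ∂μ
    rw [← MeasureTheory.integral_mul_left_eq_self (F x y) g⁻¹]
    simp only [hF, mul_inv_rev, inv_inv, AdL_mul_apply]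

variable [T2Space G]

/-- The derivative of the constant `β (Ad(γ) x) (Ad(γ) y)` along a path `γ` from `1` with initial
velocity `u`. -/
theorem bracket_invariant {β : E →L[ℝ] E →L[ℝ] ℝ}
    (hβ : ∀ (g : G) x y, β (AdL g x) (AdL g y) = β x y) (u x y : E) :
    β (bracket E G u x) y + β x (bracket E G u y) = 0 := by
  have hc : CompleteSpace E := FiniteDimensional.complete ℝ E
  have h1 := (hasRD_develop G (constPath u) 0).hasDerivWithinAt_AdL
  have hx := h1.clm_apply (hasDerivWithinAt_const _ _ x)
  have hy := h1.clm_apply (hasDerivWithinAt_const _ _ y)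
  have h2 := ((β.hasFDerivAt (x := _)).comp_hasDerivWithinAt _ hx).clm_apply hy
  simp only [Function.comp_apply, hβ, pathExt_coe, develop_zero, AdL_one] at h2
  have h3 := (uniqueDiffOn_Icc (zero_lt_one' ℝ) _ (0 : I).2).eq_deriv _ h2
    (hasDerivWithinAt_const _ _ (β x y))
  simpa [bracket_eq_adL] using h3

end InnerProduct

end

end OctonionicNahm

namespace OctonionicNahm

noncomputable section

/-! ### The cubic form of the Nahm equations -/

section Blowup

universe u

variable {E : Type u} [NormedAddCommGroup E] [NormedSpace ℝ E] [FiniteDimensional ℝ E]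
variable {G : Type*} [TopologicalSpace G] [ChartedSpace E G] [Group G]
variable [LieGroup 𝓘(ℝ, E) ∞ G]

/-- The pairing of two elements of `𝔤 ⊗ ℝ⁷` induced by a bilinear form on `𝔤`. -/
def pairing (β : E →L[ℝ] E →L[ℝ] ℝ) (x y : Fin 7 → E) : ℝ := ∑ i, β (x i) (y i)

theorem pairing_sq_le {β : E →L[ℝ] E →L[ℝ] ℝ} (hs : ∀ x y, β x y = β y x)
    (hp : ∀ x, 0 ≤ β x x) (x y : Fin 7 → E) :
    pairing β x y ^ 2 ≤ pairing β x x * pairing β y y := by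
  have key : ∀ c : ℝ, 0 ≤ pairing β y y * (c * c) + 2 * pairing β x y * c + pairing β x x := by
    intro c
    have h1 : pairing β y y * (c * c) + 2 * pairing β x y * c + pairing β x x =
        ∑ i, β (x i + c • y i) (x i + c • y i) := by
      simp only [pairing, Finset.mul_sum, Finset.sum_mul, ← Finset.sum_add_distrib]
      refine Finset.sum_congr rfl fun i _ => ?_
      simp only [map_add, map_smul, add_apply, smul_apply, smul_eq_mul, hs (y i) (x i)]
      ring
    rw [h1]
    exact Finset.sum_nonneg fun i _ => hp _
  have h2 := discrim_le_zero key
  rw [discrim] at h2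
  linarith

/-- By invariance `β(x_i, [x_j, x_k])` is totally antisymmetric, as are the structure constants, so
`⟨x, Q(x)⟩` comes from a symmetric trilinear form. Hence varying the two arguments inside `Q`
contributes twice what varying the outer one does. -/
theorem pairing_nahmBil {β : E →L[ℝ] E →L[ℝ] ℝ} (hs : ∀ x y, β x y = β y x)
    (hinv : ∀ u x y, β (bracket E G u x) y + β x (bracket E G u y) = 0)
    {x v : Fin 8 → E} (hx : x 0 = 0) (hv : v 0 = 0) :
    pairing β (tailL x) (nahmBil E G x v + nahmBil E G v x) =
      2 * pairing β (tailL v) (nahmTerm E G x) := by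
  have c1 : ∀ i j k, β (x i) (bracket E G (x j) (v k)) = β (v k) (bracket E G (x i) (x j)) := by
    intro i j k
    have h1 := hinv (x j) (x i) (v k)
    rw [bracket_swap (x j) (x i), map_neg, neg_apply, hs (bracket E G (x i) (x j))] at h1
    linarith
  have c2 : ∀ i j k, β (x i) (bracket E G (v k) (x j)) = -β (v k) (bracket E G (x i) (x j)) := by
    intro i j k
    rw [bracket_swap, map_neg, c1]
  -- The condition `j < i` orients the rewriting, so that brackets are brought to increasing order
  -- and `simp` terminates.
  have sw : ∀ i j, j < i → bracket E G (x i) (x j) = -bracket E G (x j) (x i) := fun i j _ =>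
    bracket_swap _ _
  have h0 : ∀ y : E, bracket E G 0 y = 0 := fun y => by rw [bracket_eq_adL]; simp
  simp only [pairing, Fin.sum_univ_seven, Pi.add_apply, tailL_apply, nahmBil, nahmTerm,
    LinearMap.coe_toContinuousLinearMap', LinearMap.comp_apply, LinearEquiv.coe_coe,
    LinearMap.mk₂_apply, Fin.reduceSucc]
  simp only [Matrix.cons_val, hx, hv, h0, map_add, map_sub, map_zero, c1, c2]
  simp (discharger := decide) only [sw, map_neg]
  ring

variable [CompactSpace G] [T2Space G]

/-- Solutions with `X_0 = 0` whose initial value is too large blow up before time `1`. -/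
theorem neg_pairing_lt {β : E →L[ℝ] E →L[ℝ] ℝ} (hs : ∀ x y, β x y = β y x)
    (hp : ∀ x, 0 ≤ β x x)
    (hinv : ∀ u x y, β (bracket E G u x) y + β x (bracket E G u y) = 0)
    {X : V E} (hX : X ∈ solutions E G) (hX0 : ∀ t, value X t 0 = 0)
    (hpos : 0 < -pairing β (tailL (value X 0)) (nahmTerm E G (value X 0))) :
    -pairing β (tailL (value X 0)) (nahmTerm E G (value X 0)) <
      pairing β (tailL (value X 0)) (tailL (value X 0)) := by
  have hv0 : ∀ t, velocity X t 0 = 0 := by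
    have h1 : head X = 0 := C1.ext_val fun t => hX0 t
    exact fun t => congrArg (fun y : C1 E => C1.der y t) h1
  have hvel : ∀ t, tailL (velocity X t) = -nahmTerm E G (value X t) := fun t =>
    funext fun i => eq_neg_of_add_eq_zero_left (hX t i)
  set x : ℝ → Fin 8 → E := pathExt (value X) with hx
  have hx' : ∀ t : I, x t = value X t := pathExt_coe _
  have hx0 : x 0 = value X 0 := hx' 0
  have hder : ∀ t : I, HasDerivWithinAt x (velocity X t) (Set.Icc 0 1) t :=
    C1.hasDerivWithinAt X
  have hpair : ∀ (a b : ℝ → Fin 7 → E) (a' b' : Fin 7 → E) (t : ℝ),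
      HasDerivWithinAt a a' (Set.Icc 0 1) t → HasDerivWithinAt b b' (Set.Icc 0 1) t →
      HasDerivWithinAt (fun s => pairing β (a s) (b s))
        (pairing β a' (b t) + pairing β (a t) b') (Set.Icc 0 1) t := by
    intro a b a' b' t ha hb
    simp only [pairing, ← Finset.sum_add_distrib]
    refine HasDerivWithinAt.fun_sum fun i _ => ?_
    exact (β.hasFDerivAt.comp_hasDerivWithinAt t (hasDerivWithinAt_pi.1 ha i)).clm_apply
      (hasDerivWithinAt_pi.1 hb i)
  have hsym : ∀ a b, pairing β a b = pairing β b a := fun a b =>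
    Finset.sum_congr rfl fun i _ => hs _ _
  have hneg : ∀ a b, pairing β (-a) b = -pairing β a b := fun a b => by
    simp [pairing]
  have hnn : ∀ a, 0 ≤ pairing β a a := fun a => Finset.sum_nonneg fun i _ => hp _
  have htail : ∀ t : I, HasDerivWithinAt (fun s => tailL (x s)) (-nahmTerm E G (x t))
      (Set.Icc 0 1) t := fun t => by
    rw [hx', ← hvel]
    exact tailL.hasFDerivAt.comp_hasDerivWithinAt (t : ℝ) (hder t)
  have hQ : ∀ t : I, HasDerivWithinAt (fun s => nahmTerm E G (x s))
      (nahmBil E G (x t) (velocity X t) + nahmBil E G (velocity X t) (x t)) (Set.Icc 0 1) t :=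
    fun t => (hasFDerivAt_nahmTerm (x t)).comp_hasDerivWithinAt (t : ℝ) (hder t)
  have hmain := lt_of_hasDerivWithinAt_blowup
    (N := fun s => pairing β (tailL (x s)) (tailL (x s)))
    (P := fun s => -pairing β (tailL (x s)) (nahmTerm E G (x s)))
    (K := fun s => pairing β (nahmTerm E G (x s)) (nahmTerm E G (x s)))
    (fun t ht => by
      have h1 := hpair _ _ _ _ t (htail ⟨t, ht⟩) (htail ⟨t, ht⟩)
      refine h1.congr_deriv ?_
      rw [hsym (tailL (x t)), hneg, hsym (nahmTerm E G (x t))]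
      ring)
    (fun t ht => by
      have h1 := (hpair _ _ _ _ t (htail ⟨t, ht⟩) (hQ ⟨t, ht⟩)).neg
      refine h1.congr_deriv ?_
      have h2 : x t 0 = 0 := by rw [hx' ⟨t, ht⟩, hX0]
      have h3 := hvel ⟨t, ht⟩
      rw [← hx' ⟨t, ht⟩] at h3
      rw [pairing_nahmBil hs hinv h2 (hv0 _), h3, hneg]
      ring)
    (fun t _ => hnn _) (fun t _ => hnn _)
    (fun t _ => by rw [neg_sq]; exact pairing_sq_le hs hp _ _)
    (by simpa only [hx0] using hpos)
  simpa only [hx0] using hmain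

variable [ConnectedSpace G]

/-- If `z = [x, y] ≠ 0`, surjectivity provides a solution starting at `c(x, y, -z, 0, 0, 0, 0)`. The
sign of `z` makes the cubic quantity equal to the positive number `3c³ β(z, z)`, which outgrows the
squared norm `c² m`. -/
theorem bracket_eq_zero_of_surjective (h : Function.Surjective (modChi E G)) (x y : E) :
    bracket E G x y = 0 := by
  obtain ⟨β, hs, hp, hinv⟩ := exists_invariant_inner E G
  have hp' : ∀ x, 0 ≤ β x x := fun x => by
    rcases eq_or_ne x 0 with rfl | hx
    · simp
    · exact (hp x hx).le
  by_contra hz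
  set z := bracket E G x y with hzd
  have hzz := hp z hz
  have hb := bracket_invariant hinv
  set m : ℝ := β x x + β y y + β z z with hm
  have hm0 : 0 ≤ m := add_nonneg (add_nonneg (hp' x) (hp' y)) (hp' z)
  -- Large enough that `m ≤ 3c β(z, z)`, which contradicts the bound of `neg_pairing_lt`.
  set c : ℝ := m / β z z + 1 with hc
  have hc0 : 0 < c := by positivity
  have hcm : m ≤ 3 * c * β z z := by
    have h1 : c * β z z = m + β z z := by rw [hc]; field_simp
    nlinarith
  obtain ⟨X, hX, hX0, hXξ⟩ := mem_range_modChi_iff.1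
    (h ((1 : G), c • (![x, y, -z, 0, 0, 0, 0] : Fin 7 → E)))
  have hval : value X 0 = c • (![0, x, y, -z, 0, 0, 0, 0] : Fin 8 → E) := by
    funext j
    refine Fin.cases ?_ (fun i => ?_) j
    · rw [hX0]; simp
    · rw [hXξ]; rfl
  have h0 : ∀ x : E, bracket E G 0 x = 0 := fun x => by rw [bracket_eq_adL]; simp
  have h0' : ∀ x : E, bracket E G x 0 = 0 := fun x => by rw [bracket_eq_adL]; simp
  have hcyc : β x (bracket E G y z) = β z z := by
    have := hb y x z
    rw [bracket_swap y x, ← hzd, map_neg, neg_apply] at this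
    linarith
  have hcyc' : β y (bracket E G x z) = -β z z := by
    have := hb x y z
    rw [← hzd] at this
    linarith
  have hn : ∀ a, bracket E G a (-z) = -bracket E G a z := fun a => by
    rw [bracket_eq_adL, bracket_eq_adL, map_neg]
  have hN : pairing β (tailL (value X 0)) (tailL (value X 0)) = c ^ 2 * m := by
    rw [hval]
    simp [pairing, Fin.sum_univ_seven, hm]
    ring
  have hP : -pairing β (tailL (value X 0)) (nahmTerm E G (value X 0)) =
      3 * c ^ 3 * β z z := by
    rw [hval, nahmTerm_smul]
    simp [pairing, Fin.sum_univ_seven, nahmTerm, h0, h0', hn, hcyc, hcyc', ← hzd]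
    ring
  have hlt := neg_pairing_lt hs hp' hb hX hX0 (by rw [hP]; positivity)
  rw [hN, hP] at hlt
  have h2 : c ^ 2 * m ≤ c ^ 2 * (3 * c * β z z) := by gcongr
  nlinarith

/-- The borderline case: both sides of the strict inequality `neg_pairing_lt` equal `3 β(σ₃, σ₃)`,
since invariance gives the three `σ_i` equal length. -/
theorem neg_triple_notMem_range {σ₁ σ₂ σ₃ : E} (hσ : σ₁ ≠ 0) (h12 : bracket E G σ₁ σ₂ = σ₃)
    (h23 : bracket E G σ₂ σ₃ = σ₁) (h31 : bracket E G σ₃ σ₁ = σ₂) (a : G) :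
    (a, -(![σ₁, σ₂, σ₃, 0, 0, 0, 0] : Fin 7 → E)) ∉ Set.range (modChi E G) := by
  intro hmem
  obtain ⟨β, hs, hp, hinv⟩ := exists_invariant_inner E G
  have hp' : ∀ x, 0 ≤ β x x := fun x => by
    rcases eq_or_ne x 0 with rfl | hx
    · simp
    · exact (hp x hx).le
  have hb := bracket_invariant hinv
  obtain ⟨X, hX, hX0, hXξ⟩ := mem_range_modChi_iff.1 hmem
  have hval : value X 0 = (-1 : ℝ) • (![0, σ₁, σ₂, σ₃, 0, 0, 0, 0] : Fin 8 → E) := by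
    funext j
    refine Fin.cases ?_ (fun i => ?_) j
    · rw [hX0]; simp
    · rw [hXξ, neg_one_smul]; rfl
  have e1 : β σ₁ σ₁ = β σ₃ σ₃ := by
    have := hb σ₂ σ₁ σ₃
    rw [h23, bracket_swap σ₂ σ₁, h12, map_neg, neg_apply] at this
    linarith
  have e2 : β σ₂ σ₂ = β σ₃ σ₃ := by
    have := hb σ₁ σ₂ σ₃
    rw [h12, bracket_swap σ₁ σ₃, h31, map_neg] at this
    linarith
  have hN : pairing β (tailL (value X 0)) (tailL (value X 0)) = 3 * β σ₃ σ₃ := by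
    rw [hval]
    simp [pairing, Fin.sum_univ_seven, e1, e2]
    ring
  have hP : -pairing β (tailL (value X 0)) (nahmTerm E G (value X 0)) = 3 * β σ₃ σ₃ := by
    rw [hval, nahmTerm_smul, nahmTerm_triple h12 h23 h31]
    simp [pairing, Fin.sum_univ_seven, e1, e2]
    ring
  have hpos := hp σ₁ hσ
  rw [e1] at hpos
  have hlt := neg_pairing_lt hs hp' hb hX hX0 (by rw [hP]; positivity)
  rw [hN, hP] at hlt
  exact lt_irrefl _ hlt

end Blowup

end

end OctonionicNahm

theorem mainTheorem2
    (E : Type*) [NormedAddCommGroup E] [NormedSpace ℝ E] [FiniteDimensional ℝ E]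
    (G : Type*) [TopologicalSpace G] [ChartedSpace E G] [Group G] [LieGroup 𝓘(ℝ, E) ∞ G]
    [T2Space G] [CompactSpace G] [ConnectedSpace G] :
    -- for every solution there is exactly one gauge transformation with `g 0 = 1` killing `X_0`
    (∀ X : OctonionicNahm.solutions E G, ∃! g : I → G, g ∈ OctonionicNahm.gaugeGroup E G ∧
      g 0 = 1 ∧ ∀ t : I, OctonionicNahm.gaugeAct g (OctonionicNahm.value X.1) t 0 = 0) ∧
    ∃ χ : OctonionicNahm.Moduli E G → G × (Fin 7 → E),
      -- the map `χ`
      (∀ (X : OctonionicNahm.solutions E G) (g : I → G), g ∈ OctonionicNahm.gaugeGroup E G →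
        g 0 = 1 → (∀ t : I, OctonionicNahm.gaugeAct g (OctonionicNahm.value X.1) t 0 = 0) →
        χ (OctonionicNahm.Moduli.mk X) = (g 1, fun i : Fin 7 => OctonionicNahm.value X.1 0 i.succ)) ∧
      -- the moduli space is a smooth quotient manifold
      (∃ c : ChartedSpace (E × (Fin 7 → E)) (OctonionicNahm.Moduli E G),
        OctonionicNahm.IsQuotientStructure E G c) ∧
      -- `χ` is a diffeomorphism onto an open set containing `G × {0}`
      (∀ c : ChartedSpace (E × (Fin 7 → E)) (OctonionicNahm.Moduli E G),
        OctonionicNahm.IsQuotientStructure E G c →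
        ∃ W : TopologicalSpace.Opens (G × (Fin 7 → E)),
          (∀ a : G, (a, (0 : Fin 7 → E)) ∈ W) ∧
          ∃ Φ : Diffeomorph 𝓘(ℝ, E × (Fin 7 → E)) (𝓘(ℝ, E).prod 𝓘(ℝ, Fin 7 → E))
            (OctonionicNahm.Moduli E G) W ∞,
            ∀ m : OctonionicNahm.Moduli E G, (Φ m : G × (Fin 7 → E)) = χ m) ∧
      -- `χ` is surjective if and only if `G` is abelian
      (Function.Surjective χ ↔ ∀ a b : G, a * b = b * a) ∧
      -- blow-up example for a triple spanning a copy of `su(2)`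
      (∀ σ₁ σ₂ σ₃ : E, σ₁ ≠ 0 → OctonionicNahm.bracket E G σ₁ σ₂ = σ₃ →
        OctonionicNahm.bracket E G σ₂ σ₃ = σ₁ → OctonionicNahm.bracket E G σ₃ σ₁ = σ₂ →
        (∀ t : ℝ, t < 1 → ∀ i : Fin 7,
          HasDerivAt (fun s : ℝ => (s - 1)⁻¹ • (![σ₁, σ₂, σ₃, 0, 0, 0, 0] : Fin 7 → E) i)
            (-OctonionicNahm.nahmTerm E G
              ((t - 1)⁻¹ • (![0, σ₁, σ₂, σ₃, 0, 0, 0, 0] : Fin 8 → E)) i) t) ∧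
        Filter.Tendsto (fun s : ℝ => ‖(s - 1)⁻¹ • (![σ₁, σ₂, σ₃, 0, 0, 0, 0] : Fin 7 → E)‖)
          (𝓝[<] 1) Filter.atTop ∧
        ∀ a : G, (a, -(![σ₁, σ₂, σ₃, 0, 0, 0, 0] : Fin 7 → E)) ∉ Set.range χ) ∧
      -- the image of `χ` is star-shaped with respect to the origin of `𝔤 ⊗ ℝ⁷`
      (∀ a : G, StarConvex ℝ 0 {ξ : Fin 7 → E | (a, ξ) ∈ Set.range χ}) := by
  refine ⟨fun X => OctonionicNahm.existsUnique_killGauge X.1, OctonionicNahm.modChi E G,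
    fun X g hg h0 h => OctonionicNahm.modChi_eq hg h0 h,
    OctonionicNahm.exists_isQuotientStructure, fun c hc => ?_, ?_,
    fun σ₁ σ₂ σ₃ hσ h12 h23 h31 => ?_, OctonionicNahm.starConvex_range_modChi⟩
  · exact ⟨⟨Set.range (OctonionicNahm.modChi E G),
      OctonionicNahm.isOpenEmbedding_modChi.isOpen_range⟩,
      OctonionicNahm.mem_range_modChi_zero, OctonionicNahm.exists_diffeomorph c hc _ rfl⟩
  · exact ⟨fun h => OctonionicNahm.comm_of_bracket_eq_zero
      (OctonionicNahm.bracket_eq_zero_of_surjective h),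
      OctonionicNahm.surjective_modChi_of_comm⟩
  · exact ⟨fun t ht i => OctonionicNahm.hasDerivAt_triple h12 h23 h31 ht i,
      OctonionicNahm.tendsto_norm_inv_smul fun h => hσ (congrFun h 0),
      OctonionicNahm.neg_triple_notMem_range hσ h12 h23 h31⟩
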